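/- **Setting.** Let $T>0$, let $(\Omega,\mathcal F,\mathbb P)$ be a probability space with a normal filtration $(\mathcal F_t)_{t\in[0,T]}$ (right-continuous, and $\mathcal F_0$ contains all $\mathbb P$-null sets of $\mathcal F$), and let $U,H$ be separable real Hilbert spaces. Let $W=(W_{h;t})_{h\in U,\,t\in[0,T]}$ be a generalised Wiener process on $U$ with respect to $(\mathcal F_t)$ with covariance operator $Q$: $h\mapsto W_{h;t}$ is linear and mean-square continuous, each $W_{h;\cdot}$ is a real Wiener process (adapted, started at $0$, with continuous paths and centred Gaussian increments on $[s,t]$, of variance proportional to $t-s$ and independent of $\mathcal F_s$), and $\mathbb E[W_{h;t}W_{g;s}]=(t\wedge s)\langle Qh,g\rangle_U$ with $Q\in L(U)$ symmetric and non-negative. Let $U_0:=Q^{1/2}(U)$ be the Hilbert space with inner product $\langle Q^{-1/2}x,Q^{-1/2}y\rangle_U$ ($Q^{-1/2}$ the pseudo-inverse), and let $\varphi:[0,T]\times\Omega\to L_2(U_0;H)$ be a predictable process of Hilbert--Schmidt operators with $$\mathbb P\Big[\int_0^T\|\varphi_t\|_{L_2(U_0;H)}^2\,dt<\infty\Big]=1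 .$$ **Hilbert--Schmidt extensions.** Let $U_1$ be a separable Hilbert space, $\iota:U_0\to U_1$ an injective Hilbert--Schmidt operator, and $Q_1:=\iota\iota^*\in L(U_1)$, with adjoint taken for $\iota:U_0\to U_1$; $Q_1^{1/2}(U_1)$ carries the inner product $\langle Q_1^{-1/2}x,Q_1^{-1/2}y\rangle_{U_1}$. An adapted continuous $U_1$-valued process $W^{1}$ represents $W$ in $U_1$ if, for some orthonormal basis $(f_k)$ of $U_0$ and some independent standard real $(\mathcal F_t)$-Brownian motions $(\beta^k)$, one has $W_{h;t}=\sum_k\beta^k_t\langle f_k,h\rangle_U$ for all $h\in U$ and $W^1_t=\sum_k\beta^k_t\,\iota f_k$ for all $t$, both in mean square. **The integral with respect to a $Q_1$-Wiener process.** If $W^1$ is a $Q_1$-Wiener process in $U_1$ and $\psi$ is predictable with $\mathbb E\int_0^T\|\psi_t\|^2_{L_2(Q_1^{1/2}(U_1);H)}dt<\infty$, then $\int_0^\cdot\psi\,dW^1$ is the limit, in the norm $\sup_{t\le T}\mathbb E[\|\cdot\|_H^2]^{1/2}$, of the elementary integrals of simple $L(U_1;H)$-valued processes converging to $\psi$ in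 $L^2([0,T]\times\Omega;L_2(Q_1^{1/2}(U_1);H))$. If $\psi$ is predictable and only almost surely square integrable in time, $\int_0^\cdot\psi\,dW^1$ is an adapted continuous process $M$ such that, for some non-decreasing sequence of $[0,T]\cup\{\infty\}$-valued stopping times $\tau_n$ which almost surely equal $\infty$ for large $n$, each $\mathbf 1_{[0,\tau_n]}\psi$ is square integrable on $[0,T]\times\Omega$ and $M_{\cdot\wedge\tau_n}=\int_0^\cdot\mathbf 1_{[0,\tau_n]}\psi\,dW^1$. **Theorem.** For every such $(U_1,\iota)$: 1. There is a process $W^1$ which represents $W$ in $U_1$, and each such process is a $Q_1$-Wiener process with respect to $(\mathcal F_t)$. 2. The process $\varphi\circ\iota^{-1}$ is well defined with values in $L_2(Q_1^{1/2}(U_1);H)$, is predictable, and is almost surely square integrable in time. 3. For each $W^1$ as in 1 the stochastic integral $$\varphi\bullet W_t:=\int_0^t(\varphi_s\circ\iota^{-1})\,dW^1_s,\qquad t\in[0,T],$$ exists and is a continuous, $H$-valued, locally square integrable local martingale which is $0$ at time $0$. 4. The integral is unique up to indistinguishability, and independent of the choice of $U_1$ and $\iota$: if $(U_1,\iota_1)$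 and $(U_2,\iota_2)$ are two such choices, $W^1$, $W^2$ represent $W$ in $U_1$, $U_2$, and $M_1$, $M_2$ are versions of $\int(\varphi\circ\iota_1^{-1})\,dW^1$ and $\int(\varphi\circ\iota_2^{-1})\,dW^2$, then $\mathbb P[M_1(t)=M_2(t)\text{ for all }t\in[0,T]]=1$. -/

import Mathlib

open MeasureTheory ProbabilityTheory Filter Topology
open scoped ENNReal InnerProductSpace

set_option linter.unusedSectionVars false

noncomputable section

namespace GenWiener

universe u v w

/-! ### Square roots, images of operators, Hilbert-Schmidt operators -/

section Operators

variable {E : Type u} [NormedAddCommGroup E] [InnerProductSpace ℝ E] [CompleteSpace E]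
variable {F : Type v} [NormedAddCommGroup F] [InnerProductSpace ℝ F] [CompleteSpace F]

open Classical in
/-- The square root `Q^{1/2}`: the (unique) non-negative symmetric operator whose square is `Q`.
It exists for every non-negative symmetric bounded `Q`; for other `Q` without such a root the
value is `0`. -/
def opSqrt (Q : E →L[ℝ] E) : E →L[ℝ] E :=
  if h : ∃ S : E →L[ℝ] E, S.IsPositive ∧ S ∘L S = Q then h.choose else 0

/-- The image `S(E)` of a bounded operator `S : E → F`, as a vector space. It is given below the
Hilbert space structure `⟪x, y⟫ = ⟪S⁻¹ x, S⁻¹ y⟫`, with `S⁻¹` the pseudo-inverse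
(and not the one inherited from `F`). -/
def ImageSpace (S : E →L[ℝ] F) : Type v := LinearMap.range (S : E →ₗ[ℝ] F)

namespace ImageSpace

variable (S : E →L[ℝ] F)

instance : AddCommGroup (ImageSpace S) :=
  inferInstanceAs (AddCommGroup (LinearMap.range (S : E →ₗ[ℝ] F)))

instance : Module ℝ (ImageSpace S) :=
  inferInstanceAs (Module ℝ (LinearMap.range (S : E →ₗ[ℝ] F)))

/-- The inclusion `S(E) ⊆ F`, as a linear map. -/
def inclₗ : ImageSpace S →ₗ[ℝ] F := (LinearMap.range (S : E →ₗ[ℝ] F)).subtype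

/-- `S` restricts to a linear bijection from `(ker S)ᗮ` onto `S(E)`. -/
def equivOrtho : (LinearMap.ker (S : E →ₗ[ℝ] F))ᗮ ≃ₗ[ℝ] ImageSpace S :=
  haveI : CompleteSpace (LinearMap.ker (S : E →ₗ[ℝ] F)) := S.isClosed_ker.completeSpace_coe
  LinearMap.kerComplementEquivRange (S : E →ₗ[ℝ] F)
    (Submodule.isCompl_orthogonal (LinearMap.ker (S : E →ₗ[ℝ] F))).symm

/-- The pseudo-inverse of `S`, on the image of `S`. -/
def pinv : ImageSpace S →ₗ[ℝ] E :=
  (LinearMap.ker (S : E →ₗ[ℝ] F))ᗮ.subtype ∘ₗ (equivOrtho S).symm.toLinearMap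

lemma pinv_mem (y : ImageSpace S) : pinv S y ∈ (LinearMap.ker (S : E →ₗ[ℝ] F))ᗮ :=
  ((equivOrtho S).symm y).2

lemma apply_pinv (y : ImageSpace S) : S (pinv S y) = inclₗ S y :=
  congrArg Subtype.val ((equivOrtho S).apply_symm_apply y)

lemma pinv_injective : Function.Injective (pinv S) :=
  Subtype.val_injective.comp (equivOrtho S).symm.injective

/-- `pinv S y` is the preimage of `y` of minimal norm. -/
lemma norm_pinv_le (y : ImageSpace S) (x : E) (hx : S x = inclₗ S y) : ‖pinv S y‖ ≤ ‖x‖ := by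
  have hk : x - pinv S y ∈ LinearMap.ker (S : E →ₗ[ℝ] F) := by
    simp [hx, apply_pinv]
  have h0 : ⟪x - pinv S y, pinv S y⟫_ℝ = 0 := pinv_mem S y _ hk
  have h1 : ‖x‖ ^ 2 = ‖x - pinv S y‖ ^ 2 + ‖pinv S y‖ ^ 2 := by
    have := norm_add_sq_real (x - pinv S y) (pinv S y)
    rw [h0] at this
    simpa using this
  nlinarith [sq_nonneg ‖x - pinv S y‖, norm_nonneg x, norm_nonneg (pinv S y)]

instance : NormedAddCommGroup (ImageSpace S) :=
  NormedAddCommGroup.induced (ImageSpace S) E (pinv S) (pinv_injective S)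

lemma norm_def (x : ImageSpace S) : ‖x‖ = ‖pinv S x‖ := rfl

instance : InnerProductSpace ℝ (ImageSpace S) where
  norm_smul_le a x := by simp [norm_def, norm_smul]
  inner x y := ⟪pinv S x, pinv S y⟫_ℝ
  norm_sq_eq_re_inner x := by simp [norm_def]
  conj_inner_symm x y := by simp [real_inner_comm]
  add_left x y z := by simp [inner_add_left]
  smul_left x y r := by simp [real_inner_smul_left]

lemma inner_def (x y : ImageSpace S) : ⟪x, y⟫_ℝ = ⟪pinv S x, pinv S y⟫_ℝ := rfl

instance : CompleteSpace (ImageSpace S) := by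
  let e : ImageSpace S ≃ₗᵢ[ℝ] (LinearMap.ker (S : E →ₗ[ℝ] F))ᗮ :=
    { (equivOrtho S).symm with norm_map' := fun _ => rfl }
  exact (completeSpace_congr (e := e.toEquiv) e.isometry.isUniformEmbedding).2 inferInstance

/-- The inclusion `S(E) ⊆ F`, as a bounded operator. -/
def incl : ImageSpace S →L[ℝ] F :=
  (inclₗ S).mkContinuous ‖S‖ fun y => by
    rw [← apply_pinv, norm_def]
    exact S.le_opNorm _

end ImageSpace

/-- The reproducing kernel space `U₀ = Q^{1/2}(U)`, with inner product
`⟪Q^{-1/2} x, Q^{-1/2} y⟫`. -/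
abbrev RKSpace (Q : E →L[ℝ] E) : Type u := ImageSpace (opSqrt Q)

variable (E) in
/-- The index set of a fixed orthonormal basis of the Hilbert space `E`. -/
def BasisIndex : Set E := (exists_hilbertBasis ℝ E).choose

variable (E) in
/-- A fixed orthonormal basis of the Hilbert space `E`; the notions below do not depend on it. -/
def stdBasis : HilbertBasis (BasisIndex E) ℝ E := (exists_hilbertBasis ℝ E).choose_spec.choose

/-- The squared Hilbert-Schmidt norm `∑ ‖T eᵢ‖²`, with values in `[0, ∞]`. -/
def hsNormSq (T : E →L[ℝ] F) : ℝ≥0∞ := ∑' i, ‖T (stdBasis E i)‖ₑ ^ 2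

def IsHilbertSchmidt (T : E →L[ℝ] F) : Prop := hsNormSq T < ∞

/-- The trace `∑ ⟪Q eᵢ, eᵢ⟫` of a non-negative symmetric operator, with values in `[0, ∞]`. -/
def posTrace (Q : E →L[ℝ] E) : ℝ≥0∞ :=
  ∑' i, ENNReal.ofReal ⟪Q (stdBasis E i), stdBasis E i⟫_ℝ

lemma isHilbertSchmidt_iff_memℓp (T : E →L[ℝ] F) :
    IsHilbertSchmidt T ↔ Memℓp (fun i => T (stdBasis E i)) 2 := by
  rw [memℓp_gen_iff (by norm_num)]
  have h : hsNormSq T = ∑' i, ENNReal.ofReal (‖T (stdBasis E i)‖ ^ 2) := by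
    unfold hsNormSq
    congr 1; ext i
    rw [ENNReal.ofReal_pow (norm_nonneg _), ofReal_norm]
  have h2 : ∀ i, ‖T (stdBasis E i)‖ ^ (2 : ℝ≥0∞).toReal = ‖T (stdBasis E i)‖ ^ 2 := by
    intro i; simp
  simp_rw [IsHilbertSchmidt, h, h2]
  constructor
  · intro hlt
    have := ENNReal.summable_toReal hlt.ne
    refine this.congr fun i => ?_
    rw [ENNReal.toReal_ofReal (by positivity)]
  · intro hs
    rw [← ENNReal.ofReal_tsum_of_nonneg (fun i => by positivity) hs]
    exact ENNReal.ofReal_lt_top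

variable (E F) in
/-- The space `L₂(E; F)` of Hilbert-Schmidt operators. -/
def hsSubmodule : Submodule ℝ (E →L[ℝ] F) where
  carrier := {T | IsHilbertSchmidt T}
  add_mem' {S T} hS hT := by
    simp only [Set.mem_ofPred_eq, isHilbertSchmidt_iff_memℓp] at hS hT ⊢
    exact hS.add hT
  zero_mem' := by simp [IsHilbertSchmidt, hsNormSq]
  smul_mem' c T hT := by
    simp only [Set.mem_ofPred_eq, isHilbertSchmidt_iff_memℓp] at hT ⊢
    exact hT.const_smul c

variable (E F) in
/-- The space `L₂(E; F)` of Hilbert-Schmidt operators, to be equipped with the Hilbert-Schmidt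
(and not the operator) norm. -/
def HSOp : Type (max u v) := hsSubmodule E F

namespace HSOp

instance : AddCommGroup (HSOp E F) := inferInstanceAs (AddCommGroup (hsSubmodule E F))

instance : Module ℝ (HSOp E F) := inferInstanceAs (Module ℝ (hsSubmodule E F))

/-- The bounded operator underlying a Hilbert-Schmidt operator. -/
def toCLM : HSOp E F →ₗ[ℝ] (E →L[ℝ] F) := (hsSubmodule E F).subtype

/-- The family `(T eᵢ)ᵢ` as an element of `ℓ²`. -/
def toLp : HSOp E F →ₗ[ℝ] lp (fun _ : BasisIndex E => F) 2 where
  toFun T := ⟨fun i => toCLM T (stdBasis E i), (isHilbertSchmidt_iff_memℓp _).1 T.2⟩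
  map_add' _ _ := rfl
  map_smul' _ _ := rfl

lemma toLp_injective : Function.Injective (toLp (E := E) (F := F)) := by
  intro S T h
  have hb : ∀ i, toCLM S (stdBasis E i) = toCLM T (stdBasis E i) := fun i =>
    congrFun (congrArg Subtype.val h) i
  apply Subtype.ext
  refine ContinuousLinearMap.ext_on (s := Set.range (stdBasis E)) ?_ ?_
  · rw [dense_iff_closure_eq, ← Submodule.topologicalClosure_coe, (stdBasis E).dense_span]
    rfl
  · rintro _ ⟨i, rfl⟩
    exact hb i

instance : NormedAddCommGroup (HSOp E F) :=
  NormedAddCommGroup.induced (HSOp E F) (lp (fun _ : BasisIndex E => F) 2) toLp toLp_injective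

lemma norm_def (T : HSOp E F) : ‖T‖ = ‖toLp T‖ := rfl

instance : InnerProductSpace ℝ (HSOp E F) where
  norm_smul_le a x := by simp [norm_def, norm_smul]
  inner x y := ⟪toLp x, toLp y⟫_ℝ
  norm_sq_eq_re_inner x := by simp [norm_def]
  conj_inner_symm x y := by simp [real_inner_comm]
  add_left x y z := by simp [inner_add_left]
  smul_left x y r := by simp [real_inner_smul_left]

lemma enorm_sq_eq (T : HSOp E F) : ‖T‖ₑ ^ 2 = hsNormSq (toCLM T) := by
  have hs : Summable fun i => ‖toCLM T (stdBasis E i)‖ ^ 2 := by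
    have := (memℓp_gen_iff (p := 2) (by norm_num)).1 ((isHilbertSchmidt_iff_memℓp _).1 T.2)
    simp only [ENNReal.toReal_ofNat, Real.rpow_ofNat] at this
    exact this
  have h1 : ‖T‖ ^ 2 = ∑' i, ‖toCLM T (stdBasis E i)‖ ^ 2 := by
    have := lp.norm_rpow_eq_tsum (p := 2) (by norm_num) (toLp T)
    simp only [ENNReal.toReal_ofNat, Real.rpow_ofNat] at this
    exact this
  rw [← ofReal_norm, ← ENNReal.ofReal_pow (norm_nonneg _), h1,
    ENNReal.ofReal_tsum_of_nonneg (fun i => by positivity) hs, hsNormSq]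
  congr 1; ext i
  rw [ENNReal.ofReal_pow (norm_nonneg _), ofReal_norm]

end HSOp

end Operators

/-! ### Stochastic processes on `[0, T]` -/

section Paths

instance factNonneg {T : ℝ} [h : Fact (0 < T)] : Fact (0 ≤ T) := ⟨h.out.le⟩

/-- The time interval `[0, T]`. -/
abbrev Time (T : ℝ) : Type := Set.Icc (0 : ℝ) T

/-- Lebesgue measure on `[0, T]`. -/
def timeMeasure (T : ℝ) : Measure (Time T) := Measure.comap Subtype.val volume

variable {Ω : Type u} {mΩ : MeasurableSpace Ω} {T : ℝ} [Fact (0 < T)]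
variable {E : Type v} [NormedAddCommGroup E] [InnerProductSpace ℝ E] [CompleteSpace E]
variable {H : Type w} [NormedAddCommGroup H] [InnerProductSpace ℝ H] [CompleteSpace H]

/-- A normal filtration: right-continuous, and `𝓕 0` contains all null sets. -/
structure IsNormal (𝓕 : Filtration (Time T) mΩ) (P : Measure Ω) : Prop where
  null_sets : ∀ A, MeasurableSet A → P A = 0 → MeasurableSet[𝓕 ⊥] A
  right_continuous : 𝓕.IsRightContinuous

/-- Continuous, locally square integrable local martingales on `[0, T]`. Since the elements of a
localizing sequence take values in `[0, T] ∪ {⊤}` and tend to `⊤`, they almost surely equal `⊤`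
eventually, so that the stopped processes exhaust the closed interval `[0, T]`. -/
structure IsContLocalMartingale (𝓕 : Filtration (Time T) mΩ) (P : Measure Ω)
    (M : Time T → Ω → H) : Prop where
  adapted : StronglyAdapted 𝓕 M
  continuous : ∀ᵐ ω ∂P, Continuous (M · ω)
  zero : ∀ᵐ ω ∂P, M ⊥ ω = 0
  localized : ∃ τ : ℕ → Ω → WithTop (Time T), IsLocalizingSequence 𝓕 τ P ∧
    ∀ n, Martingale (stoppedProcess M (τ n)) 𝓕 P ∧
      (⨆ t, ∫⁻ ω, ‖(stoppedProcess M (τ n) t ω)‖ₑ ^ 2 ∂P) < ∞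

/-- `X` is an `E`-valued `Q`-Wiener process with respect to the filtration `𝓕`. -/
structure IsQWiener (𝓕 : Filtration (Time T) mΩ) (P : Measure Ω) (Q : E →L[ℝ] E)
    (X : Time T → Ω → E) : Prop where
  isPositive : Q.IsPositive
  traceClass : posTrace Q < ∞
  adapted : StronglyAdapted 𝓕 X
  zero : ∀ᵐ ω ∂P, X ⊥ ω = 0
  continuous : ∀ᵐ ω ∂P, Continuous (X · ω)
  gaussian : ∀ s t : Time T, s ≤ t → ∀ g : E,
    P.map (fun ω => ⟪X t ω - X s ω, g⟫_ℝ)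
      = gaussianReal 0 (Real.toNNReal (((t : ℝ) - s) * ⟪Q g, g⟫_ℝ))
  indep : ∀ s t : Time T, s ≤ t →
    Indep (MeasurableSpace.comap (fun ω => X t ω - X s ω) (borel E)) (𝓕 s) P

/-- `W` is a generalised Wiener process on `E` with covariance `Q`, with respect to `𝓕`:
`W t h` is the pairing of `h` with the noise at time `t`. -/
structure IsGenWiener (𝓕 : Filtration (Time T) mΩ) (P : Measure Ω) (Q : E →L[ℝ] E)
    (W : Time T → E → Ω → ℝ) : Prop where
  linear : ∀ t (a b : ℝ) (h g : E),
    W t (a • h + b • g) =ᵐ[P] fun ω => a * W t h ω + b * W t g ω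
  wiener : ∀ h, ∃ q : ℝ, IsQWiener 𝓕 P (q • ContinuousLinearMap.id ℝ ℝ) (fun t => W t h)
  continuous : ∀ t (h : ℕ → E) (g : E), Tendsto h atTop (𝓝 g) →
    Tendsto (fun n => ∫⁻ ω, ‖W t g ω - W t (h n) ω‖ₑ ^ 2 ∂P) atTop (𝓝 0)
  isPositive : Q.IsPositive
  covariance : ∀ (s t : Time T) (h g : E),
    ∫ ω, W s h ω * W t g ω ∂P = min (s : ℝ) t * ⟪Q h, g⟫_ℝ

/-- Stochastic integrands: predictable `L₂`-valued processes, almost surely square integrable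
in time. -/
structure IsIntegrand {K : Type v} [NormedAddCommGroup K]
    (𝓕 : Filtration (Time T) mΩ) (P : Measure Ω) (φ : Time T → Ω → K) : Prop where
  predictable : IsStronglyPredictable 𝓕 φ
  sq_integrable : ∀ᵐ ω ∂P, (∫⁻ t, ‖φ t ω‖ₑ ^ 2 ∂(timeMeasure T)) < ∞

/-! ### The stochastic integral with respect to a `Q`-Wiener process -/

variable (E H) in
/-- Simple `L(E; H)`-valued processes, with deterministic times `0 = t₀ < ⋯ < t_{n+1} = T`. -/
structure SimpleProc (𝓕 : Filtration (Time T) mΩ) where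
  n : ℕ
  time : Fin (n + 2) → Time T
  strictMono : StrictMono time
  time_first : time 0 = ⊥
  time_last : time (Fin.last (n + 1)) = ⊤
  val : Fin (n + 1) → Ω → (E →L[ℝ] H)
  finite_range : ∀ m, (Set.range (val m)).Finite
  measurable : ∀ m, StronglyMeasurable[𝓕 (time m.castSucc)] (val m)

namespace SimpleProc

variable {𝓕 : Filtration (Time T) mΩ}

open Classical in
/-- `Φ_t = Φ₀ 1_{{0}}(t) + ∑ Φ_m 1_{(t_m, t_{m+1}]}(t)` -/
def eval (Φ : SimpleProc E H 𝓕) (t : Time T) (ω : Ω) : E →L[ℝ] H :=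
  (if t = ⊥ then Φ.val 0 ω else 0) +
    ∑ m : Fin (Φ.n + 1),
      if Φ.time m.castSucc < t ∧ t ≤ Φ.time m.succ then Φ.val m ω else 0

/-- `∑ Φ_m (X_{t_{m+1} ∧ t} - X_{t_m ∧ t})` -/
def integral (Φ : SimpleProc E H 𝓕) (X : Time T → Ω → E) (t : Time T) (ω : Ω) : H :=
  ∑ m : Fin (Φ.n + 1),
    Φ.val m ω (X (min (Φ.time m.succ) t) ω - X (min (Φ.time m.castSucc) t) ω)

end SimpleProc

/-- `M` is the integral `∫₀^· ψ dX` of a square integrable integrand `ψ` with respect to the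
`Q`-Wiener process `X`: the limit of the integrals of simple processes `Φ k` which converge to
`ψ` in `L²([0, T] × Ω; L₂(Q^{1/2}(E); H))`. The restriction of `Φ k` to `Q^{1/2}(E)` is the
composition with the inclusion `Q^{1/2}(E) ⊆ E`. -/
structure IsSqIntegral (𝓕 : Filtration (Time T) mΩ) (P : Measure Ω) (Q : E →L[ℝ] E)
    (X : Time T → Ω → E) (ψ : Time T → Ω → HSOp (RKSpace Q) H) (M : Time T → Ω → H) :
    Prop where
  approx : ∃ Φ : ℕ → SimpleProc E H 𝓕,
    Tendsto (fun k => ∫⁻ ω, ∫⁻ t,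
      hsNormSq ((Φ k).eval t ω ∘L ImageSpace.incl (opSqrt Q) - HSOp.toCLM (ψ t ω))
        ∂(timeMeasure T) ∂P) atTop (𝓝 0) ∧
    Tendsto (fun k => ⨆ t, ∫⁻ ω, ‖(Φ k).integral X t ω - M t ω‖ₑ ^ 2 ∂P) atTop (𝓝 0)

open Classical in
/-- The process `1_{[0, τ]} ψ`. -/
def truncate {K : Type v} [Zero K] (τ : Ω → WithTop (Time T)) (ψ : Time T → Ω → K) :
    Time T → Ω → K :=
  fun t ω => if (t : WithTop (Time T)) ≤ τ ω then ψ t ω else 0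

/-- The adapted continuous process `M` is the integral `∫₀^· ψ dX` with respect to the
`Q`-Wiener process `X`: for some localizing sequence `τ`, the process `M` stopped at `τ n` is the
integral of the square integrable integrand `1_{[0, τ n]} ψ`, for every `n`. -/
structure IsStochIntegral (𝓕 : Filtration (Time T) mΩ) (P : Measure Ω) (Q : E →L[ℝ] E)
    (X : Time T → Ω → E) (ψ : Time T → Ω → HSOp (RKSpace Q) H) (M : Time T → Ω → H) :
    Prop where
  adapted : StronglyAdapted 𝓕 M
  continuous : ∀ᵐ ω ∂P, Continuous (M · ω)
  localized : ∃ τ : ℕ → Ω → WithTop (Time T), IsLocalizingSequence 𝓕 τ P ∧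
    ∀ n, (∫⁻ ω, ∫⁻ t, ‖truncate (τ n) ψ t ω‖ₑ ^ 2 ∂(timeMeasure T) ∂P) < ∞ ∧
      IsSqIntegral 𝓕 P Q X (truncate (τ n) ψ) (stoppedProcess M (τ n))

end Paths

/-! ### Hilbert-Schmidt extensions of generalised Wiener processes -/

section Extension

variable {Ω : Type u} {mΩ : MeasurableSpace Ω} {T : ℝ} [Fact (0 < T)]
variable {U : Type v} [NormedAddCommGroup U] [InnerProductSpace ℝ U] [CompleteSpace U]
variable {U₁ : Type w} [NormedAddCommGroup U₁] [InnerProductSpace ℝ U₁] [CompleteSpace U₁]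

/-- A Hilbert-Schmidt embedding `ι : U₀ = Q^{1/2}(U) → U₁`. -/
structure IsHSEmbedding {Q : U →L[ℝ] U} (ι : RKSpace Q →L[ℝ] U₁) : Prop where
  injective : Function.Injective ι
  hilbertSchmidt : IsHilbertSchmidt ι

/-- The covariance `Q₁ = ι ι^*` of a generalised Wiener process seen as a `U₁`-valued process,
where the adjoint is that of `ι : U₀ → U₁`. -/
def extCov {Q : U →L[ℝ] U} (ι : RKSpace Q →L[ℝ] U₁) : U₁ →L[ℝ] U₁ :=
  ι ∘L ContinuousLinearMap.adjoint ι

/-- The adapted continuous process `X` is the generalised Wiener process `W` seen as a process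
with values in `U₁`: for an orthonormal basis `f` of `U₀ = Q^{1/2}(U)` and independent standard
real Brownian motions `β`, one has `W_{h;t} = ∑ β^k_t ⟪f_k, h⟫_U` for all `h ∈ U`, that is,
`W_t = ∑ β^k_t f_k` formally, and `X_t = ∑ β^k_t ι f_k`. The sums converge in mean square. -/
structure IsExtension (𝓕 : Filtration (Time T) mΩ) (P : Measure Ω) {Q : U →L[ℝ] U}
    (W : Time T → U → Ω → ℝ) (ι : RKSpace Q →L[ℝ] U₁) (X : Time T → Ω → U₁) : Prop where
  adapted : StronglyAdapted 𝓕 X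
  continuous : ∀ᵐ ω ∂P, Continuous (X · ω)
  series : ∃ (κ : Set (RKSpace Q)) (f : HilbertBasis κ ℝ (RKSpace Q)) (β : κ → Time T → Ω → ℝ),
    (∀ k, IsQWiener 𝓕 P (ContinuousLinearMap.id ℝ ℝ) (β k)) ∧
    iIndepFun (fun k ω t => β k t ω) P ∧
    (∀ t h, Tendsto (fun s : Finset κ => ∫⁻ ω,
      ‖W t h ω - ∑ k ∈ s, β k t ω * ⟪ImageSpace.incl (opSqrt Q) (f k), h⟫_ℝ‖ₑ ^ 2 ∂P)
      atTop (𝓝 0)) ∧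
    (∀ t, Tendsto (fun s : Finset κ => ∫⁻ ω,
      ‖X t ω - ∑ k ∈ s, β k t ω • ι (f k)‖ₑ ^ 2 ∂P) atTop (𝓝 0))

/-- `ψ = φ ∘ ι⁻¹` as a process of operators on `Q₁^{1/2}(U₁)`, `Q₁ = ι ι^*`: every element of
`Q₁^{1/2}(U₁)` is of the form `ι x`, and is mapped to `φ x`. -/
def IsCompInv {H : Type*} [NormedAddCommGroup H] [InnerProductSpace ℝ H] [CompleteSpace H]
    {Q : U →L[ℝ] U} (ι : RKSpace Q →L[ℝ] U₁) (φ : Time T → Ω → HSOp (RKSpace Q) H)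
    (ψ : Time T → Ω → HSOp (RKSpace (extCov ι)) H) : Prop :=
  ∀ t ω (y : RKSpace (extCov ι)), ∃ x : RKSpace Q,
    ι x = ImageSpace.incl (opSqrt (extCov ι)) y ∧
      HSOp.toCLM (ψ t ω) y = HSOp.toCLM (φ t ω) x

end Extension

end GenWiener

end

/-! An injective `ι : U₀ → U₁` has a polar decomposition: it is a unitary `J` from U₀ onto
Q₁^{1/2}(U₁), Q₁ = ι ι^*, followed by the inclusion into U₁ (`exists_polar`). Hence φ ∘ ι⁻¹ is φ ∘
J⁻¹, composition with `J` is an isometry of the spaces of Hilbert-Schmidt operators, and every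
statement about φ ∘ ι⁻¹ turns into one about φ itself on U₀, the embedding surviving only in the
integrator.

For simple Φ the Itô isometry reads E‖∫Φ dW¹‖² = E∫‖Φ ∘ ι‖² dt with Hilbert-Schmidt norms
(`IsWienerLike.lintegral_integral_sq`). It needs only the first two moments of the increments and
their independence of the past. Operators L ∘ ι are dense in L₂(U₀; H) because ι is injective, so
simple processes are dense (`exists_simpleProc_tendsto`); Doob's inequality makes the continuous
square integrable martingales complete (`exists_limit_of_cauchy`). This gives the integral of square
integrable integrands, and stopping at the level n of ∫‖φ‖² gives the general one
(`exists_isLocalIntegral`).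

For two choices, the pair (W¹, W²) is regarded as a process in the Hilbert sum U₁ ⊕ U₂, with the
embedding (ι₁, ι₂). If Φᵢ ∘ ιᵢ is close to φ, then Φ₁ ∘ π₁ - Φ₂ ∘ π₂ is simple on the sum, its
integral against the pair is ∫Φ₁ dW¹ - ∫Φ₂ dW², and the isometry bounds the mean square by E∫‖Φ₁ ι₁
- Φ₂ ι₂‖² dt, which is small (`IsL2Integral.ae_eq`). Stopping and path continuity yield
indistinguishability (`IsLocalIntegral.indistinguishable`).

That the pair is a Wiener process cannot be read off the two series, as these may use different
bases and Brownian motions. `IsRepr` is a basis-free substitute: ⟪X_t, g⟫ is the mean square limit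
of W_{h_n;t} when Q h_n → ι^* g in U₀. It follows from a series by orthogonality, passes to pairs
(`IsRepr.prod`), and gives Gaussian increments independent of the past through characteristic
functions integrated over past events. A series exists because Gram-Schmidt provides a basis of U₀
of the form Q h_k: then β^k = W_{h_k}, and orthonormality in U₀ means independence by joint
Gaussianity. -/

noncomputable section

namespace GenWiener

universe u v w

/-! ### Hilbert-Schmidt norms -/

section HilbertSchmidt

variable {E : Type*} [NormedAddCommGroup E] [InnerProductSpace ℝ E] [CompleteSpace E]
variable {F : Type*} [NormedAddCommGroup F] [InnerProductSpace ℝ F] [CompleteSpace F]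
variable {G : Type*} [NormedAddCommGroup G] [InnerProductSpace ℝ G] [CompleteSpace G]

lemma enorm_sq_eq_ofReal {V : Type*} [SeminormedAddCommGroup V] (x : V) : ‖x‖ₑ ^ 2 = ENNReal.ofReal (‖x‖ ^ 2) := by
  rw [ENNReal.ofReal_pow (norm_nonneg _), ofReal_norm]

lemma enorm_sq_eq_tsum_inner {κ : Type*} (b : HilbertBasis κ ℝ E) (x : E) :
    ‖x‖ₑ ^ 2 = ∑' j, ‖⟪b j, x⟫_ℝ‖ₑ ^ 2 := by
  have h := b.hasSum_inner_mul_inner x x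
  have h2 : ∀ j, ⟪x, b j⟫_ℝ * ⟪b j, x⟫_ℝ = ‖⟪b j, x⟫_ℝ‖ ^ 2 := fun j => by
    rw [real_inner_comm, Real.norm_eq_abs, sq_abs]; ring
  simp_rw [h2, real_inner_self_eq_norm_sq] at h
  simp_rw [enorm_sq_eq_ofReal]
  rw [← h.tsum_eq, ENNReal.ofReal_tsum_of_nonneg (fun j => by positivity) h.summable]

/-- Both sides are the double sum of ⟪T b_i, b'_j⟫², in the two orders of summation. As the right
side does not involve `b`, basis independence follows. -/
lemma tsum_enorm_sq_eq_adjoint {κ κ' : Type*} (b : HilbertBasis κ ℝ E) (b' : HilbertBasis κ' ℝ F)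
    (T : E →L[ℝ] F) :
    ∑' i, ‖T (b i)‖ₑ ^ 2 = ∑' j, ‖ContinuousLinearMap.adjoint T (b' j)‖ₑ ^ 2 := by
  simp_rw [enorm_sq_eq_tsum_inner b', fun j => enorm_sq_eq_tsum_inner b
    (ContinuousLinearMap.adjoint T (b' j))]
  rw [ENNReal.tsum_comm]
  refine tsum_congr fun j => tsum_congr fun i => ?_
  rw [ContinuousLinearMap.adjoint_inner_right, real_inner_comm]

lemma hsNormSq_adjoint (T : E →L[ℝ] F) : hsNormSq (ContinuousLinearMap.adjoint T) = hsNormSq T :=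
  (tsum_enorm_sq_eq_adjoint _ _ T).symm

/-- The Hilbert-Schmidt norm does not depend on the orthonormal basis. -/
lemma hsNormSq_eq_tsum {κ : Type*} (b : HilbertBasis κ ℝ E) (T : E →L[ℝ] F) :
    hsNormSq T = ∑' i, ‖T (b i)‖ₑ ^ 2 := by
  rw [← hsNormSq_adjoint, tsum_enorm_sq_eq_adjoint b (stdBasis F), hsNormSq]

lemma hsNormSq_comp_le (A : F →L[ℝ] G) (T : E →L[ℝ] F) :
    hsNormSq (A ∘L T) ≤ ‖A‖ₑ ^ 2 * hsNormSq T := by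
  unfold hsNormSq
  rw [← ENNReal.tsum_mul_left]
  refine ENNReal.tsum_le_tsum fun i => ?_
  rw [← mul_pow]
  gcongr
  exact A.le_opENorm _

/-- Passing to adjoints moves the unitary factor to the left, where it preserves every term of the
sum. -/
lemma hsNormSq_comp_linearIsometryEquiv (T : F →L[ℝ] G) (J : E ≃ₗᵢ[ℝ] F) :
    hsNormSq (T ∘L (J.toContinuousLinearEquiv : E →L[ℝ] F)) = hsNormSq T := by
  rw [← hsNormSq_adjoint, ← hsNormSq_adjoint T, ContinuousLinearMap.adjoint_comp]
  unfold hsNormSq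
  refine tsum_congr fun i => ?_
  congr 1
  rw [LinearIsometryEquiv.adjoint_eq_symm]
  simp only [ContinuousLinearMap.comp_apply]
  exact J.symm.enorm_map _

lemma IsHilbertSchmidt.comp_left {T : E →L[ℝ] F} (hT : IsHilbertSchmidt T) (A : F →L[ℝ] G) :
    IsHilbertSchmidt (A ∘L T) :=
  (hsNormSq_comp_le A T).trans_lt
    (ENNReal.mul_lt_top (by simp) hT)

/-- ⟪R R^* e, e⟫ = ‖R^* e‖². This converts the trace class condition on a covariance into the
Hilbert-Schmidt condition on a factor of it. -/
lemma posTrace_comp_adjoint (R : E →L[ℝ] F) :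
    posTrace (R ∘L ContinuousLinearMap.adjoint R) = hsNormSq R := by
  rw [← hsNormSq_adjoint, posTrace, hsNormSq]
  refine tsum_congr fun i => ?_
  rw [ContinuousLinearMap.comp_apply, ← ContinuousLinearMap.adjoint_inner_right,
    real_inner_self_eq_norm_sq, enorm_sq_eq_ofReal]

namespace HSOp

/-- A Hilbert-Schmidt operator, as an element of `HSOp E F`. -/
def ofCLM (T : E →L[ℝ] F) (hT : IsHilbertSchmidt T) : HSOp E F := ⟨T, hT⟩

lemma toCLM_injective : Function.Injective (toCLM (E := E) (F := F)) := Subtype.val_injective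

lemma enorm_ofCLM_sq (T : E →L[ℝ] F) (hT : IsHilbertSchmidt T) :
    ‖ofCLM T hT‖ₑ ^ 2 = hsNormSq T := enorm_sq_eq _

/-- Composition with a fixed Hilbert-Schmidt operator `R`, as a bounded operator into the space
of Hilbert-Schmidt operators. -/
def compRight (R : E →L[ℝ] F) (hR : IsHilbertSchmidt R) : (F →L[ℝ] G) →L[ℝ] HSOp E G :=
  LinearMap.mkContinuous
    { toFun := fun L => ofCLM (L ∘L R) (hR.comp_left L)
      map_add' := fun _ _ => rfl
      map_smul' := fun _ _ => rfl } ‖ofCLM R hR‖ fun L => by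
    have h : ‖ofCLM (L ∘L R) (hR.comp_left L)‖ₑ ^ 2 ≤ (‖ofCLM R hR‖ₑ * ‖L‖ₑ) ^ 2 := by
      rw [enorm_ofCLM_sq, mul_pow, enorm_ofCLM_sq, mul_comm]
      exact hsNormSq_comp_le _ _
    have h2 := (ENNReal.pow_le_pow_left_iff (two_ne_zero)).1 h
    rw [← ofReal_norm, ← ofReal_norm, ← ofReal_norm,
      ← ENNReal.ofReal_mul (norm_nonneg _), ENNReal.ofReal_le_ofReal_iff (by positivity)] at h2
    exact h2

@[simp] lemma toCLM_compRight (R : E →L[ℝ] F) (hR : IsHilbertSchmidt R) (L : F →L[ℝ] G) :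
    toCLM (compRight R hR L) = L ∘L R := rfl

/-- Composition with a unitary operator, as an isometry of spaces of Hilbert-Schmidt operators. -/
def compIsometry (J : E ≃ₗᵢ[ℝ] F) : HSOp F G →ₗᵢ[ℝ] HSOp E G where
  toFun T := ofCLM (toCLM T ∘L (J.toContinuousLinearEquiv : E →L[ℝ] F))
    (by rw [IsHilbertSchmidt, hsNormSq_comp_linearIsometryEquiv]; exact T.2)
  map_add' _ _ := rfl
  map_smul' _ _ := rfl
  norm_map' T := by
    have h : ‖ofCLM (toCLM T ∘L (J.toContinuousLinearEquiv : E →L[ℝ] F))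
        (by rw [IsHilbertSchmidt, hsNormSq_comp_linearIsometryEquiv]; exact T.2)‖ₑ ^ 2
        = ‖T‖ₑ ^ 2 := by
      rw [enorm_ofCLM_sq, enorm_sq_eq, hsNormSq_comp_linearIsometryEquiv]
    rw [enorm_sq_eq_ofReal, enorm_sq_eq_ofReal, ENNReal.ofReal_eq_ofReal_iff (by positivity)
      (by positivity), sq_eq_sq₀ (norm_nonneg _) (norm_nonneg _)] at h
    exact h

@[simp] lemma toCLM_compIsometry_apply (J : E ≃ₗᵢ[ℝ] F) (T : HSOp F G) (x : E) :
    toCLM (compIsometry J T) x = toCLM T (J x) := rfl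

end HSOp

end HilbertSchmidt

/-! ### Square roots of non-negative operators -/

section Sqrt

/-- By the Catalan convolution the partial sums satisfy s_{n+1} ≤ 1 + s_n² / 4, and 2 is the fixed
point of x ↦ 1 + x² / 4. -/
lemma sum_catalan_div_le (n : ℕ) :
    ∑ k ∈ Finset.range n, (catalan k : ℝ) / 4 ^ k ≤ 2 := by
  induction n with
  | zero => simp
  | succ n ih =>
    have h0 : ∀ k, (0 : ℝ) ≤ (catalan k : ℝ) / 4 ^ k := fun k => by positivity
    have hle : ∑ k ∈ Finset.range n, (catalan (k + 1) : ℝ) / 4 ^ k ≤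
        (∑ k ∈ Finset.range n, (catalan k : ℝ) / 4 ^ k) *
          ∑ k ∈ Finset.range n, (catalan k : ℝ) / 4 ^ k := by
      -- The antidiagonals of 0, …, n - 1 are disjoint and contained in the square [0, n)², and all
      -- terms are non-negative.
      rw [Finset.sum_mul_sum, ← Finset.sum_product']
      calc ∑ k ∈ Finset.range n, (catalan (k + 1) : ℝ) / 4 ^ k
          = ∑ k ∈ Finset.range n, ∑ p ∈ Finset.HasAntidiagonal.antidiagonal k,
              (catalan p.1 : ℝ) / 4 ^ p.1 * ((catalan p.2 : ℝ) / 4 ^ p.2) := by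
            refine Finset.sum_congr rfl fun k _ => ?_
            rw [catalan_succ']
            push_cast
            rw [Finset.sum_div]
            refine Finset.sum_congr rfl fun p hp => ?_
            rw [← Finset.HasAntidiagonal.mem_antidiagonal.1 hp, pow_add]
            field_simp
        _ = ∑ x ∈ (Finset.range n).sigma fun k => Finset.HasAntidiagonal.antidiagonal k,
              (catalan x.2.1 : ℝ) / 4 ^ x.2.1 * ((catalan x.2.2 : ℝ) / 4 ^ x.2.2) := by
            rw [Finset.sum_sigma]
        _ = ∑ p ∈ ((Finset.range n).sigma fun k => Finset.HasAntidiagonal.antidiagonal k).image Sigma.snd,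
              (catalan p.1 : ℝ) / 4 ^ p.1 * ((catalan p.2 : ℝ) / 4 ^ p.2) := by
            rw [Finset.sum_image]
            rintro ⟨a, p⟩ hp ⟨b, p'⟩ hp' (h : p = p')
            simp only [Finset.coe_sigma, Set.mem_sigma_iff, Finset.mem_coe,
              Finset.HasAntidiagonal.mem_antidiagonal] at hp hp'
            subst h
            obtain rfl : a = b := hp.2.symm.trans hp'.2
            rfl
        _ ≤ _ := by
            refine Finset.sum_le_sum_of_subset_of_nonneg ?_
              fun p _ _ => mul_nonneg (h0 _) (h0 _)
            intro p hp
            simp only [Finset.mem_image, Finset.mem_sigma, Finset.mem_range,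
              Finset.HasAntidiagonal.mem_antidiagonal] at hp
            obtain ⟨⟨a, p'⟩, ⟨h1, h2⟩, rfl⟩ := hp
            simp only [Finset.mem_product, Finset.mem_range]
            simp only at h1 h2
            omega
    have hs : 0 ≤ ∑ k ∈ Finset.range n, (catalan k : ℝ) / 4 ^ k :=
      Finset.sum_nonneg fun k _ => h0 k
    rw [Finset.sum_range_succ']
    have h4 : ∑ k ∈ Finset.range n, (catalan (k + 1) : ℝ) / 4 ^ (k + 1)
        = (∑ k ∈ Finset.range n, (catalan (k + 1) : ℝ) / 4 ^ k) / 4 := by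
      rw [Finset.sum_div]
      refine Finset.sum_congr rfl fun k _ => ?_
      rw [pow_succ]; field_simp
    rw [h4]
    simp only [catalan_zero, Nat.cast_one, pow_zero, div_one]
    nlinarith

lemma summable_catalan_div : Summable fun k : ℕ => (catalan k : ℝ) / 4 ^ k :=
  summable_of_sum_range_le (fun k => by positivity) sum_catalan_div_le

lemma tsum_catalan_div_le : ∑' k : ℕ, (catalan k : ℝ) / 4 ^ k ≤ 2 :=
  Real.tsum_le_of_sum_range_le (fun k => by positivity) sum_catalan_div_le

/-! ### The power series of √(1 - x) in a Banach algebra -/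

section Algebra

variable {A : Type*} [NormedRing A] [NormedAlgebra ℝ A] [CompleteSpace A] [NormOneClass A]

/-- The generating function of the Catalan numbers, at `x / 4`. -/
def catalanSeries (x : A) : A := ∑' k : ℕ, ((catalan k : ℝ) / 4 ^ k) • x ^ k

lemma norm_catalan_smul_pow_le {x : A} (hx : ‖x‖ ≤ 1) (k : ℕ) :
    ‖((catalan k : ℝ) / 4 ^ k) • x ^ k‖ ≤ (catalan k : ℝ) / 4 ^ k := by
  rw [norm_smul, Real.norm_of_nonneg (by positivity)]
  exact mul_le_of_le_one_right (by positivity)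
    ((norm_pow_le x k).trans (pow_le_one₀ (norm_nonneg _) hx))

lemma summable_norm_catalan_smul_pow {x : A} (hx : ‖x‖ ≤ 1) :
    Summable fun k : ℕ => ‖((catalan k : ℝ) / 4 ^ k) • x ^ k‖ :=
  Summable.of_nonneg_of_le (fun _ => norm_nonneg _) (norm_catalan_smul_pow_le hx)
    summable_catalan_div

lemma norm_catalanSeries_le {x : A} (hx : ‖x‖ ≤ 1) : ‖catalanSeries x‖ ≤ 2 :=
  (tsum_of_norm_bounded summable_catalan_div.hasSum (norm_catalan_smul_pow_le hx)).trans
    tsum_catalan_div_le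

lemma commute_catalanSeries (x : A) : Commute x (catalanSeries x) :=
  Commute.tsum_right _ fun k => ((Commute.refl x).pow_right k).smul_right _

/-- The Cauchy product combined with the Catalan convolution is the functional equation C = 1 + z C²
at z = x / 4. -/
lemma catalanSeries_eq {x : A} (hx : ‖x‖ ≤ 1) :
    catalanSeries x = 1 + (4⁻¹ : ℝ) • (x * (catalanSeries x * catalanSeries x)) := by
  have hs := (summable_norm_catalan_smul_pow hx).of_norm
  have h0 : catalanSeries x = 1 + ∑' k : ℕ, ((catalan (k + 1) : ℝ) / 4 ^ (k + 1)) • x ^ (k + 1) := by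
    rw [catalanSeries, hs.tsum_eq_zero_add]
    simp
  refine h0.trans ?_
  congr 1
  · rw [catalanSeries, tsum_mul_tsum_eq_tsum_sum_antidiagonal_of_summable_norm
      (summable_norm_catalan_smul_pow hx) (summable_norm_catalan_smul_pow hx)]
    have hs2 := (summable_norm_sum_mul_antidiagonal_of_summable_norm
      (summable_norm_catalan_smul_pow hx) (summable_norm_catalan_smul_pow hx)).of_norm
    rw [← hs2.tsum_mul_left, ← (hs2.mul_left x).tsum_const_smul]
    refine tsum_congr fun k => ?_
    rw [catalan_succ', Finset.mul_sum, Finset.smul_sum]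
    push_cast
    rw [Finset.sum_div, Finset.sum_smul]
    refine Finset.sum_congr rfl fun p hp => ?_
    rw [← Finset.HasAntidiagonal.mem_antidiagonal.1 hp, smul_mul_smul_comm, mul_smul_comm, smul_smul, ← pow_add,
      ← pow_succ']
    congr 1
    rw [pow_succ, pow_add]
    field_simp

/-- Multiplying C = 1 + (x / 4) C² by x gives (x C)² / 4 = x C - x, so the square of 1 - x C / 2
collapses. The bound on the Catalan series makes this root available on the whole closed unit ball.
-/
lemma sq_one_sub_catalanSeries {x : A} (hx : ‖x‖ ≤ 1) :
    (1 - (2⁻¹ : ℝ) • (x * catalanSeries x)) * (1 - (2⁻¹ : ℝ) • (x * catalanSeries x)) = 1 - x := by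
  have h1 := catalanSeries_eq hx
  have hc : x * catalanSeries x * (x * catalanSeries x)
      = x * (x * (catalanSeries x * catalanSeries x)) := by
    have := (commute_catalanSeries x).eq
    calc x * catalanSeries x * (x * catalanSeries x)
        = x * ((catalanSeries x * x) * catalanSeries x) := by noncomm_ring
      _ = _ := by rw [← this]; noncomm_ring
  have h2 : (4⁻¹ : ℝ) • (x * (x * (catalanSeries x * catalanSeries x)))
      = x * catalanSeries x - x := by
    rw [← mul_smul_comm]
    nth_rewrite 3 [h1]
    rw [mul_add]
    simp
  rw [sub_mul, one_mul, mul_sub, mul_one, smul_mul_smul_comm, hc]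
  rw [show (2⁻¹ : ℝ) * 2⁻¹ = 4⁻¹ by norm_num, h2]
  have : (2⁻¹ : ℝ) • (x * catalanSeries x) + (2⁻¹ : ℝ) • (x * catalanSeries x)
      = x * catalanSeries x := by rw [← add_smul]; norm_num
  calc _ = 1 - ((2⁻¹ : ℝ) • (x * catalanSeries x) + (2⁻¹ : ℝ) • (x * catalanSeries x))
      + (x * catalanSeries x - x) := by abel
    _ = _ := by rw [this]; abel

lemma isSelfAdjoint_catalanSeries [StarRing A] [ContinuousStar A] [StarModule ℝ A] {x : A}
    (hx : ‖x‖ ≤ 1) (hxs : IsSelfAdjoint x) : IsSelfAdjoint (catalanSeries x) := by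
  have h := (summable_norm_catalan_smul_pow hx).of_norm.hasSum
  have h2 := h.star
  rw [isSelfAdjoint_iff]
  refine h2.unique ?_
  have h3 : (fun k : ℕ => star (((catalan k : ℝ) / 4 ^ k) • x ^ k))
      = fun k : ℕ => ((catalan k : ℝ) / 4 ^ k) • x ^ k := by
    ext1 k
    rw [star_smul, star_pow, hxs.star_eq, star_trivial]
  rw [h3]
  exact h

end Algebra

variable {E : Type*} [NormedAddCommGroup E] [InnerProductSpace ℝ E] [CompleteSpace E]

/-- Positivity tested at v - B v, together with ‖B‖ ≤ 1, gives ‖B v‖² ≤ ⟪B v, v⟫; hence ‖v - B v‖² ≤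
‖v‖² - ⟪B v, v⟫. -/
lemma norm_one_sub_le_one {B : E →L[ℝ] E} (hB : B.IsPositive) (h1 : ‖B‖ ≤ 1) : ‖1 - B‖ ≤ 1 := by
  refine ContinuousLinearMap.opNorm_le_bound _ zero_le_one fun v => ?_
  have hp := hB.inner_nonneg_left (v - B v)
  have hs : ⟪B (B v), v⟫_ℝ = ‖B v‖ ^ 2 := by
    rw [hB.inner_left_eq_inner_right, real_inner_self_eq_norm_sq]
  have h2 : ⟪B (B v), B v⟫_ℝ ≤ ‖B v‖ ^ 2 := by
    calc ⟪B (B v), B v⟫_ℝ ≤ ‖B (B v)‖ * ‖B v‖ := real_inner_le_norm _ _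
      _ ≤ ‖B v‖ * ‖B v‖ := by
        gcongr
        exact (B.le_opNorm _).trans (mul_le_of_le_one_left (norm_nonneg _) h1)
      _ = _ := by ring
  have h0 := hB.inner_nonneg_left v
  rw [map_sub, inner_sub_left, inner_sub_right, inner_sub_right, hs,
    real_inner_self_eq_norm_sq] at hp
  have h3 : ‖(1 - B) v‖ ^ 2 ≤ ‖v‖ ^ 2 := by
    change ‖v - B v‖ ^ 2 ≤ _
    rw [norm_sub_sq_real, real_inner_comm]
    nlinarith
  rw [one_mul]
  exact (sq_le_sq₀ (norm_nonneg _) (norm_nonneg _)).1 h3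

/-- ‖D‖ ≤ 2 gives ⟪D v, v⟫ ≤ 2 ‖v‖². It is applied to D = x C, where 2 is the bound on the Catalan
series. -/
lemma isPositive_one_sub_half_smul {D : E →L[ℝ] E} (hD : IsSelfAdjoint D) (hn : ‖D‖ ≤ 2) :
    (1 - (2⁻¹ : ℝ) • D).IsPositive := by
  rw [ContinuousLinearMap.isPositive_iff]
  have hsym : ∀ v w, ⟪D v, w⟫_ℝ = ⟪v, D w⟫_ℝ := hD.isSymmetric
  refine ⟨fun v w => ?_, fun v => ?_⟩
  · change ⟪v - (2⁻¹ : ℝ) • D v, w⟫_ℝ = ⟪v, w - (2⁻¹ : ℝ) • D w⟫_ℝ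
    rw [inner_sub_left, inner_sub_right, real_inner_smul_left, real_inner_smul_right, hsym]
  have h1 : (1 - (2⁻¹ : ℝ) • D) v = v - (2⁻¹ : ℝ) • D v := rfl
  rw [h1, inner_sub_left, real_inner_smul_left, real_inner_self_eq_norm_sq]
  have h2 : ⟪D v, v⟫_ℝ ≤ 2 * ‖v‖ ^ 2 := by
    calc ⟪D v, v⟫_ℝ ≤ ‖D v‖ * ‖v‖ := real_inner_le_norm _ _
      _ ≤ (2 * ‖v‖) * ‖v‖ := by
          gcongr
          exact (D.le_opNorm _).trans (by gcongr)
      _ = _ := by ring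
  linarith

/-- The series of √(1 - x) is evaluated at x = 1 - B. Self-adjointness of x C comes from the
commutation of x and C. Nontriviality of E provides ‖1‖ = 1. -/
lemma exists_isPositive_sq_eq_of_norm_le_one [Nontrivial E] {B : E →L[ℝ] E} (hB : B.IsPositive)
    (hB1 : ‖B‖ ≤ 1) : ∃ S : E →L[ℝ] E, S.IsPositive ∧ S * S = B := by
  obtain ⟨x, hx⟩ : ∃ x : E →L[ℝ] E, x = 1 - B := ⟨_, rfl⟩
  have hx1 : ‖x‖ ≤ 1 := by rw [hx]; exact norm_one_sub_le_one hB hB1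
  have hxs : IsSelfAdjoint x := by
    rw [hx]; exact (IsSelfAdjoint.one _).sub hB.isSelfAdjoint
  refine ⟨1 - (2⁻¹ : ℝ) • (x * catalanSeries x), isPositive_one_sub_half_smul ?_ ?_, ?_⟩
  · exact (hxs.commute_iff (isSelfAdjoint_catalanSeries hx1 hxs)).1 (commute_catalanSeries x)
  · refine (norm_mul_le _ _).trans ?_
    have h2 := norm_catalanSeries_le hx1
    calc ‖x‖ * ‖catalanSeries x‖ ≤ 1 * 2 := by gcongr
      _ = 2 := one_mul 2
  · exact (sq_one_sub_catalanSeries hx1).trans (by rw [hx, sub_sub_cancel])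

/-- Rescaling by ‖Q‖ reduces to norm one. Consequently the default branch of `opSqrt` is never taken
at a positive operator. -/
lemma exists_isPositive_sq_eq {Q : E →L[ℝ] E} (hQ : Q.IsPositive) :
    ∃ S : E →L[ℝ] E, S.IsPositive ∧ S ∘L S = Q := by
  rcases eq_or_ne Q 0 with rfl | hQ0
  · exact ⟨0, ContinuousLinearMap.isPositive_zero, by simp⟩
  have hnt : Nontrivial E := by
    by_contra hE
    rw [not_nontrivial_iff_subsingleton] at hE
    exact hQ0 (Subsingleton.elim _ _)
  have hn : 0 < ‖Q‖ := norm_pos_iff.2 hQ0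
  have hB1 : ‖‖Q‖⁻¹ • Q‖ ≤ 1 := by
    rw [norm_smul, norm_inv, norm_norm, inv_mul_cancel₀ hn.ne']
  obtain ⟨S, hS, hSS⟩ := exists_isPositive_sq_eq_of_norm_le_one
    (hQ.smul_of_nonneg (inv_nonneg.2 hn.le)) hB1
  refine ⟨(√‖Q‖) • S, hS.smul_of_nonneg (Real.sqrt_nonneg _), ?_⟩
  have h4 : ((√‖Q‖) • S) * ((√‖Q‖) • S) = Q := by
    rw [smul_mul_smul_comm, hSS, Real.mul_self_sqrt hn.le, smul_smul,
      mul_inv_cancel₀ hn.ne', one_smul]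
  exact h4

lemma isPositive_opSqrt (Q : E →L[ℝ] E) : (opSqrt Q).IsPositive := by
  unfold opSqrt
  split_ifs with h
  · exact h.choose_spec.1
  · exact ContinuousLinearMap.isPositive_zero

lemma opSqrt_comp_opSqrt {Q : E →L[ℝ] E} (hQ : Q.IsPositive) : opSqrt Q ∘L opSqrt Q = Q := by
  unfold opSqrt
  rw [dif_pos (exists_isPositive_sq_eq hQ)]
  exact (exists_isPositive_sq_eq hQ).choose_spec.2

lemma adjoint_opSqrt (Q : E →L[ℝ] E) : ContinuousLinearMap.adjoint (opSqrt Q) = opSqrt Q :=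
  (isPositive_opSqrt Q).isSelfAdjoint

end Sqrt

/-! ### Images of square roots -/

section Polar

variable {E : Type*} [NormedAddCommGroup E] [InnerProductSpace ℝ E] [CompleteSpace E]
variable {F : Type*} [NormedAddCommGroup F] [InnerProductSpace ℝ F] [CompleteSpace F]
variable {G : Type*} [NormedAddCommGroup G] [InnerProductSpace ℝ G] [CompleteSpace G]

lemma ImageSpace.incl_injective (S : E →L[ℝ] F) : Function.Injective (ImageSpace.incl S) :=
  Subtype.val_injective

lemma ImageSpace.incl_eq_apply_pinv (S : E →L[ℝ] F) (y : ImageSpace S) :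
    ImageSpace.incl S y = S (ImageSpace.pinv S y) := (ImageSpace.apply_pinv S y).symm

/-- The element `S x` of the image of `S`. -/
def ImageSpace.mk (S : E →L[ℝ] F) (x : E) : ImageSpace S := ⟨S x, x, rfl⟩

lemma ImageSpace.incl_mk (S : E →L[ℝ] F) (x : E) : ImageSpace.incl S (ImageSpace.mk S x) = S x :=
  rfl

/-- Two preimages in (ker S)ᗮ of the same vector differ by an element of ker S ∩ (ker S)ᗮ = 0. -/
lemma ImageSpace.pinv_eq_of_mem (S : E →L[ℝ] F) {y : ImageSpace S} {x : E}
    (hx : x ∈ (LinearMap.ker (S : E →ₗ[ℝ] F))ᗮ) (hy : S x = ImageSpace.incl S y) :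
    ImageSpace.pinv S y = x := by
  have h : x - ImageSpace.pinv S y ∈ LinearMap.ker (S : E →ₗ[ℝ] F) := by
    simp [hy, ImageSpace.incl_eq_apply_pinv]
  have h2 : x - ImageSpace.pinv S y ∈ (LinearMap.ker (S : E →ₗ[ℝ] F))ᗮ :=
    Submodule.sub_mem _ hx (ImageSpace.pinv_mem S y)
  have := inner_self_eq_zero.1 (h2 _ h)
  exact (sub_eq_zero.1 this).symm

lemma inner_opSqrt_opSqrt {Q : E →L[ℝ] E} (hQ : Q.IsPositive) (g h : E) :
    ⟪opSqrt Q g, opSqrt Q h⟫_ℝ = ⟪Q g, h⟫_ℝ := by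
  rw [← (isPositive_opSqrt Q).inner_left_eq_inner_right, ← ContinuousLinearMap.comp_apply,
    opSqrt_comp_opSqrt hQ]

lemma norm_opSqrt_sq {Q : E →L[ℝ] E} (hQ : Q.IsPositive) (g : E) :
    ‖opSqrt Q g‖ ^ 2 = ⟪Q g, g⟫_ℝ := by
  rw [← inner_opSqrt_opSqrt hQ, real_inner_self_eq_norm_sq]

/-- A symmetric operator has range orthogonal to its kernel. Thus Q^{1/2} g is itself the
pseudo-inverse image of Q^{1/2}(Q^{1/2} g). -/
lemma opSqrt_apply_mem (Q : E →L[ℝ] E) (g : E) :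
    opSqrt Q g ∈ (LinearMap.ker (opSqrt Q : E →ₗ[ℝ] E))ᗮ := by
  intro z hz
  have hz' : opSqrt Q z = 0 := hz
  rw [← (isPositive_opSqrt Q).inner_left_eq_inner_right, hz', inner_zero_left]

/-- The adjoint of the inclusion `Q^{1/2}(U) ⊆ U`; it maps `h` to `Q h`. -/
def covMap (Q : E →L[ℝ] E) : E →L[ℝ] RKSpace Q :=
  ContinuousLinearMap.adjoint (ImageSpace.incl (opSqrt Q))

lemma inner_covMap (Q : E →L[ℝ] E) (x : RKSpace Q) (h : E) :
    ⟪x, covMap Q h⟫_ℝ = ⟪ImageSpace.incl (opSqrt Q) x, h⟫_ℝ := by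
  rw [covMap, ContinuousLinearMap.adjoint_inner_right]

lemma covMap_eq (Q : E →L[ℝ] E) (h : E) :
    covMap Q h = ImageSpace.mk (opSqrt Q) (opSqrt Q h) := by
  refine ext_inner_left ℝ fun x => ?_
  rw [inner_covMap, ImageSpace.inner_def, ImageSpace.pinv_eq_of_mem (opSqrt Q)
    (y := ImageSpace.mk (opSqrt Q) (opSqrt Q h)) (opSqrt_apply_mem Q h) rfl, ImageSpace.incl_eq_apply_pinv,
    (isPositive_opSqrt Q).inner_left_eq_inner_right]

lemma incl_covMap {Q : E →L[ℝ] E} (hQ : Q.IsPositive) (h : E) :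
    ImageSpace.incl (opSqrt Q) (covMap Q h) = Q h := by
  rw [covMap_eq, ImageSpace.incl_mk, ← ContinuousLinearMap.comp_apply, opSqrt_comp_opSqrt hQ]

/-- The covariance of W_g and W_h is therefore an inner product in U₀, and mean square statements
about W become statements about `covMap`. -/
lemma inner_covMap_covMap {Q : E →L[ℝ] E} (hQ : Q.IsPositive) (g h : E) :
    ⟪covMap Q g, covMap Q h⟫_ℝ = ⟪Q g, h⟫_ℝ := by
  rw [inner_covMap, incl_covMap hQ]

/-- (range R^*)ᗮ = ker R. Through this density the injectivity of ι enters both the polar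
decomposition and the approximation by simple processes. -/
lemma denseRange_adjoint {R : E →L[ℝ] F} (hR : Function.Injective R) :
    DenseRange (ContinuousLinearMap.adjoint R) := by
  have h : (LinearMap.range (ContinuousLinearMap.adjoint R : F →ₗ[ℝ] E))ᗮ = ⊥ := by
    rw [Submodule.eq_bot_iff]
    intro x hx
    apply hR
    rw [map_zero]
    refine ext_inner_left ℝ fun y => ?_
    rw [← ContinuousLinearMap.adjoint_inner_left, inner_zero_right]
    exact hx _ ⟨y, rfl⟩
  have h2 := Submodule.topologicalClosure_eq_top_iff.2 h
  intro x
  have h3 : x ∈ (LinearMap.range (ContinuousLinearMap.adjoint R : F →ₗ[ℝ] E)).topologicalClosure :=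
    h2 ▸ Submodule.mem_top
  exact h3

lemma denseRange_covMap (Q : E →L[ℝ] E) : DenseRange (covMap Q) :=
  denseRange_adjoint (ImageSpace.incl_injective _)

instance [TopologicalSpace.SeparableSpace E] (Q : E →L[ℝ] E) :
    TopologicalSpace.SeparableSpace (RKSpace Q) :=
  (denseRange_covMap Q).separableSpace (covMap Q).continuous

/-- Both squared norms are ⟪R R^* g, g⟫; this is the isometry behind the polar decomposition. -/
lemma norm_opSqrt_comp_adjoint (R : E →L[ℝ] F) (g : F) :
    ‖opSqrt (R ∘L ContinuousLinearMap.adjoint R) g‖ = ‖ContinuousLinearMap.adjoint R g‖ := by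
  rw [← sq_eq_sq₀ (norm_nonneg _) (norm_nonneg _),
    norm_opSqrt_sq (ContinuousLinearMap.isPositive_self_comp_adjoint R),
    ContinuousLinearMap.comp_apply, ← ContinuousLinearMap.adjoint_inner_right,
    real_inner_self_eq_norm_sq]

/-- Equality of norms makes A g ↦ B g a well-defined isometry on the range of A, which extends to
the closure by completeness of the target. The extension is expressed by sequences. -/
lemma tendsto_of_norm_map_eq {E' F' : Type*} [NormedAddCommGroup E'] [NormedSpace ℝ E']
    [NormedAddCommGroup F'] [NormedSpace ℝ F'] [CompleteSpace F'] {A : G →L[ℝ] E'} {B : G →L[ℝ] F'}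
    (h : ∀ g, ‖A g‖ = ‖B g‖) {x : E'} (hx : x ∈ closure (Set.range A)) :
    ∃ (g : ℕ → G) (y : F'), Tendsto (fun n => A (g n)) atTop (𝓝 x) ∧
      Tendsto (fun n => B (g n)) atTop (𝓝 y) ∧ ‖y‖ = ‖x‖ := by
  obtain ⟨a, ha, hlim⟩ := mem_closure_iff_seq_limit.1 hx
  choose g hg using ha
  obtain rfl : (fun n => A (g n)) = a := funext hg
  have hc : CauchySeq fun n => B (g n) := by
    rw [Metric.cauchySeq_iff]
    intro ε hε
    obtain ⟨N, hN⟩ := Metric.cauchySeq_iff.1 hlim.cauchySeq ε hε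
    refine ⟨N, fun m hm n hn => ?_⟩
    have := hN m hm n hn
    rw [dist_eq_norm, ← map_sub, h] at this
    rwa [dist_eq_norm, ← map_sub]
  obtain ⟨y, hy⟩ := cauchySeq_tendsto_of_complete hc
  refine ⟨g, y, hlim, hy, tendsto_nhds_unique hy.norm ?_⟩
  simpa [h] using hlim.norm

lemma mem_closure_range_opSqrt (Q : E →L[ℝ] E) {x : E}
    (hx : x ∈ (LinearMap.ker (opSqrt Q : E →ₗ[ℝ] E))ᗮ) : x ∈ closure (Set.range (opSqrt Q)) := by
  have h := ContinuousLinearMap.orthogonal_ker (opSqrt Q)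
  rw [adjoint_opSqrt] at h
  rw [h] at hx
  exact hx

/-- Polar decomposition: `R` is the composition of a unitary operator from `E` onto the image of
`(R R^*)^{1/2}` with the inclusion of this image. -/
lemma exists_polar {R : E →L[ℝ] F} (hR : Function.Injective R) :
    ∃ J : E ≃ₗᵢ[ℝ] RKSpace (R ∘L ContinuousLinearMap.adjoint R),
      ∀ x, ImageSpace.incl _ (J x) = R x := by
  set Q := R ∘L ContinuousLinearMap.adjoint R with hQ
  have hpos : Q.IsPositive := ContinuousLinearMap.isPositive_self_comp_adjoint R
  have hnorm : ∀ g, ‖ContinuousLinearMap.adjoint R g‖ = ‖opSqrt Q g‖ := fun g =>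
    (norm_opSqrt_comp_adjoint R g).symm
  have hSS : ∀ g, opSqrt Q (opSqrt Q g) = R (ContinuousLinearMap.adjoint R g) := fun g => by
    rw [← ContinuousLinearMap.comp_apply, opSqrt_comp_opSqrt hpos, hQ,
      ContinuousLinearMap.comp_apply]
  have hclosed : IsClosed ((LinearMap.ker (opSqrt Q : F →ₗ[ℝ] F))ᗮ : Set F) :=
    Submodule.isClosed_orthogonal _
  -- The isometry R^* g ↦ (R R^*)^{1/2} g extends to all of E, because R^* has dense range; `v` is
  -- the image of `x`.
  have key : ∀ x : E, ∃ v ∈ (LinearMap.ker (opSqrt Q : F →ₗ[ℝ] F))ᗮ,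
      opSqrt Q v = R x ∧ ‖v‖ = ‖x‖ := by
    intro x
    obtain ⟨g, v, hg, hv, hn⟩ := tendsto_of_norm_map_eq hnorm (denseRange_adjoint hR x)
    refine ⟨v, hclosed.mem_of_tendsto hv (Eventually.of_forall fun n => opSqrt_apply_mem Q _),
      ?_, hn⟩
    refine tendsto_nhds_unique (((opSqrt Q).continuous.tendsto v).comp hv) ?_
    simp only [Function.comp_def, hSS]
    exact (R.continuous.tendsto x).comp hg
  let J₀ : E →ₗ[ℝ] RKSpace Q := LinearMap.codRestrict (LinearMap.range (opSqrt Q : F →ₗ[ℝ] F))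
    (R : E →ₗ[ℝ] F) fun x => by
      obtain ⟨v, -, hv, -⟩ := key x
      exact ⟨v, hv⟩
  have hJ₀ : ∀ x, ImageSpace.incl _ (J₀ x) = R x := fun x => rfl
  let J₁ : E →ₗᵢ[ℝ] RKSpace Q :=
    { J₀ with
      norm_map' := fun x => by
        obtain ⟨v, hm, hv, hn⟩ := key x
        rw [ImageSpace.norm_def, ← hn]
        congr 1
        exact ImageSpace.pinv_eq_of_mem _ hm (hv.trans (hJ₀ x).symm) }
  -- The reverse isometry (R R^*)^{1/2} g ↦ R^* g extends to the closure of the range of the root,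
  -- which contains the pseudo-inverse of `y`.
  have hsurj : Function.Surjective J₁ := by
    intro y
    obtain ⟨g, x, hg, hx, -⟩ := tendsto_of_norm_map_eq (fun g => (hnorm g).symm)
      (mem_closure_range_opSqrt Q (ImageSpace.pinv_mem _ y))
    refine ⟨x, ImageSpace.incl_injective _ ?_⟩
    refine (hJ₀ x).trans ?_
    rw [ImageSpace.incl_eq_apply_pinv]
    refine tendsto_nhds_unique ((R.continuous.tendsto x).comp hx) ?_
    simp only [Function.comp_def, ← hSS]
    exact ((opSqrt Q).continuous.tendsto _).comp hg
  exact ⟨LinearIsometryEquiv.ofSurjective J₁ hsurj, hJ₀⟩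

/-- Distinct orthonormal vectors have distance √2, so the balls of radius 1/2 around them are
disjoint open sets. -/
lemma Orthonormal.countable_of_separable [TopologicalSpace.SeparableSpace E] {κ : Type*} {b : κ → E}
    (hb : Orthonormal ℝ b) : Countable κ := by
  have hd : Pairwise (Function.onFun Disjoint fun k => Metric.ball (b k) (1 / 2)) := by
    intro i j hij
    refine Metric.ball_disjoint_ball ?_
    have h : ‖b i - b j‖ ^ 2 = 2 := by
      rw [norm_sub_sq_real, hb.1 i, hb.1 j, hb.2 hij]; norm_num
    rw [dist_eq_norm]
    nlinarith [norm_nonneg (b i - b j)]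
  exact Pairwise.countable_of_isOpen_disjoint hd (fun _ => Metric.isOpen_ball)
    fun k => ⟨b k, Metric.mem_ball_self (by norm_num)⟩

instance [TopologicalSpace.SeparableSpace E] : Countable (BasisIndex E) :=
  Orthonormal.countable_of_separable (stdBasis E).orthonormal

/-- The reproducing kernel space has an orthonormal basis which consists of elements `Q h`. -/
lemma exists_hilbertBasis_covMap [TopologicalSpace.SeparableSpace E] (Q : E →L[ℝ] E) :
    ∃ (κ : Set (RKSpace Q)) (f : HilbertBasis κ ℝ (RKSpace Q)) (h : κ → E),
      ∀ k, f k = covMap Q (h k) := by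
  classical
  -- Gram-Schmidt forms only finite linear combinations, so the basis stays in the range of
  -- `covMap`, which need not be closed.
  set d : ℕ → RKSpace Q := fun n => covMap Q (TopologicalSpace.denseSeq E n) with hd
  have hdd : DenseRange d :=
    (denseRange_covMap Q).comp (TopologicalSpace.denseRange_denseSeq E) (covMap Q).continuous
  set e : ℕ → RKSpace Q := InnerProductSpace.gramSchmidtNormed ℝ d with he
  have hspan : Submodule.span ℝ (Set.range e) = Submodule.span ℝ (Set.range d) := by
    rw [he, InnerProductSpace.span_gramSchmidtNormed_range, InnerProductSpace.span_gramSchmidt]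
  -- Gram-Schmidt returns 0 at a vector dependent on its predecessors; these zeros are discarded.
  set κ : Set (RKSpace Q) := Set.range e \ {0} with hκ
  have hspan2 : Submodule.span ℝ κ = Submodule.span ℝ (Set.range d) := by
    rw [hκ, Submodule.span_sdiff_singleton_zero, hspan]
  have hon : Orthonormal ℝ (fun k : κ => (k : RKSpace Q)) := by
    have h := InnerProductSpace.gramSchmidtNormed_orthonormal' (𝕜 := ℝ) d
    rw [orthonormal_subtype_iff_ite]
    rintro _ ⟨⟨m, rfl⟩, hm⟩ _ ⟨⟨n, rfl⟩, hn⟩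
    rw [orthonormal_iff_ite] at h
    have := h ⟨m, hm⟩ ⟨n, hn⟩
    rw [he]
    split_ifs with heq
    · rw [← heq]
      simpa using h ⟨m, hm⟩ ⟨m, hm⟩
    · rw [if_neg (fun hmn => heq (by rw [Subtype.mk.inj hmn]))] at this
      exact this
  have hdense : ⊤ ≤ (Submodule.span ℝ (Set.range fun k : κ => (k : RKSpace Q))).topologicalClosure := by
    rw [Subtype.range_coe, hspan2]
    intro x _
    exact closure_mono Submodule.subset_span (hdd x)
  have hmem : ∀ k : κ, ∃ h : E, (k : RKSpace Q) = covMap Q h := by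
    intro k
    have h1 : (k : RKSpace Q) ∈ Submodule.span ℝ (Set.range d) := by
      rw [← hspan2]; exact Submodule.subset_span k.2
    have h2 : Submodule.span ℝ (Set.range d) ≤ LinearMap.range (covMap Q : E →ₗ[ℝ] RKSpace Q) := by
      rw [Submodule.span_le]
      rintro _ ⟨n, rfl⟩
      exact ⟨_, rfl⟩
    obtain ⟨h, hh⟩ := h2 h1
    exact ⟨h, hh.symm⟩
  choose h hh using hmem
  refine ⟨κ, HilbertBasis.mk hon hdense, h, fun k => ?_⟩
  rw [HilbertBasis.coe_mk]
  exact hh k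

end Polar

/-! ### Mean square estimates -/

section MeanSquare

variable {Ω : Type*} {mΩ : MeasurableSpace Ω} {P : Measure Ω}
variable {H : Type*} [NormedAddCommGroup H]

/-- ‖a + b‖ ≤ 2 max(‖a‖, ‖b‖). The constant 4 is not sharp, but only its finiteness matters. -/
lemma enorm_add_sq_le (a b : H) : ‖a + b‖ₑ ^ 2 ≤ 4 * ‖a‖ₑ ^ 2 + 4 * ‖b‖ₑ ^ 2 := by
  have h : ‖a + b‖ₑ ≤ ‖a‖ₑ + ‖b‖ₑ := enorm_add_le a b
  rcases le_total ‖a‖ₑ ‖b‖ₑ with hab | hab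
  · calc ‖a + b‖ₑ ^ 2 ≤ (2 * ‖b‖ₑ) ^ 2 := by
          gcongr
          exact h.trans (by rw [two_mul]; gcongr)
      _ = 4 * ‖b‖ₑ ^ 2 := by rw [mul_pow]; norm_num
      _ ≤ _ := le_add_self
  · calc ‖a + b‖ₑ ^ 2 ≤ (2 * ‖a‖ₑ) ^ 2 := by
          gcongr
          exact h.trans (by rw [two_mul]; gcongr)
      _ = 4 * ‖a‖ₑ ^ 2 := by rw [mul_pow]; norm_num
      _ ≤ _ := le_self_add

lemma eLpNorm_two_sq (f : Ω → H) : eLpNorm f 2 P ^ 2 = ∫⁻ ω, ‖f ω‖ₑ ^ 2 ∂P := by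
  have h := eLpNorm_nnreal_pow_eq_lintegral (f := f) (μ := P) (p := 2) two_ne_zero
  simpa using h

lemma memLp_two_of_lintegral {f : Ω → H} (hf : AEStronglyMeasurable f P)
    (h : ∫⁻ ω, ‖f ω‖ₑ ^ 2 ∂P < ∞) : MemLp f 2 P := by
  refine ⟨hf, ?_⟩
  rw [← eLpNorm_two_sq] at h
  by_contra hc
  rw [not_lt, top_le_iff] at hc
  simp [hc] at h

lemma _root_.MeasureTheory.MemLp.lintegral_sq_lt_top {f : Ω → H} (hf : MemLp f 2 P) :
    ∫⁻ ω, ‖f ω‖ₑ ^ 2 ∂P < ∞ := by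
  rw [← eLpNorm_two_sq]
  exact ENNReal.pow_lt_top hf.2

lemma lintegral_enorm_add_sq_le {f g : Ω → H} (hf : AEStronglyMeasurable f P) :
    ∫⁻ ω, ‖f ω + g ω‖ₑ ^ 2 ∂P ≤ 4 * ∫⁻ ω, ‖f ω‖ₑ ^ 2 ∂P + 4 * ∫⁻ ω, ‖g ω‖ₑ ^ 2 ∂P := by
  calc ∫⁻ ω, ‖f ω + g ω‖ₑ ^ 2 ∂P ≤ ∫⁻ ω, (4 * ‖f ω‖ₑ ^ 2 + 4 * ‖g ω‖ₑ ^ 2) ∂P :=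
        lintegral_mono fun ω => enorm_add_sq_le _ _
    _ = _ := by
        rw [lintegral_add_left' ((hf.enorm.pow_const _).const_mul _),
          lintegral_const_mul' _ _ (by simp), lintegral_const_mul' _ _ (by simp)]

lemma lintegral_enorm_sub_sq_le {f g h : Ω → H} (hfg : AEStronglyMeasurable (fun ω => f ω - g ω) P) :
    ∫⁻ ω, ‖f ω - h ω‖ₑ ^ 2 ∂P ≤
      4 * ∫⁻ ω, ‖f ω - g ω‖ₑ ^ 2 ∂P + 4 * ∫⁻ ω, ‖g ω - h ω‖ₑ ^ 2 ∂P := by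
  have := lintegral_enorm_add_sq_le (f := fun ω => f ω - g ω) (g := fun ω => g ω - h ω) hfg
  simpa using this

lemma lintegral_enorm_sq_le_sq [IsProbabilityMeasure P] {f : Ω → H}
    (hf : AEStronglyMeasurable f P) : (∫⁻ ω, ‖f ω‖ₑ ∂P) ^ 2 ≤ ∫⁻ ω, ‖f ω‖ₑ ^ 2 ∂P := by
  rw [← eLpNorm_two_sq, ← eLpNorm_one_eq_lintegral_enorm]
  gcongr
  exact eLpNorm_le_eLpNorm_of_exponent_le (by norm_num) hf

lemma ae_eq_of_lintegral_enorm_sub_sq_eq_zero {f g : Ω → H} (hfg : AEStronglyMeasurable (fun ω => f ω - g ω) P)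
    (h : ∫⁻ ω, ‖f ω - g ω‖ₑ ^ 2 ∂P = 0) : f =ᵐ[P] g := by
  rw [lintegral_eq_zero_iff' (hfg.enorm.pow_const _)] at h
  filter_upwards [h] with ω hω
  have : ‖f ω - g ω‖ₑ ^ 2 = 0 := hω
  simpa [sub_eq_zero] using this

/-- Fatou's lemma for mean square distances. -/
lemma lintegral_enorm_sub_sq_le_of_tendsto {f : Ω → H} {g : ℕ → Ω → H} {h : Ω → H} {c : ℝ≥0∞}
    (hg : ∀ n, AEStronglyMeasurable (fun ω => f ω - g n ω) P)
    (hlim : ∀ᵐ ω ∂P, Tendsto (fun n => g n ω) atTop (𝓝 (h ω)))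
    (hc : ∀ᶠ n in atTop, ∫⁻ ω, ‖f ω - g n ω‖ₑ ^ 2 ∂P ≤ c) :
    ∫⁻ ω, ‖f ω - h ω‖ₑ ^ 2 ∂P ≤ c := by
  calc ∫⁻ ω, ‖f ω - h ω‖ₑ ^ 2 ∂P
      = ∫⁻ ω, liminf (fun n => ‖f ω - g n ω‖ₑ ^ 2) atTop ∂P := by
        refine lintegral_congr_ae ?_
        filter_upwards [hlim] with ω hω
        refine (Tendsto.liminf_eq ?_).symm
        exact (ENNReal.continuous_pow 2).continuousAt.tendsto.comp
          ((tendsto_const_nhds.sub hω).enorm)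
    _ ≤ liminf (fun n => ∫⁻ ω, ‖f ω - g n ω‖ₑ ^ 2 ∂P) atTop :=
        lintegral_liminf_le' fun n => (hg n).enorm.pow_const _
    _ ≤ c := liminf_le_of_frequently_le' hc.frequently

end MeanSquare

/-! ### Continuous square integrable martingales -/

section Martingales

variable {Ω : Type*} {mΩ : MeasurableSpace Ω} {P : Measure Ω} [IsProbabilityMeasure P]
variable {T : ℝ} [Fact (0 < T)] {𝓕 : Filtration (Time T) mΩ}
variable {H : Type*} [NormedAddCommGroup H] [InnerProductSpace ℝ H] [CompleteSpace H]

instance (m : MeasurableSpace Ω) (hm : m ≤ mΩ) : SigmaFinite (P.trim hm) := inferInstance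

/-- The norm of a vector-valued martingale is a submartingale: conditional expectation contracts the
L¹ norm over every past event. -/
lemma setLIntegral_enorm_le_of_martingale {M : Time T → Ω → H} (hM : Martingale M 𝓕 P)
    {s t : Time T} (hst : s ≤ t) {B : Set Ω} (hB : MeasurableSet[𝓕 s] B) :
    ∫⁻ ω in B, ‖M s ω‖ₑ ∂P ≤ ∫⁻ ω in B, ‖M t ω‖ₑ ∂P := by
  rw [← ofReal_integral_norm_eq_lintegral_enorm (hM.integrable s).integrableOn,
    ← ofReal_integral_norm_eq_lintegral_enorm (hM.integrable t).integrableOn]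
  refine ENNReal.ofReal_le_ofReal ?_
  refine le_of_eq_of_le ?_ (setIntegral_norm_condExp_le hB (M t))
  refine integral_congr_ae (ae_restrict_of_ae ?_)
  filter_upwards [hM.condExp_ae_eq hst] with ω hω
  rw [hω]

lemma lintegral_enorm_sq_le_of_martingale {M : Time T → Ω → H} (hM : Martingale M 𝓕 P)
    {s t : Time T} (hst : s ≤ t) : ∫⁻ ω, ‖M s ω‖ₑ ^ 2 ∂P ≤ ∫⁻ ω, ‖M t ω‖ₑ ^ 2 ∂P := by
  rw [← eLpNorm_two_sq, ← eLpNorm_two_sq]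
  gcongr
  rw [← eLpNorm_congr_ae (hM.condExp_ae_eq hst)]
  exact eLpNorm_condExp_le_eLpNorm _ (by norm_num)

/-- Doob's maximal inequality for finitely many times. -/
lemma mul_measure_exists_finset_lt_le {M : Time T → Ω → H} (hM : Martingale M 𝓕 P)
    (ε : ℝ≥0∞) (S : Finset (Time T)) :
    ε * P {ω | ∃ s ∈ S, ε < ‖M s ω‖ₑ} ≤ ∫⁻ ω, ‖M ⊤ ω‖ₑ ∂P := by
  have hmeas : ∀ s, MeasurableSet[𝓕 s] {ω | ε < ‖M s ω‖ₑ} := fun s => by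
    have h1 : Measurable[𝓕 s] fun ω => ‖M s ω‖ₑ :=
      StronglyMeasurable.enorm (hM.stronglyAdapted s)
    exact measurableSet_lt measurable_const h1
  -- Induction over the times in increasing order. `A` is the event that ε was exceeded before `a`,
  -- and `B` that it is exceeded at `a` for the first time; on `B` the submartingale property moves
  -- the time from `a` to `t`.
  have key : ∀ S : Finset (Time T), ∀ t, (∀ s ∈ S, s ≤ t) →
      MeasurableSet[𝓕 t] {ω | ∃ s ∈ S, ε < ‖M s ω‖ₑ} ∧
      ε * P {ω | ∃ s ∈ S, ε < ‖M s ω‖ₑ} ≤ ∫⁻ ω in {ω | ∃ s ∈ S, ε < ‖M s ω‖ₑ}, ‖M t ω‖ₑ ∂P := by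
    intro S
    induction S using Finset.induction_on_max with
    | empty => simp
    | insert a S ha ih =>
      intro t ht
      have hat : a ≤ t := ht a (Finset.mem_insert_self _ _)
      have hA := ih a fun s hs => (ha s hs).le
      have hA' := ih t fun s hs => ht s (Finset.mem_insert_of_mem hs)
      set A := {ω | ∃ s ∈ S, ε < ‖M s ω‖ₑ} with hAdef
      set B := {ω | ε < ‖M a ω‖ₑ} \ A with hBdef
      have hB : MeasurableSet[𝓕 a] B := (hmeas a).diff hA.1
      have hU : {ω | ∃ s ∈ insert a S, ε < ‖M s ω‖ₑ} = A ∪ B := by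
        ext ω
        simp only [hAdef, hBdef, Finset.mem_insert, exists_eq_or_imp, Set.mem_union, Set.mem_sdiff,
          Set.mem_ofPred_eq]
        by_cases h : ∃ s ∈ S, ε < ‖M s ω‖ₑ <;> simp [h]
      have hd : Disjoint A B := Set.disjoint_sdiff_right
      have hBm : MeasurableSet B := 𝓕.le _ _ hB
      rw [hU]
      refine ⟨hA'.1.union (𝓕.mono hat _ hB), ?_⟩
      rw [measure_union hd hBm, mul_add, lintegral_union hBm hd]
      refine add_le_add hA'.2 ?_
      refine le_trans ?_ (setLIntegral_enorm_le_of_martingale hM hat hB)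
      rw [← setLIntegral_const]
      exact setLIntegral_mono' hBm fun ω hω => hω.1.le
  exact (key S ⊤ fun s _ => le_top).2.trans (setLIntegral_le_lintegral _ _)

/-- Doob's maximal inequality for martingales with continuous paths. -/
lemma mul_measure_exists_lt_le {M : Time T → Ω → H} (hM : Martingale M 𝓕 P)
    (hc : ∀ᵐ ω ∂P, Continuous (M · ω)) (ε : ℝ≥0∞) :
    ε * P {ω | ∃ t, ε < ‖M t ω‖ₑ} ≤ ∫⁻ ω, ‖M ⊤ ω‖ₑ ∂P := by
  set d := TopologicalSpace.denseSeq (Time T) with hd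
  set A : ℕ → Set Ω := fun n => {ω | ∃ s ∈ (Finset.range n).image d, ε < ‖M s ω‖ₑ} with hA
  have hmono : Monotone A := by
    intro m n hmn ω
    rintro ⟨s, hs, h⟩
    exact ⟨s, Finset.image_subset_image (Finset.range_mono hmn) hs, h⟩
  have hle : P {ω | ∃ t, ε < ‖M t ω‖ₑ} ≤ P (⋃ n, A n) := by
    refine measure_mono_ae ?_
    filter_upwards [hc] with ω hω
    rintro ⟨t, ht⟩
    have ho : IsOpen {t | ε < ‖M t ω‖ₑ} := isOpen_lt continuous_const hω.enorm
    obtain ⟨n, hn⟩ := (TopologicalSpace.denseRange_denseSeq (Time T)).exists_mem_open ho ⟨t, ht⟩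
    exact Set.mem_iUnion.2 ⟨n + 1, d n, Finset.mem_image_of_mem _ (Finset.self_mem_range_succ n), hn⟩
  refine (mul_le_mul_right hle _).trans ?_
  rw [hmono.measure_iUnion, ENNReal.mul_iSup]
  exact iSup_le fun n => mul_measure_exists_finset_lt_le hM ε _

/-- Continuous, square integrable martingales on `[0, T]`. -/
structure IsContL2Martingale (𝓕 : Filtration (Time T) mΩ) (P : Measure Ω) (M : Time T → Ω → H) :
    Prop where
  martingale : Martingale M 𝓕 P
  continuous : ∀ᵐ ω ∂P, Continuous (M · ω)
  sq_lt_top : ∫⁻ ω, ‖M ⊤ ω‖ₑ ^ 2 ∂P < ∞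

namespace IsContL2Martingale

variable {M N : Time T → Ω → H}

lemma aestronglyMeasurable (hM : IsContL2Martingale 𝓕 P M) (t : Time T) :
    AEStronglyMeasurable (M t) P := (hM.martingale.integrable t).1

lemma sq_lt_top' (hM : IsContL2Martingale 𝓕 P M) (t : Time T) : ∫⁻ ω, ‖M t ω‖ₑ ^ 2 ∂P < ∞ :=
  (lintegral_enorm_sq_le_of_martingale hM.martingale le_top).trans_lt hM.sq_lt_top

lemma memLp (hM : IsContL2Martingale 𝓕 P M) (t : Time T) : MemLp (M t) 2 P :=
  memLp_two_of_lintegral (hM.aestronglyMeasurable t) (hM.sq_lt_top' t)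

lemma sub (hM : IsContL2Martingale 𝓕 P M) (hN : IsContL2Martingale 𝓕 P N) :
    IsContL2Martingale 𝓕 P (fun t ω => M t ω - N t ω) where
  martingale := hM.martingale.sub hN.martingale
  continuous := by
    filter_upwards [hM.continuous, hN.continuous] with ω h1 h2 using h1.sub h2
  sq_lt_top := ((hM.memLp ⊤).sub (hN.memLp ⊤)).lintegral_sq_lt_top

lemma lintegral_sub_sq_le (hM : IsContL2Martingale 𝓕 P M) (hN : IsContL2Martingale 𝓕 P N)
    (t : Time T) : ∫⁻ ω, ‖M t ω - N t ω‖ₑ ^ 2 ∂P ≤ ∫⁻ ω, ‖M ⊤ ω - N ⊤ ω‖ₑ ^ 2 ∂P :=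
  lintegral_enorm_sq_le_of_martingale (hM.sub hN).martingale le_top

end IsContL2Martingale

/-- Doob's inequality at level 2^{-k}, with mean norm at most 4^{-k}, bounds the exceptional
probabilities by 2^{-k}; Borel-Cantelli concludes. -/
lemma ae_eventually_forall_enorm_le {D : ℕ → Time T → Ω → H}
    (hD : ∀ k, IsContL2Martingale 𝓕 P (D k))
    (hle : ∀ k, ∫⁻ ω, ‖D k ⊤ ω‖ₑ ^ 2 ∂P ≤ ((4⁻¹ : ℝ≥0∞) ^ k) ^ 2) :
    ∀ᵐ ω ∂P, ∀ᶠ k in atTop, ∀ t, ‖D k t ω‖ₑ ≤ (2⁻¹ : ℝ≥0∞) ^ k := by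
  have h1 : ∀ k, P {ω | ∃ t, (2⁻¹ : ℝ≥0∞) ^ k < ‖D k t ω‖ₑ} ≤ (2⁻¹ : ℝ≥0∞) ^ k := by
    intro k
    have hm := mul_measure_exists_lt_le (hD k).martingale (hD k).continuous ((2⁻¹ : ℝ≥0∞) ^ k)
    have h2 : ∫⁻ ω, ‖D k ⊤ ω‖ₑ ∂P ≤ (4⁻¹ : ℝ≥0∞) ^ k := by
      have := (lintegral_enorm_sq_le_sq ((hD k).aestronglyMeasurable ⊤)).trans (hle k)
      exact (ENNReal.pow_le_pow_left_iff two_ne_zero).1 this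
    have h4 : (4⁻¹ : ℝ≥0∞) ^ k = (2⁻¹ : ℝ≥0∞) ^ k * (2⁻¹ : ℝ≥0∞) ^ k := by
      rw [← mul_pow, ← ENNReal.mul_inv (by simp) (by simp)]
      norm_num
    rw [h4] at h2
    exact (ENNReal.mul_le_mul_iff_right (pow_ne_zero _ (by simp))
      (ENNReal.pow_ne_top (by simp))).1 (hm.trans h2)
  have h3 : ∑' k, P {ω | ∃ t, (2⁻¹ : ℝ≥0∞) ^ k < ‖D k t ω‖ₑ} ≠ ∞ := by
    refine ne_top_of_le_ne_top ?_ (ENNReal.tsum_le_tsum h1)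
    rw [ENNReal.tsum_geometric]
    simp
  filter_upwards [ae_eventually_notMem h3] with ω hω
  filter_upwards [hω] with k hk
  simpa using hk

lemma exists_strictMono_of_tendsto_zero {a : ℕ → ℝ≥0∞} (ha : Tendsto a atTop (𝓝 0))
    {b : ℕ → ℝ≥0∞} (hb : ∀ k, b k ≠ 0) : ∃ φ : ℕ → ℕ, StrictMono φ ∧ ∀ k, a (φ k) ≤ b k := by
  refine extraction_forall_of_eventually (P := fun k n => a n ≤ b k) fun k => ?_
  exact ha.eventually (eventually_le_nhds (pos_iff_ne_zero.2 (hb k)))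

lemma four_inv_pow_sq_ne_zero (k : ℕ) : ((4⁻¹ : ℝ≥0∞) ^ k) ^ 2 ≠ 0 :=
  pow_ne_zero _ (pow_ne_zero _ (by simp))

lemma tendsto_two_inv_pow : Tendsto (fun k : ℕ => (2⁻¹ : ℝ≥0∞) ^ k) atTop (𝓝 0) :=
  ENNReal.tendsto_pow_atTop_nhds_zero_of_lt_one (by simp)

/-- Mean square convergence of continuous martingales implies almost sure uniform convergence
along a subsequence. -/
lemma exists_subseq_ae_tendsto {M : ℕ → Time T → Ω → H} {N : Time T → Ω → H}
    (hM : ∀ n, IsContL2Martingale 𝓕 P (M n)) (hN : IsContL2Martingale 𝓕 P N)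
    (hlim : Tendsto (fun n => ∫⁻ ω, ‖M n ⊤ ω - N ⊤ ω‖ₑ ^ 2 ∂P) atTop (𝓝 0)) :
    ∃ φ : ℕ → ℕ, StrictMono φ ∧ ∀ᵐ ω ∂P, ∀ᶠ k in atTop, ∀ t,
      ‖M (φ k) t ω - N t ω‖ₑ ≤ (2⁻¹ : ℝ≥0∞) ^ k := by
  obtain ⟨φ, hφ, hle⟩ := exists_strictMono_of_tendsto_zero hlim four_inv_pow_sq_ne_zero
  exact ⟨φ, hφ, ae_eventually_forall_enorm_le (fun k => (hM (φ k)).sub hN) hle⟩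

/-- A mean square limit of martingales is a martingale. -/
lemma martingale_of_tendsto {M : ℕ → Time T → Ω → H} {N : Time T → Ω → H}
    (hM : ∀ n, Martingale (M n) 𝓕 P) (hN : StronglyAdapted 𝓕 N)
    (hi : ∀ t, Integrable (N t) P)
    (hlim : ∀ t, Tendsto (fun n => ∫⁻ ω, ‖M n t ω - N t ω‖ₑ ^ 2 ∂P) atTop (𝓝 0)) :
    Martingale N 𝓕 P := by
  have hlim1 : ∀ t, Tendsto (fun n => eLpNorm (fun ω => M n t ω - N t ω) 1 P) atTop (𝓝 0) := by
    intro t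
    have h2 : Tendsto (fun n => eLpNorm (fun ω => M n t ω - N t ω) 2 P) atTop (𝓝 0) := by
      have h3 : ∀ n, eLpNorm (fun ω => M n t ω - N t ω) 2 P
          = (∫⁻ ω, ‖M n t ω - N t ω‖ₑ ^ 2 ∂P) ^ (2⁻¹ : ℝ) := fun n => by
        rw [← eLpNorm_two_sq, ← ENNReal.rpow_natCast, ← ENNReal.rpow_mul]
        norm_num
      simp_rw [h3]
      have := (hlim t).ennrpow_const (2⁻¹ : ℝ)
      simpa using this
    refine tendsto_of_tendsto_of_tendsto_of_le_of_le tendsto_const_nhds h2 (fun _ => zero_le) ?_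
    intro n
    exact eLpNorm_le_eLpNorm_of_exponent_le (by norm_num)
      (((hM n).integrable t).sub (hi t)).1
  refine ⟨hN, fun s t hst => ?_⟩
  -- For every n, contraction of conditional expectation in L¹ bounds the left side by E‖M^n_t -
  -- N_t‖ + E‖M^n_s - N_s‖.
  have hz : eLpNorm (fun ω => (P[N t | 𝓕 s]) ω - N s ω) 1 P ≤ 0 := by
    refine ge_of_tendsto' (x := atTop) (by simpa using (hlim1 t).add (hlim1 s)) fun n => ?_
    have h1 : (fun ω => (P[N t | 𝓕 s]) ω - N s ω) =ᵐ[P]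
        (fun ω => - (P[fun ω => M n t ω - N t ω | 𝓕 s]) ω + (M n s ω - N s ω)) := by
      filter_upwards [condExp_sub ((hM n).integrable t) (hi t) (𝓕 s), (hM n).condExp_ae_eq hst]
        with ω h2 h3
      have h4 : (P[fun ω => M n t ω - N t ω | 𝓕 s]) ω = (P[M n t | 𝓕 s]) ω - (P[N t | 𝓕 s]) ω := h2
      rw [h4, h3]; abel
    rw [eLpNorm_congr_ae h1]
    refine (eLpNorm_add_le integrable_condExp.1.neg
      (((hM n).integrable s).sub (hi s)).1 le_rfl).trans ?_
    refine add_le_add ?_ le_rfl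
    have := eLpNorm_neg (f := P[fun ω => M n t ω - N t ω | 𝓕 s]) (p := 1) (μ := P)
    refine (le_of_eq this).trans ?_
    exact eLpNorm_condExp_le_eLpNorm _ le_rfl
  have hz' := le_antisymm hz zero_le
  replace hz' := (eLpNorm_eq_zero_iff (integrable_condExp.sub (hi s)).1 one_ne_zero).1 hz'
  filter_upwards [hz'] with ω hω
  exact sub_eq_zero.1 hω

/-- A measurable null set which contains the exceptional set of an almost sure property. -/
lemma exists_measurable_null {p : Ω → Prop} (hp : ∀ᵐ ω ∂P, p ω) :
    ∃ N : Set Ω, MeasurableSet N ∧ P N = 0 ∧ ∀ ω ∉ N, p ω := by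
  refine ⟨toMeasurable P {ω | ¬ p ω}, measurableSet_toMeasurable _ _, ?_, fun ω hω => ?_⟩
  · rw [measure_toMeasurable]; exact hp
  · by_contra h
    exact hω (subset_toMeasurable _ _ h)

lemma ae_notMem_of_null {N : Set Ω} (hN : P N = 0) : ∀ᵐ ω ∂P, ω ∉ N :=
  measure_eq_zero_iff_ae_notMem.1 hN

lemma IsNormal.measurableSet (h𝓕 : IsNormal 𝓕 P) {N : Set Ω} (hN : MeasurableSet N)
    (h0 : P N = 0) (t : Time T) : MeasurableSet[𝓕 t] N :=
  𝓕.mono bot_le _ (h𝓕.null_sets N hN h0)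

/-- Paths can be set to zero on a null set without losing adaptedness. In this way normality of the
filtration enters the construction of everywhere continuous versions. -/
lemma stronglyMeasurable_compl_indicator (h𝓕 : IsNormal 𝓕 P) {N : Set Ω} (hN : MeasurableSet N)
    (h0 : P N = 0) {t : Time T} {f : Ω → H} (hf : StronglyMeasurable[𝓕 t] f) :
    StronglyMeasurable[𝓕 t] (Nᶜ.indicator f) :=
  hf.indicator (h𝓕.measurableSet hN h0 t).compl

/-- Completeness of the space of continuous square integrable martingales. -/
lemma exists_limit_of_cauchy (h𝓕 : IsNormal 𝓕 P) {M : ℕ → Time T → Ω → H}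
    (hM : ∀ n, IsContL2Martingale 𝓕 P (M n))
    (hcauchy : ∀ ε : ℝ≥0∞, 0 < ε → ∃ n₀, ∀ m ≥ n₀, ∀ n ≥ n₀,
      ∫⁻ ω, ‖M m ⊤ ω - M n ⊤ ω‖ₑ ^ 2 ∂P ≤ ε) :
    ∃ N : Time T → Ω → H, IsContL2Martingale 𝓕 P N ∧ (∀ ω, Continuous (N · ω)) ∧
      Tendsto (fun n => ∫⁻ ω, ‖M n ⊤ ω - N ⊤ ω‖ₑ ^ 2 ∂P) atTop (𝓝 0) := by
  -- A subsequence with mean square steps at most 16^{-k}: its paths almost surely move by at most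
  -- 2^{-k}, uniformly in time, from step k to step k + 1 for large k.
  choose n₀ hn₀ using fun k : ℕ => hcauchy (((4⁻¹ : ℝ≥0∞) ^ k) ^ 2)
    (pos_iff_ne_zero.2 (four_inv_pow_sq_ne_zero k))
  obtain ⟨φ, hφ, hφn⟩ : ∃ φ : ℕ → ℕ, StrictMono φ ∧ ∀ k, n₀ k ≤ φ k :=
    extraction_forall_of_eventually fun k => eventually_ge_atTop (n₀ k)
  have hev := ae_eventually_forall_enorm_le (P := P)
    (fun k => (hM (φ (k + 1))).sub (hM (φ k)))
    (fun k => hn₀ k _ ((hφn k).trans (hφ.monotone k.le_succ)) _ (hφn k))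
  have hcont : ∀ᵐ ω ∂P, ∀ k, Continuous (M (φ k) · ω) :=
    ae_all_iff.2 fun k => (hM (φ k)).continuous
  obtain ⟨Z, hZm, hZ0, hZ⟩ := exists_measurable_null (hev.and hcont)
  have hunif : ∀ ω ∉ Z, ∃ f : Time T → H, Continuous f ∧
      ∀ t, Tendsto (fun k => M (φ k) t ω) atTop (𝓝 (f t)) := by
    intro ω hω
    obtain ⟨h1, h2⟩ := hZ ω hω
    let g : ℕ → C(Time T, H) := fun k => ⟨fun t => M (φ k) t ω, h2 k⟩
    have hg : CauchySeq g := by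
      obtain ⟨K, hK⟩ := eventually_atTop.1 h1
      rw [← cauchySeq_shift K]
      refine cauchySeq_of_edist_le_geometric 2⁻¹ (2⁻¹ ^ K) (by simp)
        (ENNReal.pow_ne_top (by simp)) fun k => ?_
      rw [← pow_add, edist_comm, edist_eq_enorm_sub, ← ofReal_norm, add_comm K k]
      refine ENNReal.ofReal_le_of_le_toReal ?_
      refine (ContinuousMap.norm_le _ ENNReal.toReal_nonneg).2 fun t => ?_
      have := hK (k + K) (by omega) t
      rw [← toReal_enorm]
      refine ENNReal.toReal_mono (ENNReal.pow_ne_top (by simp)) ?_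
      have h3 : (g (k + 1 + K) - g (k + K)) t = M (φ (k + K + 1)) t ω - M (φ (k + K)) t ω := by
        simp only [g, ContinuousMap.sub_apply, ContinuousMap.coe_mk]
        rw [show k + 1 + K = k + K + 1 by omega]
      rw [h3]
      exact this
    obtain ⟨f, hf⟩ := cauchySeq_tendsto_of_complete hg
    exact ⟨f, f.continuous, fun t => (continuous_eval_const t).continuousAt.tendsto.comp hf⟩
  choose! f hfc hft using hunif
  classical
  let N : Time T → Ω → H := fun t => Zᶜ.indicator fun ω => f ω t
  have hNlim : ∀ t ω, Tendsto (fun k => Zᶜ.indicator (M (φ k) t) ω) atTop (𝓝 (N t ω)) := by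
    intro t ω
    by_cases hω : ω ∈ Z
    · simp [N, hω]
    · simpa [N, hω] using hft ω hω t
  have hNc : ∀ ω, Continuous (N · ω) := by
    intro ω
    by_cases hω : ω ∈ Z
    · simp only [N, Set.indicator, Set.mem_compl_iff, hω, not_true_eq_false, if_false]
      exact continuous_const
    · simp only [N, Set.indicator, Set.mem_compl_iff, hω, not_false_eq_true, if_true]
      exact hfc ω hω
  have hNa : StronglyAdapted 𝓕 N := fun t =>
    stronglyMeasurable_of_tendsto atTop (fun k => stronglyMeasurable_compl_indicator h𝓕 hZm hZ0
      ((hM (φ k)).martingale.stronglyAdapted t)) (tendsto_pi_nhds.2 (hNlim t))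
  have hNlim' : ∀ t, ∀ᵐ ω ∂P, Tendsto (fun k => M (φ k) t ω) atTop (𝓝 (N t ω)) := by
    intro t
    filter_upwards [ae_notMem_of_null hZ0] with ω hω
    simpa [hω] using hNlim t ω
  -- Fatou's lemma along the subsequence carries the Cauchy bound over to the limit, for the whole
  -- sequence and uniformly in time.
  have hdist : ∀ ε : ℝ≥0∞, 0 < ε → ∃ m, ∀ n ≥ m, ∀ t, ∫⁻ ω, ‖M n t ω - N t ω‖ₑ ^ 2 ∂P ≤ ε := by
    intro ε hε
    obtain ⟨m, hm⟩ := hcauchy ε hε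
    refine ⟨m, fun n hn t => ?_⟩
    refine lintegral_enorm_sub_sq_le_of_tendsto
      (fun k => ((hM n).sub (hM (φ k))).aestronglyMeasurable t) (hNlim' t) ?_
    filter_upwards [eventually_ge_atTop m] with k hk
    exact ((hM n).lintegral_sub_sq_le (hM (φ k)) t).trans (hm n hn _ (hk.trans (hφ.id_le k)))
  have htend : ∀ t, Tendsto (fun n => ∫⁻ ω, ‖M n t ω - N t ω‖ₑ ^ 2 ∂P) atTop (𝓝 0) := by
    intro t
    rw [ENNReal.tendsto_nhds_zero]
    intro ε hε
    obtain ⟨m, hm⟩ := hdist ε hε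
    filter_upwards [eventually_ge_atTop m] with n hn using hm n hn t
  have hNsq : ∀ t, MemLp (N t) 2 P := by
    intro t
    obtain ⟨m, hm⟩ := hdist 1 one_pos
    have hNm : AEStronglyMeasurable (N t) P := ((hNa t).mono (𝓕.le t)).aestronglyMeasurable
    have h1 : MemLp (fun ω => M m t ω - N t ω) 2 P :=
      memLp_two_of_lintegral (((hM m).aestronglyMeasurable t).sub hNm)
        ((hm m le_rfl t).trans_lt (by simp))
    have h2 := ((hM m).memLp t).sub h1
    refine h2.ae_eq (Eventually.of_forall fun ω => ?_)
    simp
  refine ⟨N, ⟨martingale_of_tendsto (fun n => (hM n).martingale) hNa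
    (fun t => (hNsq t).integrable (by norm_num)) htend, Eventually.of_forall hNc,
    (hNsq ⊤).lintegral_sq_lt_top⟩, hNc, htend ⊤⟩

/-- Two processes with continuous paths which agree almost surely at every time are
indistinguishable. -/
lemma indistinguishable_of_forall_ae_eq {M N : Time T → Ω → H}
    (hM : ∀ᵐ ω ∂P, Continuous (M · ω)) (hN : ∀ᵐ ω ∂P, Continuous (N · ω))
    (h : ∀ t, M t =ᵐ[P] N t) : ∀ᵐ ω ∂P, ∀ t, M t ω = N t ω := by
  have h2 : ∀ᵐ ω ∂P, ∀ n, M (TopologicalSpace.denseSeq (Time T) n) ω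
      = N (TopologicalSpace.denseSeq (Time T) n) ω := ae_all_iff.2 fun n => h _
  filter_upwards [hM, hN, h2] with ω h3 h4 h5
  have := DenseRange.equalizer (TopologicalSpace.denseRange_denseSeq (Time T)) h3 h4 (funext h5)
  exact fun t => congrFun this t

end Martingales

/-! ### Simple processes -/

section FinLemmas

lemma Fin.sum_succ_sub_castSucc {V : Type*} [AddCommGroup V] {n : ℕ} (g : Fin (n + 1) → V) :
    ∑ m : Fin n, (g m.succ - g m.castSucc) = g (Fin.last n) - g 0 := by
  induction n with
  | zero => simp
  | succ n ih =>
    rw [Fin.sum_univ_castSucc]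
    have := ih (fun i => g i.castSucc)
    simp only [Fin.succ_castSucc] at this ⊢
    rw [this, Fin.succ_last, Fin.castSucc_zero]
    abel

/-- Clamping the index to [j, k] turns the restricted sum into a full telescoping sum, the clamped
terms outside being constant. -/
lemma Fin.sum_ite_succ_sub_castSucc {V : Type*} [AddCommGroup V] {n : ℕ} (f : Fin (n + 1) → V)
    {j k : Fin (n + 1)} (hjk : j ≤ k) :
    ∑ m : Fin n, (if j ≤ m.castSucc ∧ m.castSucc < k then f m.succ - f m.castSucc else 0)
      = f k - f j := by
  have h := Fin.sum_succ_sub_castSucc fun m => f (max j (min m k))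
  have h1 : max j (min (Fin.last n) k) = k := by
    rw [min_eq_right (Fin.le_last k), max_eq_right hjk]
  have h2 : max j (min 0 k) = j := by
    rw [min_eq_left (Fin.zero_le k), max_eq_left (Fin.zero_le j)]
  rw [h1, h2] at h
  rw [← h]
  refine Finset.sum_congr rfl fun m _ => ?_
  split_ifs with hm
  · have h3 : m.succ ≤ k := Fin.castSucc_lt_iff_succ_le.1 hm.2
    rw [min_eq_left h3, min_eq_left hm.2.le, max_eq_right hm.1,
      max_eq_right (hm.1.trans (Fin.castSucc_lt_succ).le)]
  · rw [not_and_or, not_le, not_lt] at hm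
    rcases hm with hm | hm
    · have h3 : m.succ ≤ j := Fin.castSucc_lt_iff_succ_le.1 hm
      rw [max_eq_left ((min_le_left _ _).trans h3), max_eq_left ((min_le_left _ _).trans hm.le),
        sub_self]
    · rw [min_eq_right hm, min_eq_right (hm.trans (Fin.castSucc_lt_succ).le), sub_self]

lemma Fin.exists_castSucc_lt_le_succ {α : Type*} [LinearOrder α] {n : ℕ} (f : Fin (n + 1) → α)
    {t : α} (h0 : f 0 < t) (h1 : t ≤ f (Fin.last n)) :
    ∃ m : Fin n, f m.castSucc < t ∧ t ≤ f m.succ := by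
  by_contra h
  push Not at h
  have key : ∀ m : Fin (n + 1), f m < t := by
    intro m
    induction m using Fin.induction with
    | zero => exact h0
    | succ i ih => exact h i ih
  exact absurd h1 (not_le.2 (key _))

lemma Fin.unique_castSucc_lt_le_succ {α : Type*} [LinearOrder α] {n : ℕ} {f : Fin (n + 1) → α}
    (hf : StrictMono f) {t : α} {m m' : Fin n} (hm : f m.castSucc < t ∧ t ≤ f m.succ)
    (hm' : f m'.castSucc < t ∧ t ≤ f m'.succ) : m = m' := by
  refine le_antisymm ?_ ?_
  · have := hf.lt_iff_lt.1 (hm.1.trans_le hm'.2)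
    exact Fin.castSucc_lt_succ_iff.1 this
  · have := hf.lt_iff_lt.1 (hm'.1.trans_le hm.2)
    exact Fin.castSucc_lt_succ_iff.1 this

lemma Set.Finite.range_sum {Ω V I : Type*} [AddCommMonoid V] {f : I → Ω → V} (s : Finset I)
    (hf : ∀ i ∈ s, (Set.range (f i)).Finite) : (Set.range fun ω => ∑ i ∈ s, f i ω).Finite := by
  classical
  induction s using Finset.induction_on with
  | empty => simpa using Set.finite_range_const
  | insert a s ha ih =>
    have h1 := hf a (Finset.mem_insert_self _ _)
    have h2 := ih fun i hi => hf i (Finset.mem_insert_of_mem hi)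
    refine (h1.add h2).subset ?_
    rintro _ ⟨ω, rfl⟩
    simp only [Finset.sum_insert ha]
    exact Set.add_mem_add ⟨ω, rfl⟩ ⟨ω, rfl⟩

end FinLemmas

/-! ### Refinement, differences and stopping of simple processes -/

section SimpleProcesses

variable {Ω : Type u} {mΩ : MeasurableSpace Ω} {T : ℝ} [Fact (0 < T)] {𝓕 : Filtration (Time T) mΩ}
variable {E : Type*} [NormedAddCommGroup E] [InnerProductSpace ℝ E] [CompleteSpace E]
variable {E₁ : Type*} [NormedAddCommGroup E₁] [InnerProductSpace ℝ E₁] [CompleteSpace E₁]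
variable {E₂ : Type*} [NormedAddCommGroup E₂] [InnerProductSpace ℝ E₂] [CompleteSpace E₂]
variable {H : Type*} [NormedAddCommGroup H] [InnerProductSpace ℝ H] [CompleteSpace H]

lemma bot_lt_top_time : (⊥ : Time T) < ⊤ :=
  Subtype.mk_lt_mk.2 (Fact.out : 0 < T)

namespace SimpleProc

open Classical in
lemma eval_of_ne_bot (Φ : SimpleProc E H 𝓕) {t : Time T} (ht : t ≠ ⊥) (ω : Ω) :
    Φ.eval t ω = ∑ m : Fin (Φ.n + 1), if Φ.time m.castSucc < t ∧ t ≤ Φ.time m.succ then Φ.val m ω else 0 := by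
  rw [eval, if_neg ht, zero_add]

lemma exists_mem_Ioc (Φ : SimpleProc E H 𝓕) {t : Time T} (ht : t ≠ ⊥) :
    ∃ m : Fin (Φ.n + 1), Φ.time m.castSucc < t ∧ t ≤ Φ.time m.succ :=
  Fin.exists_castSucc_lt_le_succ Φ.time (by rw [Φ.time_first]; exact bot_lt_iff_ne_bot.2 ht)
    (by rw [Φ.time_last]; exact le_top)

lemma eval_eq_val (Φ : SimpleProc E H 𝓕) {t : Time T} {m : Fin (Φ.n + 1)}
    (hm : Φ.time m.castSucc < t ∧ t ≤ Φ.time m.succ) (ω : Ω) : Φ.eval t ω = Φ.val m ω := by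
  classical
  rw [Φ.eval_of_ne_bot (bot_le.trans_lt hm.1).ne', Finset.sum_eq_single m, if_pos hm]
  · intro m' _ hm'
    rw [if_neg fun h => hm' (Fin.unique_castSucc_lt_le_succ Φ.strictMono h hm)]
  · simp

open Classical in
/-- A finite sum of processes `1_{(a, b]} v` with `v` measurable with respect to `𝓕 a` is simple. -/
theorem exists_of_family {I : Type*} [Fintype I] (a b : I → Time T) (hab : ∀ i, a i ≤ b i)
    (v : I → Ω → (E →L[ℝ] H)) (hfin : ∀ i, (Set.range (v i)).Finite)
    (hmeas : ∀ i, StronglyMeasurable[𝓕 (a i)] (v i)) :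
    ∃ Φ : SimpleProc E H 𝓕,
      (∀ t, t ≠ ⊥ → ∀ ω, Φ.eval t ω = ∑ i, if a i < t ∧ t ≤ b i then v i ω else 0) ∧
      ∀ X t ω, Φ.integral X t ω = ∑ i, v i ω (X (min (b i) t) ω - X (min (a i) t) ω) := by
  -- The common refinement of all intervals, with both ends of [0, T] added; each indicator of (a i,
  -- b i] is constant on its cells.
  let S : Finset (Time T) := {⊥, ⊤} ∪ (Finset.univ.image a ∪ Finset.univ.image b)
  have hbotS : ⊥ ∈ S := by simp [S]
  have htopS : ⊤ ∈ S := by simp [S]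
  have haS : ∀ i, a i ∈ S := fun i => by simp [S]
  have hbS : ∀ i, b i ∈ S := fun i => by simp [S]
  obtain ⟨n, hn⟩ : ∃ n, S.card = n + 2 := by
    have h1 : ({⊥, ⊤} : Finset (Time T)).card ≤ S.card :=
      Finset.card_le_card Finset.subset_union_left
    rw [Finset.card_pair bot_lt_top_time.ne] at h1
    exact ⟨S.card - 2, by omega⟩
  let τ : Fin (n + 2) ↪o Time T := S.orderEmbOfFin hn
  have hτ : ∀ s ∈ S, ∃ j, τ j = s := fun s hs => by
    have : s ∈ Set.range τ := by rw [Finset.range_orderEmbOfFin]; exact hs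
    exact this
  have h0 : τ 0 = ⊥ := by
    obtain ⟨j, hj⟩ := hτ ⊥ hbotS
    refine le_bot_iff.1 ?_
    rw [← hj]; exact τ.monotone (Fin.zero_le _)
  have hl : τ (Fin.last (n + 1)) = ⊤ := by
    obtain ⟨j, hj⟩ := hτ ⊤ htopS
    refine top_le_iff.1 ?_
    rw [← hj]; exact τ.monotone (Fin.le_last _)
  let Φ : SimpleProc E H 𝓕 :=
    { n := n
      time := τ
      strictMono := τ.strictMono
      time_first := h0
      time_last := hl
      -- Whether the cell (τ m, τ (m + 1)] lies in (a i, b i] is decided at its left endpoint; `a i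
      -- ≤ τ m` makes `v i` measurable there.
      val := fun m ω => ∑ i, if a i ≤ τ m.castSucc ∧ τ m.castSucc < b i then v i ω else 0
      finite_range := fun m => by
        refine Set.Finite.range_sum _ fun i _ => ?_
        split_ifs with h
        · exact hfin i
        · exact Set.finite_range_const
      measurable := fun m => by
        refine Finset.stronglyMeasurable_fun_sum _ fun i _ => ?_
        split_ifs with h
        · exact (hmeas i).mono (𝓕.mono h.1)
        · exact stronglyMeasurable_const }
  -- At time `⊥` the two sides may differ, since `eval` takes the first value there; this time is a
  -- Lebesgue null set.
  refine ⟨Φ, fun t ht ω => ?_, fun X t ω => ?_⟩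
  · obtain ⟨m, hm⟩ := Φ.exists_mem_Ioc ht
    rw [Φ.eval_eq_val hm]
    refine Finset.sum_congr rfl fun i _ => ?_
    congr 1
    obtain ⟨j, hj⟩ := hτ _ (haS i)
    obtain ⟨k, hk⟩ := hτ _ (hbS i)
    have hm1 : τ m.castSucc < t := hm.1
    have hm2 : t ≤ τ m.succ := hm.2
    rw [← hj, ← hk]
    refine propext (and_congr ?_ ?_)
    · refine ⟨fun h => h.trans_lt hm1, fun h => τ.monotone ?_⟩
      exact Fin.le_castSucc_iff.2 (τ.lt_iff_lt.1 (h.trans_le hm2))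
    · refine ⟨fun h => hm2.trans (τ.monotone ?_), fun h => hm1.trans_le h⟩
      exact Fin.castSucc_lt_iff_succ_le.1 (τ.lt_iff_lt.1 h)
  · simp only [integral, Φ, _root_.sum_apply]
    rw [Finset.sum_comm]
    refine Finset.sum_congr rfl fun i _ => ?_
    obtain ⟨j, hj⟩ := hτ _ (haS i)
    obtain ⟨k, hk⟩ := hτ _ (hbS i)
    have hjk : j ≤ k := τ.le_iff_le.1 (by rw [hj, hk]; exact hab i)
    have h := Fin.sum_ite_succ_sub_castSucc (fun m => X (min (τ m) t) ω) hjk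
    simp only [hj, hk] at h
    rw [← h, map_sum]
    refine Finset.sum_congr rfl fun m _ => ?_
    rw [← hj, ← hk]
    simp only [τ.le_iff_le, τ.lt_iff_lt]
    split_ifs <;> simp

lemma ite_comp_apply {p : Prop} [Decidable p] (L : E₁ →L[ℝ] H) (A : E →L[ℝ] E₁) (x : E) :
    (if p then L ∘L A else 0) x = (if p then L else 0) (A x) := by
  split_ifs <;> rfl

lemma ite_neg_comp_apply {p : Prop} [Decidable p] (L : E₁ →L[ℝ] H) (A : E →L[ℝ] E₁)
    (x : E) : (if p then -(L ∘L A) else 0) x = -((if p then L else 0) (A x)) := by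
  split_ifs <;> simp

/-- The difference of two simple processes, composed with bounded operators, is simple. -/
theorem exists_comp_sub_comp (Φ₁ : SimpleProc E₁ H 𝓕) (Φ₂ : SimpleProc E₂ H 𝓕) (A₁ : E →L[ℝ] E₁)
    (A₂ : E →L[ℝ] E₂) : ∃ Φ : SimpleProc E H 𝓕,
      (∀ t, t ≠ ⊥ → ∀ ω, Φ.eval t ω = Φ₁.eval t ω ∘L A₁ - Φ₂.eval t ω ∘L A₂) ∧
      ∀ X t ω, Φ.integral X t ω = Φ₁.integral (fun s ω => A₁ (X s ω)) t ω
        - Φ₂.integral (fun s ω => A₂ (X s ω)) t ω := by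
  classical
  have hc₁ : Continuous fun L : E₁ →L[ℝ] H => L ∘L A₁ := (ContinuousLinearMap.precomp H A₁).continuous
  have hc₂ : Continuous fun L : E₂ →L[ℝ] H => -(L ∘L A₂) :=
    (ContinuousLinearMap.precomp H A₂).continuous.neg
  -- The two families of intervals are put side by side, the second one with a minus sign.
  obtain ⟨Φ, h1, h2⟩ := exists_of_family (𝓕 := 𝓕) (E := E) (H := H)
    (I := Fin (Φ₁.n + 1) ⊕ Fin (Φ₂.n + 1))
    (Sum.elim (fun m => Φ₁.time m.castSucc) fun m => Φ₂.time m.castSucc)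
    (Sum.elim (fun m => Φ₁.time m.succ) fun m => Φ₂.time m.succ)
    (by
      rintro (m | m)
      · exact Φ₁.strictMono.monotone Fin.castSucc_lt_succ.le
      · exact Φ₂.strictMono.monotone Fin.castSucc_lt_succ.le)
    (Sum.elim (fun m ω => Φ₁.val m ω ∘L A₁) fun m ω => -(Φ₂.val m ω ∘L A₂))
    (by
      rintro (m | m)
      · exact ((Φ₁.finite_range m).image fun L => L ∘L A₁).subset
          (by rintro _ ⟨ω, rfl⟩; exact ⟨_, ⟨ω, rfl⟩, rfl⟩)
      · exact ((Φ₂.finite_range m).image fun L => -(L ∘L A₂)).subset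
          (by rintro _ ⟨ω, rfl⟩; exact ⟨_, ⟨ω, rfl⟩, rfl⟩))
    (by
      rintro (m | m)
      · exact hc₁.comp_stronglyMeasurable (Φ₁.measurable m)
      · exact hc₂.comp_stronglyMeasurable (Φ₂.measurable m))
  refine ⟨Φ, fun t ht ω => ?_, fun X t ω => ?_⟩
  · rw [h1 t ht ω, Φ₁.eval_of_ne_bot ht, Φ₂.eval_of_ne_bot ht, Fintype.sum_sum_type]
    ext x
    simp only [Sum.elim_inl, Sum.elim_inr, add_apply, _root_.sum_apply, sub_apply,
      ContinuousLinearMap.comp_apply]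
    rw [sub_eq_add_neg, ← Finset.sum_neg_distrib]
    refine congrArg₂ (· + ·) (Finset.sum_congr rfl fun m _ => ?_)
      (Finset.sum_congr rfl fun m _ => ?_)
    · exact ite_comp_apply _ _ _
    · exact ite_neg_comp_apply _ _ _
  · rw [h2, Fintype.sum_sum_type]
    simp only [Sum.elim_inl, Sum.elim_inr, integral, sub_eq_add_neg, ← Finset.sum_neg_distrib]
    congr 1
    · simp
    · refine Finset.sum_congr rfl fun m _ => ?_
      simp

/-- The map `max a (min b ·)` clamps to [a, b]; the lemma serves to intersect the cells of a simple
process with those of a grid. -/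
lemma clamp_lt_and_le_iff {α : Type*} [LinearOrder α] {a b c d t : α} :
    (max a (min b c) < t ∧ t ≤ max a (min b d)) ↔ (a < t ∧ t ≤ b) ∧ c < t ∧ t ≤ d := by
  constructor
  · rintro ⟨h1, h2⟩
    have ha := (max_lt_iff.1 h1).1
    have h3 : t ≤ min b d := (le_max_iff.1 h2).resolve_left (not_le.2 ha)
    have hb := (le_min_iff.1 h3).1
    exact ⟨⟨ha, hb⟩, (min_lt_iff.1 (max_lt_iff.1 h1).2).resolve_left (not_lt.2 hb),
      (le_min_iff.1 h3).2⟩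
  · rintro ⟨⟨ha, hb⟩, hc, hd⟩
    exact ⟨max_lt ha (min_lt_of_right_lt hc), le_max_of_le_right (le_min hb hd)⟩

open Classical in
/-- Stopping a simple process at a stopping time with values in a finite grid. -/
theorem exists_stopped (Φ : SimpleProc E H 𝓕) {N : ℕ} {d : Fin (N + 1) → Time T}
    (hd : StrictMono d) (hd0 : d 0 = ⊥) (hdl : d (Fin.last N) = ⊤) {ρ : Ω → Time T}
    (hρ : ∀ ω, ∃ J, ρ ω = d J) (hρm : ∀ s, MeasurableSet[𝓕 s] {ω | s < ρ ω}) :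
    ∃ Ψ : SimpleProc E H 𝓕,
      (∀ t, t ≠ ⊥ → ∀ ω, Ψ.eval t ω = if t ≤ ρ ω then Φ.eval t ω else 0) ∧
      ∀ X t ω, Ψ.integral X t ω = Φ.integral X (min t (ρ ω)) ω := by
  let c : Fin (Φ.n + 1) → Time T → Time T := fun m x =>
    max (Φ.time m.castSucc) (min (Φ.time m.succ) x)
  have htm : ∀ m : Fin (Φ.n + 1), Φ.time m.castSucc ≤ Φ.time m.succ := fun m =>
    Φ.strictMono.monotone Fin.castSucc_lt_succ.le
  have hc : ∀ m, Monotone (c m) := fun m x y hxy => max_le_max le_rfl (min_le_min le_rfl hxy)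
  obtain ⟨Ψ, h1, h2⟩ := exists_of_family (𝓕 := 𝓕) (E := E) (H := H) (I := Fin (Φ.n + 1) × Fin N)
    (fun p => c p.1 (d p.2.castSucc)) (fun p => c p.1 (d p.2.succ))
    (fun p => hc _ (hd.monotone Fin.castSucc_lt_succ.le))
    -- The condition `d j < ρ` is known at time `d j`. When `d j` lies beyond the cell of Φ, the
    -- clamped left endpoint precedes `d j` and measurability could fail; the first, deterministic
    -- condition removes these terms, whose intervals are empty.
    (fun p ω => if d p.2.castSucc ≤ Φ.time p.1.succ ∧ d p.2.castSucc < ρ ω then Φ.val p.1 ω else 0)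
    (fun p => ((Φ.finite_range p.1).union (Set.finite_singleton 0)).subset (by
      rintro _ ⟨ω, rfl⟩
      simp only
      split_ifs
      · exact Or.inl ⟨ω, rfl⟩
      · exact Or.inr rfl))
    (fun p => by
      by_cases hp : d p.2.castSucc ≤ Φ.time p.1.succ
      · simp only [hp, true_and]
        have hle : d p.2.castSucc ≤ c p.1 (d p.2.castSucc) :=
          le_max_of_le_right (le_min hp le_rfl)
        exact StronglyMeasurable.ite (𝓕.mono hle _ (hρm _))
          ((Φ.measurable p.1).mono (𝓕.mono (le_max_left _ _))) stronglyMeasurable_const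
      · simp only [hp, false_and, if_false]
        exact stronglyMeasurable_const)
  refine ⟨Ψ, fun t ht ω => ?_, fun X t ω => ?_⟩
  · obtain ⟨m, hm⟩ := Φ.exists_mem_Ioc ht
    obtain ⟨j, hj⟩ := Fin.exists_castSucc_lt_le_succ d
      (by rw [hd0]; exact bot_lt_iff_ne_bot.2 ht) (by rw [hdl]; exact le_top)
    rw [h1 t ht, Finset.sum_eq_single (m, j), if_pos (clamp_lt_and_le_iff.2 ⟨hm, hj⟩),
      Φ.eval_eq_val hm]
    · congr 1
      -- As ρ takes values in the grid, `d j < ρ` forces `d (j + 1) ≤ ρ`, so the whole grid cell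
      -- lies before ρ.
      refine propext ⟨fun h => ?_, fun h => ⟨hj.1.le.trans hm.2, hj.1.trans_le h⟩⟩
      obtain ⟨J, hJ⟩ := hρ ω
      rw [hJ] at h ⊢
      exact hj.2.trans (hd.monotone (Fin.castSucc_lt_iff_succ_le.1 (hd.lt_iff_lt.1 h.2)))
    · rintro ⟨m', j'⟩ - hne
      rw [if_neg]
      intro h
      obtain ⟨hm', hj'⟩ := clamp_lt_and_le_iff.1 h
      exact hne (Prod.ext (Fin.unique_castSucc_lt_le_succ Φ.strictMono hm' hm)
        (Fin.unique_castSucc_lt_le_succ hd hj' hj))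
    · simp
  · rw [h2, Fintype.sum_prod_type, integral]
    refine Finset.sum_congr rfl fun m _ => ?_
    obtain ⟨J, hJ⟩ := hρ ω
    have h := Fin.sum_ite_succ_sub_castSucc (fun j => X (min (c m (d j)) t) ω) (Fin.zero_le J)
    have h3 : ∀ j : Fin N,
        (if d j.castSucc ≤ Φ.time m.succ ∧ d j.castSucc < ρ ω then Φ.val m ω else 0)
          (X (min (c m (d j.succ)) t) ω - X (min (c m (d j.castSucc)) t) ω)
        = Φ.val m ω (if 0 ≤ j.castSucc ∧ j.castSucc < J then
          X (min (c m (d j.succ)) t) ω - X (min (c m (d j.castSucc)) t) ω else 0) := by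
      intro j
      rw [hJ]
      simp only [hd.lt_iff_lt, Fin.zero_le, true_and]
      by_cases hjJ : j.castSucc < J
      · by_cases hjt : d j.castSucc ≤ Φ.time m.succ
        · simp [hjJ, hjt]
        · have h4 : c m (d j.succ) = c m (d j.castSucc) := by
            have h5 : Φ.time m.succ ≤ d j.castSucc := (not_le.1 hjt).le
            simp only [c]
            rw [min_eq_left h5, min_eq_left (h5.trans (hd.monotone Fin.castSucc_lt_succ.le))]
          simp [h4]
      · simp [hjJ]
    simp only [h3]
    rw [← map_sum, h, ← hJ, hd0]
    congr 1
    have hb : c m ⊥ = Φ.time m.castSucc := by simp [c]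
    rw [hb]
    rcases le_total (Φ.time m.castSucc) (ρ ω) with hle | hle
    · have h6 : c m (ρ ω) = min (Φ.time m.succ) (ρ ω) :=
        max_eq_right (le_min (htm m) hle)
      rw [h6]
      have e1 : min (min (Φ.time m.succ) (ρ ω)) t = min (Φ.time m.succ) (min t (ρ ω)) := by
        rw [min_assoc, min_comm t]
      have e2 : min (Φ.time m.castSucc) t = min (Φ.time m.castSucc) (min t (ρ ω)) := by
        rw [min_comm t, ← min_assoc, min_eq_left hle]
      rw [e1, ← e2]
    · have h6 : c m (ρ ω) = Φ.time m.castSucc :=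
        max_eq_left ((min_le_right _ _).trans hle)
      rw [h6, sub_self, min_comm t, ← min_assoc, ← min_assoc, min_eq_right (hle.trans (htm m)),
        min_eq_right hle, sub_self]

end SimpleProc

end SimpleProcesses

/-! ### Elementary integrals are martingales -/

section ElementaryIntegral

variable {Ω : Type*} {mΩ : MeasurableSpace Ω} {P : Measure Ω} [IsProbabilityMeasure P]
variable {T : ℝ} [Fact (0 < T)] {𝓕 : Filtration (Time T) mΩ}
variable {E : Type*} [NormedAddCommGroup E] [InnerProductSpace ℝ E] [CompleteSpace E]
variable {H : Type*} [NormedAddCommGroup H] [InnerProductSpace ℝ H] [CompleteSpace H]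

lemma _root_.MeasureTheory.MemLp.integrable_inner_real {f g : Ω → H} (hf : MemLp f 2 P)
    (hg : MemLp g 2 P) : Integrable (fun ω => ⟪f ω, g ω⟫_ℝ) P :=
  memLp_one_iff_integrable.1 ((innerSL ℝ).memLp_of_bilin 1 hf hg)

/-- The increment has conditional mean zero given 𝓕 s, and the 𝓕 s-measurable factor `M s` can be
pulled out. -/
lemma integral_inner_increment_eq_zero {M : Time T → Ω → H} (hM : IsContL2Martingale 𝓕 P M)
    {s t : Time T} (hst : s ≤ t) : ∫ ω, ⟪M s ω, M t ω - M s ω⟫_ℝ ∂P = 0 := by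
  have hi : Integrable (fun ω => M t ω - M s ω) P :=
    (hM.martingale.integrable t).sub (hM.martingale.integrable s)
  have hii : Integrable (fun ω => innerSL ℝ (M s ω) (M t ω - M s ω)) P :=
    (hM.memLp s).integrable_inner_real ((hM.memLp t).sub (hM.memLp s))
  have h1 := condExp_bilin_of_stronglyMeasurable_left (m := 𝓕 s) (innerSL ℝ)
    (hM.martingale.stronglyAdapted s) hii hi
  have h2 : P[fun ω => M t ω - M s ω | 𝓕 s] =ᵐ[P] 0 := by
    have h3 := condExp_sub (m := 𝓕 s) (hM.martingale.integrable t) (hM.martingale.integrable s)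
    have h4 := hM.martingale.condExp_ae_eq hst
    have h5 := hM.martingale.condExp_ae_eq (le_refl s)
    filter_upwards [h3, h4, h5] with ω h3 h4 h5
    have : (fun ω => M t ω - M s ω) = M t - M s := rfl
    rw [this, h3]
    simp [h4, h5]
  rw [← integral_condExp (𝓕.le s)]
  refine (integral_congr_ae (h1.trans ?_)).trans (integral_zero _ _)
  filter_upwards [h2] with ω hω
  rw [hω]
  simp

lemma lintegral_enorm_sq_add_of_orthogonal {f g : Ω → H} (hf : MemLp f 2 P) (hg : MemLp g 2 P)
    (h : ∫ ω, ⟪f ω, g ω⟫_ℝ ∂P = 0) :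
    ∫⁻ ω, ‖f ω + g ω‖ₑ ^ 2 ∂P = ∫⁻ ω, ‖f ω‖ₑ ^ 2 ∂P + ∫⁻ ω, ‖g ω‖ₑ ^ 2 ∂P := by
  have key : ∀ {f : Ω → H}, MemLp f 2 P →
      ∫⁻ ω, ‖f ω‖ₑ ^ 2 ∂P = ENNReal.ofReal (∫ ω, ‖f ω‖ ^ 2 ∂P) := by
    intro f hf
    rw [ofReal_integral_eq_lintegral_ofReal (hf.integrable_norm_pow two_ne_zero)
      (Eventually.of_forall fun _ => by positivity)]
    simp_rw [enorm_sq_eq_ofReal]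
  have e := key (hf.add hg)
  simp only [Pi.add_apply] at e
  rw [e, key hf, key hg, ← ENNReal.ofReal_add (integral_nonneg fun _ => by positivity)
    (integral_nonneg fun _ => by positivity)]
  congr 1
  have h2 : ∀ ω, ‖f ω + g ω‖ ^ 2 = ‖f ω‖ ^ 2 + ‖g ω‖ ^ 2 + 2 * ⟪f ω, g ω⟫_ℝ := by
    intro ω
    rw [norm_add_sq_real]; ring
  simp_rw [h2]
  have i1 := hf.integrable_norm_pow two_ne_zero
  have i2 := hg.integrable_norm_pow two_ne_zero
  have i4 : Integrable (fun ω => ‖f ω‖ ^ 2 + ‖g ω‖ ^ 2) P := i1.add i2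
  rw [integral_add i4 ((hf.integrable_inner_real hg).const_mul 2), integral_const_mul, h, mul_zero,
    add_zero, integral_add i1 i2]

lemma lintegral_enorm_sq_eq_add {M : Time T → Ω → H} (hM : IsContL2Martingale 𝓕 P M)
    {s t : Time T} (hst : s ≤ t) :
    ∫⁻ ω, ‖M t ω‖ₑ ^ 2 ∂P = ∫⁻ ω, ‖M s ω‖ₑ ^ 2 ∂P + ∫⁻ ω, ‖M t ω - M s ω‖ₑ ^ 2 ∂P := by
  have h := lintegral_enorm_sq_add_of_orthogonal (hM.memLp s) ((hM.memLp t).sub (hM.memLp s))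
    (integral_inner_increment_eq_zero hM hst)
  simpa using h

/-- The elementary integral `v (X_{b ∧ t} - X_{a ∧ t})`. -/
lemma isContL2Martingale_elementary {X : Time T → Ω → E} (hX : IsContL2Martingale 𝓕 P X)
    {a b : Time T} (hab : a ≤ b) {v : Ω → (E →L[ℝ] H)} (hv : StronglyMeasurable[𝓕 a] v)
    (hfin : (Set.range v).Finite) :
    IsContL2Martingale 𝓕 P (fun t ω => v ω (X (min b t) ω - X (min a t) ω)) := by
  obtain ⟨C, hC⟩ : ∃ C : ℝ, ∀ ω, ‖v ω‖ ≤ C := by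
    obtain ⟨C, hC⟩ := (hfin.image norm).bddAbove
    exact ⟨C, fun ω => hC ⟨_, ⟨ω, rfl⟩, rfl⟩⟩
  -- With `c` the clamp to [a, b], the elementary integral is `v` applied to an increment from `a`
  -- to `c t`, so X is evaluated only at times where `v` is already measurable.
  let c : Time T → Time T := fun t => max a (min b t)
  have hca : ∀ t, a ≤ c t := fun t => le_max_left _ _
  have hcm : Monotone c := fun s t hst => max_le_max le_rfl (min_le_min le_rfl hst)
  have heq : ∀ t ω, v ω (X (min b t) ω - X (min a t) ω) = v ω (X (c t) ω - X a ω) := by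
    intro t ω
    rcases le_total a t with h | h
    · rw [min_eq_left h, show c t = min b t from max_eq_right (le_min hab h)]
    · rw [min_eq_right h, min_eq_right (h.trans hab),
        show c t = a from max_eq_left ((min_le_right _ _).trans h), sub_self, sub_self]
  have hvm : StronglyMeasurable v := hv.mono (𝓕.le a)
  have hmem : ∀ s t, MemLp (fun ω => v ω (X t ω - X s ω)) 2 P := by
    intro s t
    refine MemLp.of_le_mul (c := C) ((hX.memLp t).sub (hX.memLp s)) ?_ ?_
    · exact ((continuous_fst.clm_apply continuous_snd).comp_aestronglyMeasurable
        (hvm.aestronglyMeasurable.prodMk ((hX.memLp t).sub (hX.memLp s)).1) :)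
    · refine Eventually.of_forall fun ω => ?_
      exact ((v ω).le_opNorm _).trans (mul_le_mul_of_nonneg_right (hC ω) (norm_nonneg _))
  have hzero : ∀ s t, a ≤ s → s ≤ t → P[fun ω => v ω (X t ω - X s ω) | 𝓕 s] =ᵐ[P] 0 := by
    intro s t has hst
    have hi : Integrable (fun ω => X t ω - X s ω) P :=
      (hX.martingale.integrable t).sub (hX.martingale.integrable s)
    have h1 := condExp_bilin_of_stronglyMeasurable_left (m := 𝓕 s)
      (ContinuousLinearMap.id ℝ (E →L[ℝ] H)) (hv.mono (𝓕.mono has))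
      (((hmem s t).integrable one_le_two :)) hi
    have h3 := condExp_sub (m := 𝓕 s) (hX.martingale.integrable t) (hX.martingale.integrable s)
    have h4 := hX.martingale.condExp_ae_eq hst
    have h5 := hX.martingale.condExp_ae_eq (le_refl s)
    filter_upwards [h1, h3, h4, h5] with ω h1 h3 h4 h5
    have e : (fun ω => X t ω - X s ω) = X t - X s := rfl
    refine h1.trans ?_
    rw [e, h3]
    simp [h4, h5]
  have hadapt : StronglyAdapted 𝓕 (fun t ω => v ω (X (min b t) ω - X (min a t) ω)) := by
    intro t
    rcases le_total a t with h | h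
    · have h1 := hv.mono (𝓕.mono h)
      have h2 : ∀ r, r ≤ t → StronglyMeasurable[𝓕 t] (X r) := fun r hr =>
        (hX.martingale.stronglyAdapted r).mono (𝓕.mono hr)
      exact (continuous_fst.clm_apply continuous_snd).comp_stronglyMeasurable
        (h1.prodMk ((h2 _ (min_le_right b t)).sub (h2 _ (min_le_right a t))))
    · have : (fun ω => v ω (X (min b t) ω - X (min a t) ω)) = fun _ => 0 := by
        ext ω
        rw [min_eq_right h, min_eq_right (h.trans hab), sub_self, map_zero]
      simp only [this]
      exact stronglyMeasurable_const
  refine ⟨⟨hadapt, fun s t hst => ?_⟩, ?_, (hmem _ _).lintegral_sq_lt_top⟩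
  · have hsplit : (fun ω => v ω (X (min b t) ω - X (min a t) ω))
        = (fun ω => v ω (X (min b s) ω - X (min a s) ω)) + fun ω => v ω (X (c t) ω - X (c s) ω) := by
      ext ω
      rw [Pi.add_apply, heq t, heq s, ← map_add]
      congr 1; abel
    -- If `s ≤ c s`, one conditions first on 𝓕 (c s), where `v` is measurable. Otherwise `b ≤ s` and
    -- the increment is zero.
    have h0 : P[fun ω => v ω (X (c t) ω - X (c s) ω) | 𝓕 s] =ᵐ[P] 0 := by
      rcases le_or_gt s (c s) with hs | hs
      · refine (condExp_condExp_of_le (𝓕.mono hs) (𝓕.le (c s))).symm.trans ?_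
        refine (condExp_congr_ae (hzero (c s) (c t) (hca s) (hcm hst))).trans ?_
        rw [condExp_zero]
      · have hbs : b ≤ s := by
          by_contra hbs
          exact absurd ((le_min (not_le.1 hbs).le le_rfl).trans (le_max_right a (min b s)))
            (not_le.2 hs)
        have hcc : c t = c s := by
          simp only [c]; rw [min_eq_left hbs, min_eq_left (hbs.trans hst)]
        simp only [hcc, sub_self, map_zero]
        change P[(0 : Ω → H) | 𝓕 s] =ᵐ[P] 0
        rw [condExp_zero]
    have hs : Integrable (fun ω => v ω (X (min b s) ω - X (min a s) ω)) P :=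
      (hmem _ _).integrable one_le_two
    refine (condExp_congr_ae (Eventually.of_forall (congrFun hsplit))).trans ?_
    refine (condExp_add hs ((hmem _ _).integrable one_le_two) _).trans ?_
    rw [condExp_of_stronglyMeasurable (𝓕.le s) (hadapt s) hs]
    filter_upwards [h0] with ω hω
    rw [Pi.add_apply, hω, Pi.zero_apply, add_zero]
  · filter_upwards [hX.continuous] with ω hω
    exact (v ω).continuous.comp ((hω.comp (continuous_const.min continuous_id)).sub
      (hω.comp (continuous_const.min continuous_id)))

lemma IsContL2Martingale.zero : IsContL2Martingale 𝓕 P (fun _ _ => (0 : H)) where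
  martingale := martingale_zero _ _ _
  continuous := Eventually.of_forall fun _ => continuous_const
  sq_lt_top := by simp

lemma IsContL2Martingale.add {M N : Time T → Ω → H} (hM : IsContL2Martingale 𝓕 P M)
    (hN : IsContL2Martingale 𝓕 P N) : IsContL2Martingale 𝓕 P (fun t ω => M t ω + N t ω) where
  martingale := hM.martingale.add hN.martingale
  continuous := by
    filter_upwards [hM.continuous, hN.continuous] with ω h1 h2 using h1.add h2
  sq_lt_top := ((hM.memLp ⊤).add (hN.memLp ⊤)).lintegral_sq_lt_top

lemma IsContL2Martingale.sum {I : Type*} (S : Finset I) {M : I → Time T → Ω → H}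
    (hM : ∀ i ∈ S, IsContL2Martingale 𝓕 P (M i)) :
    IsContL2Martingale 𝓕 P (fun t ω => ∑ i ∈ S, M i t ω) := by
  classical
  induction S using Finset.induction_on with
  | empty => simpa using IsContL2Martingale.zero
  | insert i S hi ih =>
    simp only [Finset.sum_insert hi]
    exact (hM i (Finset.mem_insert_self _ _)).add
      (ih fun j hj => hM j (Finset.mem_insert_of_mem hj))

lemma SimpleProc.isContL2Martingale_integral {X : Time T → Ω → E}
    (hX : IsContL2Martingale 𝓕 P X) (Φ : SimpleProc E H 𝓕) :
    IsContL2Martingale 𝓕 P (Φ.integral X) :=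
  IsContL2Martingale.sum _ fun m _ => isContL2Martingale_elementary hX
    (Φ.strictMono.monotone Fin.castSucc_lt_succ.le) (Φ.measurable m) (Φ.finite_range m)

lemma SimpleProc.integral_succ_sub_castSucc (X : Time T → Ω → E) (Φ : SimpleProc E H 𝓕)
    (m : Fin (Φ.n + 1)) (ω : Ω) :
    Φ.integral X (Φ.time m.succ) ω - Φ.integral X (Φ.time m.castSucc) ω
      = Φ.val m ω (X (Φ.time m.succ) ω - X (Φ.time m.castSucc) ω) := by
  have hmono := Φ.strictMono.monotone
  rw [SimpleProc.integral, SimpleProc.integral, ← Finset.sum_sub_distrib,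
    Finset.sum_eq_single m]
  · rw [min_self, min_eq_left (hmono Fin.castSucc_lt_succ.le), min_self,
      min_eq_right (hmono Fin.castSucc_lt_succ.le), sub_self, map_zero, sub_zero]
  · intro j _ hj
    rcases lt_or_gt_of_ne hj with h | h
    · have h1 : j.succ ≤ m.castSucc := by
        rw [Fin.le_iff_val_le_val]; simpa using h
      have h2 := h1.trans Fin.castSucc_lt_succ.le
      rw [min_eq_left (hmono h1), min_eq_left (hmono h2),
        min_eq_left (hmono (Fin.castSucc_lt_succ.le.trans h1)),
        min_eq_left (hmono (Fin.castSucc_lt_succ.le.trans h2)), sub_self]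
    · have h1 : m.succ ≤ j.castSucc := by
        rw [Fin.le_iff_val_le_val]; simpa using h
      have h2 := Fin.castSucc_lt_succ.le.trans h1
      rw [min_eq_right (hmono (h1.trans Fin.castSucc_lt_succ.le)), min_eq_right (hmono h1),
        min_eq_right (hmono (h2.trans Fin.castSucc_lt_succ.le)), min_eq_right (hmono h2)]
      simp
  · simp

/-- The integral is a martingale, so its increments over successive cells are orthogonal and the
mean squares add up, by induction over the partition points. -/
lemma SimpleProc.lintegral_integral_sq {X : Time T → Ω → E} (hX : IsContL2Martingale 𝓕 P X)
    (Φ : SimpleProc E H 𝓕) :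
    ∫⁻ ω, ‖Φ.integral X ⊤ ω‖ₑ ^ 2 ∂P = ∑ m : Fin (Φ.n + 1),
      ∫⁻ ω, ‖Φ.val m ω (X (Φ.time m.succ) ω - X (Φ.time m.castSucc) ω)‖ₑ ^ 2 ∂P := by
  have hI := Φ.isContL2Martingale_integral hX
  have key : ∀ j : ℕ, ∀ hj : j < Φ.n + 2,
      ∫⁻ ω, ‖Φ.integral X (Φ.time ⟨j, hj⟩) ω‖ₑ ^ 2 ∂P = ∑ m : Fin (Φ.n + 1), if m.1 < j then
        ∫⁻ ω, ‖Φ.val m ω (X (Φ.time m.succ) ω - X (Φ.time m.castSucc) ω)‖ₑ ^ 2 ∂P else 0 := by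
    intro j
    induction j with
    | zero =>
      intro hj
      have h0 : Φ.time ⟨0, hj⟩ = ⊥ := Φ.time_first
      have : ∀ ω, Φ.integral X ⊥ ω = 0 := fun ω => by simp [SimpleProc.integral]
      rw [h0]
      simp [this]
    | succ j ih =>
      intro hj
      have hj' : j < Φ.n + 1 := by omega
      let m : Fin (Φ.n + 1) := ⟨j, hj'⟩
      have h1 : (⟨j + 1, hj⟩ : Fin (Φ.n + 2)) = m.succ := rfl
      have h2 := ih (by omega)
      have h3 : (⟨j, by omega⟩ : Fin (Φ.n + 2)) = m.castSucc := rfl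
      rw [h3] at h2
      rw [h1, lintegral_enorm_sq_eq_add hI (Φ.strictMono.monotone Fin.castSucc_lt_succ.le), h2]
      simp only [Φ.integral_succ_sub_castSucc X m]
      have h4 : ∀ i : Fin (Φ.n + 1), (if i.1 < j + 1 then
          ∫⁻ ω, ‖Φ.val i ω (X (Φ.time i.succ) ω - X (Φ.time i.castSucc) ω)‖ₑ ^ 2 ∂P else 0)
          = (if i.1 < j then
          ∫⁻ ω, ‖Φ.val i ω (X (Φ.time i.succ) ω - X (Φ.time i.castSucc) ω)‖ₑ ^ 2 ∂P else 0)
          + if i = m then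
          ∫⁻ ω, ‖Φ.val i ω (X (Φ.time i.succ) ω - X (Φ.time i.castSucc) ω)‖ₑ ^ 2 ∂P else 0 := by
        intro i
        have hi : i = m ↔ i.1 = j := Fin.ext_iff
        simp only [hi]
        rcases lt_trichotomy i.1 j with h | h | h
        · simp [h, h.ne, h.trans (Nat.lt_succ_self j)]
        · simp [h]
        · have : ¬ i.1 < j + 1 := by omega
          simp [this, h.ne', h.not_gt]
      simp only [h4, Finset.sum_add_distrib, Finset.sum_ite_eq', Finset.mem_univ, if_true]
  have h := key (Φ.n + 1) (by omega)
  have hl : Φ.time ⟨Φ.n + 1, by omega⟩ = ⊤ := Φ.time_last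
  rw [hl] at h
  rw [h]
  exact Finset.sum_congr rfl fun m _ => if_pos m.2

end ElementaryIntegral

/-! ### Processes with the increments of a Wiener process -/

section TimeMeasure

variable {T : ℝ} [Fact (0 < T)]

lemma timeMeasure_apply (s : Set (Time T)) : timeMeasure T s = volume (Subtype.val '' s) :=
  (MeasurableEmbedding.subtype_coe measurableSet_Icc).comap_apply _ _

lemma timeMeasure_Ioc (a b : Time T) :
    timeMeasure T (Set.Ioc a b) = ENNReal.ofReal ((b : ℝ) - a) := by
  rw [timeMeasure_apply]
  have : (Subtype.val '' Set.Ioc a b : Set ℝ) = Set.Ioc (a : ℝ) b := by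
    ext x
    constructor
    · rintro ⟨y, hy, rfl⟩
      exact hy
    · intro hx
      exact ⟨⟨x, a.2.1.trans hx.1.le, hx.2.trans b.2.2⟩, hx, rfl⟩
  rw [this, Real.volume_Ioc]

lemma timeMeasure_singleton (a : Time T) : timeMeasure T {a} = 0 := by
  rw [timeMeasure_apply]
  simp

lemma timeMeasure_univ : timeMeasure T Set.univ = ENNReal.ofReal T := by
  rw [timeMeasure_apply, Set.image_univ, Subtype.range_coe_subtype, Set.ofPred_mem_eq,
    Real.volume_Icc, sub_zero]

instance : IsFiniteMeasure (timeMeasure T) := ⟨by rw [timeMeasure_univ]; exact ENNReal.ofReal_lt_top⟩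

lemma ae_ne_bot : ∀ᵐ t ∂(timeMeasure T), t ≠ ⊥ := by
  rw [ae_iff]
  simp only [not_not]
  exact timeMeasure_singleton ⊥

end TimeMeasure

/-! ### Second moments of increments and the Itô isometry -/

section WienerLike

variable {Ω : Type*} {mΩ : MeasurableSpace Ω} {P : Measure Ω} [IsProbabilityMeasure P]
variable {T : ℝ} [Fact (0 < T)] {𝓕 : Filtration (Time T) mΩ}
variable {E : Type*} [NormedAddCommGroup E] [InnerProductSpace ℝ E] [CompleteSpace E]
variable {G : Type*} [NormedAddCommGroup G] [InnerProductSpace ℝ G] [CompleteSpace G]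
variable {H : Type*} [NormedAddCommGroup H] [InnerProductSpace ℝ H] [CompleteSpace H]

/-- A continuous adapted process, started at `0`, with centred increments of covariance `R R^*`
times the length of the time interval, independent of the past. -/
structure IsWienerLike (𝓕 : Filtration (Time T) mΩ) (P : Measure Ω) (R : G →L[ℝ] E)
    (X : Time T → Ω → E) : Prop where
  hilbertSchmidt : IsHilbertSchmidt R
  adapted : StronglyAdapted 𝓕 X
  zero : ∀ᵐ ω ∂P, X ⊥ ω = 0
  continuous : ∀ᵐ ω ∂P, Continuous (X · ω)
  mean : ∀ s t : Time T, s ≤ t → ∀ g : E, ∫ ω, ⟪X t ω - X s ω, g⟫_ℝ ∂P = 0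
  variance : ∀ s t : Time T, s ≤ t → ∀ g : E, ∫⁻ ω, ‖⟪X t ω - X s ω, g⟫_ℝ‖ₑ ^ 2 ∂P
    = ENNReal.ofReal ((t : ℝ) - s) * ‖ContinuousLinearMap.adjoint R g‖ₑ ^ 2
  indep : ∀ s t : Time T, s ≤ t →
    Indep (MeasurableSpace.comap (fun ω => X t ω - X s ω) (borel E)) (𝓕 s) P

lemma stronglyMeasurable_of_adapted {X : Time T → Ω → E} (hX : StronglyAdapted 𝓕 X) (t : Time T) :
    StronglyMeasurable (X t) := (hX t).mono (𝓕.le t)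

lemma integral_of_map_eq_gaussianReal {Y : Ω → ℝ} (hY : AEMeasurable Y P) {v : NNReal}
    (h : P.map Y = gaussianReal 0 v) : ∫ ω, Y ω ∂P = 0 := by
  have h1 := integral_map hY (f := fun x : ℝ => x) aestronglyMeasurable_id
  rw [← h1, h, integral_id_gaussianReal]

lemma lintegral_sq_of_map_eq_gaussianReal {Y : Ω → ℝ} (hY : AEMeasurable Y P) {v : NNReal}
    (h : P.map Y = gaussianReal 0 v) : ∫⁻ ω, ‖Y ω‖ₑ ^ 2 ∂P = v := by
  have h1 : ∫⁻ ω, ‖Y ω‖ₑ ^ 2 ∂P = ∫⁻ x, ‖x‖ₑ ^ 2 ∂(gaussianReal 0 v) := by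
    rw [← h, lintegral_map' (by fun_prop) hY]
  have h2 : MemLp id 2 (gaussianReal 0 v) := memLp_id_gaussianReal 2
  have h3 := h2.ofReal_variance_eq
  rw [variance_id_gaussianReal, evariance_eq_lintegral_ofReal] at h3
  have h4 : ∫ x, id x ∂(gaussianReal 0 v) = 0 := integral_id_gaussianReal
  rw [h1, ← ENNReal.ofReal_coe_nnreal, h3, h4]
  refine lintegral_congr fun x => ?_
  rw [enorm_sq_eq_ofReal, sub_zero, id, Real.norm_eq_abs, sq_abs]

/-- The inclusion i of Q^{1/2}(E) satisfies i i^* = Q, so it is a factor of the covariance. Of the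
Gaussian law only mean and variance are retained. -/
lemma IsQWiener.isWienerLike {Q : E →L[ℝ] E} {X : Time T → Ω → E} (hX : IsQWiener 𝓕 P Q X) :
    IsWienerLike 𝓕 P (ImageSpace.incl (opSqrt Q)) X where
  hilbertSchmidt := by
    have h := posTrace_comp_adjoint (ImageSpace.incl (opSqrt Q))
    have h1 : ImageSpace.incl (opSqrt Q) ∘L
        ContinuousLinearMap.adjoint (ImageSpace.incl (opSqrt Q)) = Q := by
      ext x
      exact incl_covMap hX.isPositive x
    rw [IsHilbertSchmidt, ← h, h1]
    exact hX.traceClass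
  adapted := hX.adapted
  zero := hX.zero
  continuous := hX.continuous
  mean s t hst g := by
    have hm : AEMeasurable (fun ω => ⟪X t ω - X s ω, g⟫_ℝ) P :=
      (((stronglyMeasurable_of_adapted hX.adapted t).sub
        (stronglyMeasurable_of_adapted hX.adapted s)).inner
          stronglyMeasurable_const).measurable.aemeasurable
    exact integral_of_map_eq_gaussianReal hm (hX.gaussian s t hst g)
  variance s t hst g := by
    have hm : AEMeasurable (fun ω => ⟪X t ω - X s ω, g⟫_ℝ) P :=
      (((stronglyMeasurable_of_adapted hX.adapted t).sub
        (stronglyMeasurable_of_adapted hX.adapted s)).inner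
          stronglyMeasurable_const).measurable.aemeasurable
    rw [lintegral_sq_of_map_eq_gaussianReal hm (hX.gaussian s t hst g),
      enorm_sq_eq_ofReal, ← ENNReal.ofReal_mul (sub_nonneg.2 hst)]
    congr 1
    have := inner_covMap_covMap hX.isPositive g g
    rw [real_inner_self_eq_norm_sq] at this
    rw [← this]
    rfl
  indep := hX.indep

namespace IsWienerLike

variable {R : G →L[ℝ] E} {X : Time T → Ω → E}

lemma stronglyMeasurable_sub (hX : IsWienerLike 𝓕 P R X) (s t : Time T) :
    StronglyMeasurable fun ω => X t ω - X s ω :=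
  (stronglyMeasurable_of_adapted hX.adapted t).sub (stronglyMeasurable_of_adapted hX.adapted s)

/-- Parseval in H reduces to the scalar variances, proportional to ‖R^* L^* e_j‖², whose sum is the
squared Hilbert-Schmidt norm of (L R)^*. -/
lemma lintegral_apply_sq [TopologicalSpace.SeparableSpace H] (hX : IsWienerLike 𝓕 P R X) {s t : Time T}
    (hst : s ≤ t) (L : E →L[ℝ] H) : ∫⁻ ω, ‖L (X t ω - X s ω)‖ₑ ^ 2 ∂P
      = ENNReal.ofReal ((t : ℝ) - s) * hsNormSq (L ∘L R) := by
  have h1 : ∀ ω, ‖L (X t ω - X s ω)‖ₑ ^ 2 = ∑' j : BasisIndex H,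
      ‖⟪X t ω - X s ω, ContinuousLinearMap.adjoint L (stdBasis H j)⟫_ℝ‖ₑ ^ 2 := by
    intro ω
    rw [enorm_sq_eq_tsum_inner (stdBasis H)]
    refine tsum_congr fun j => ?_
    rw [ContinuousLinearMap.adjoint_inner_right, real_inner_comm]
  simp_rw [h1]
  rw [lintegral_tsum fun j => (((hX.stronglyMeasurable_sub s t).inner
    stronglyMeasurable_const).measurable.enorm.pow_const _).aemeasurable]
  simp_rw [hX.variance s t hst]
  rw [ENNReal.tsum_mul_left, ← hsNormSq_adjoint, hsNormSq, ContinuousLinearMap.adjoint_comp]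
  rfl

variable [TopologicalSpace.SeparableSpace E]

lemma lintegral_sub_sq (hX : IsWienerLike 𝓕 P R X) {s t : Time T} (hst : s ≤ t) :
    ∫⁻ ω, ‖X t ω - X s ω‖ₑ ^ 2 ∂P = ENNReal.ofReal ((t : ℝ) - s) * hsNormSq R := by
  have := hX.lintegral_apply_sq hst (ContinuousLinearMap.id ℝ E)
  simpa using this

lemma memLp_sub (hX : IsWienerLike 𝓕 P R X) {s t : Time T} (hst : s ≤ t) :
    MemLp (fun ω => X t ω - X s ω) 2 P := by
  refine memLp_two_of_lintegral (hX.stronglyMeasurable_sub s t).aestronglyMeasurable ?_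
  rw [hX.lintegral_sub_sq hst]
  exact ENNReal.mul_lt_top ENNReal.ofReal_lt_top hX.hilbertSchmidt

lemma memLp (hX : IsWienerLike 𝓕 P R X) (t : Time T) : MemLp (X t) 2 P := by
  refine (hX.memLp_sub (bot_le : ⊥ ≤ t)).ae_eq ?_
  filter_upwards [hX.zero] with ω hω
  rw [hω, sub_zero]

lemma isContL2Martingale (hX : IsWienerLike 𝓕 P R X) : IsContL2Martingale 𝓕 P X where
  martingale := by
    refine ⟨hX.adapted, fun s t hst => ?_⟩
    have hi : ∀ t, Integrable (X t) P := fun t => (hX.memLp t).integrable one_le_two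
    borelize E
    have hm := (hX.stronglyMeasurable_sub s t).measurable
    have h1 : P[X t - X s | 𝓕 s] =ᵐ[P] fun _ => ∫ ω, (X t - X s) ω ∂P := by
      refine condExp_indep_eq hm.comap_le (𝓕.le s) ?_ (hX.indep s t hst)
      exact (comap_measurable (fun ω => X t ω - X s ω)).stronglyMeasurable
    have h2 : ∫ ω, (X t - X s) ω ∂P = 0 := by
      refine ext_inner_right ℝ fun g => ?_
      rw [inner_zero_left, ← hX.mean s t hst g, real_inner_comm,
        ← integral_inner ((hi t).sub (hi s))]
      simp_rw [real_inner_comm]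
      rfl
    have h3 := condExp_sub (m := 𝓕 s) (hi t) (hi s)
    have h4 := condExp_of_stronglyMeasurable (𝓕.le s) (hX.adapted s) (hi s)
    filter_upwards [h1, h3] with ω h1 h3
    rw [h1, h2] at h3
    rw [Pi.sub_apply, h4] at h3
    exact (sub_eq_zero.1 h3.symm)
  continuous := hX.continuous
  sq_lt_top := (hX.memLp ⊤).lintegral_sq_lt_top

variable [TopologicalSpace.SeparableSpace H]

/-- `v` has finitely many values L, and ‖L (X_t - X_s)‖² is independent of the past event {v = L}.
-/
lemma lintegral_val_apply_sq (hX : IsWienerLike 𝓕 P R X) {s t : Time T} (hst : s ≤ t)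
    {v : Ω → (E →L[ℝ] H)} (hv : StronglyMeasurable[𝓕 s] v) (hfin : (Set.range v).Finite) :
    ∫⁻ ω, ‖v ω (X t ω - X s ω)‖ₑ ^ 2 ∂P
      = ∫⁻ ω, ENNReal.ofReal ((t : ℝ) - s) * hsNormSq (v ω ∘L R) ∂P := by
  classical
  borelize E
  have hA : ∀ L, MeasurableSet[𝓕 s] {ω | v ω = L} := fun L =>
    hv.measurableSet_eq_fun stronglyMeasurable_const
  have key : ∀ (F : (E →L[ℝ] H) → Ω → ℝ≥0∞) ω, F (v ω) ω
      = ∑ L ∈ hfin.toFinset, F L ω * Set.indicator {ω | v ω = L} 1 ω := by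
    intro F ω
    rw [Finset.sum_eq_single (v ω)]
    · simp
    · intro L _ hL
      rw [Set.indicator_of_notMem (by simpa using hL.symm), mul_zero]
    · intro h
      exact absurd (hfin.mem_toFinset.2 ⟨ω, rfl⟩) h
  have hi : ∀ L, Measurable (Set.indicator {ω | v ω = L} (1 : Ω → ℝ≥0∞)) := fun L =>
    measurable_one.indicator (𝓕.le s _ (hA L))
  have hm : ∀ L : E →L[ℝ] H, Measurable fun ω => ‖L (X t ω - X s ω)‖ₑ ^ 2 := fun L =>
    (L.continuous.comp_stronglyMeasurable (hX.stronglyMeasurable_sub s t)).enorm.pow_const _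
  rw [lintegral_congr (key fun L ω => ‖L (X t ω - X s ω)‖ₑ ^ 2),
    lintegral_congr (key fun L ω => ENNReal.ofReal ((t : ℝ) - s) * hsNormSq (L ∘L R)),
    lintegral_finsetSum _ fun L _ => show Measurable fun ω => ‖L (X t ω - X s ω)‖ₑ ^ 2 * Set.indicator {ω | v ω = L} (1 : Ω → ℝ≥0∞) ω from (hm L).mul (hi L),
    lintegral_finsetSum _ fun L _ => show Measurable fun ω => ENNReal.ofReal ((t : ℝ) - s) * hsNormSq (L ∘L R) * Set.indicator {ω | v ω = L} (1 : Ω → ℝ≥0∞) ω from measurable_const.mul (hi L)]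
  refine Finset.sum_congr rfl fun L _ => ?_
  rw [lintegral_mul_eq_lintegral_mul_lintegral_of_independent_measurableSpace
    (hX.stronglyMeasurable_sub s t).measurable.comap_le (𝓕.le s) (hX.indep s t hst) ?_
    ((@measurable_one _ _ _ (𝓕 s) _).indicator (hA L)), hX.lintegral_apply_sq hst,
    lintegral_const_mul _ (hi L)]
  have hc : Measurable fun x : E => ‖L x‖ₑ ^ 2 := L.continuous.enorm.measurable.pow_const 2
  exact hc.comp (comap_measurable (fun ω => X t ω - X s ω))

end IsWienerLike

lemma SimpleProc.lintegral_eval (R : G →L[ℝ] E) (Φ : SimpleProc E H 𝓕) (ω : Ω) :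
    ∫⁻ t, hsNormSq (Φ.eval t ω ∘L R) ∂(timeMeasure T) = ∑ m : Fin (Φ.n + 1),
      ENNReal.ofReal ((Φ.time m.succ : ℝ) - Φ.time m.castSucc) * hsNormSq (Φ.val m ω ∘L R) := by
  have h : ∀ᵐ t ∂(timeMeasure T), hsNormSq (Φ.eval t ω ∘L R) = ∑ m : Fin (Φ.n + 1),
      (Set.Ioc (Φ.time m.castSucc) (Φ.time m.succ)).indicator
        (fun _ => hsNormSq (Φ.val m ω ∘L R)) t := by
    filter_upwards [ae_ne_bot] with t ht
    obtain ⟨m, hm⟩ := Φ.exists_mem_Ioc ht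
    rw [Φ.eval_eq_val hm, Finset.sum_eq_single m]
    · rw [Set.indicator_of_mem (show t ∈ Set.Ioc _ _ from hm)]
    · intro j _ hj
      rw [Set.indicator_of_notMem]
      exact fun hj' => hj (Fin.unique_castSucc_lt_le_succ Φ.strictMono hj' hm)
    · simp
  rw [lintegral_congr_ae h, lintegral_finsetSum _ fun m _ =>
    measurable_const.indicator measurableSet_Ioc]
  refine Finset.sum_congr rfl fun m _ => ?_
  rw [lintegral_indicator_const measurableSet_Ioc, timeMeasure_Ioc, mul_comm]

/-- The Itô isometry. -/
theorem IsWienerLike.lintegral_integral_sq [TopologicalSpace.SeparableSpace E] [TopologicalSpace.SeparableSpace H] {R : G →L[ℝ] E}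
    {X : Time T → Ω → E} (hX : IsWienerLike 𝓕 P R X) (Φ : SimpleProc E H 𝓕) :
    ∫⁻ ω, ‖Φ.integral X ⊤ ω‖ₑ ^ 2 ∂P
      = ∫⁻ ω, ∫⁻ t, hsNormSq (Φ.eval t ω ∘L R) ∂(timeMeasure T) ∂P := by
  rw [Φ.lintegral_integral_sq hX.isContL2Martingale]
  simp_rw [Φ.lintegral_eval R]
  rw [lintegral_finsetSum']
  · exact Finset.sum_congr rfl fun m _ => hX.lintegral_val_apply_sq
      (Φ.strictMono.monotone Fin.castSucc_lt_succ.le) (Φ.measurable m) (Φ.finite_range m)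
  · intro m _
    -- Measurability in ω: the Hilbert-Schmidt norm of L ∘ R is the norm of a bounded linear image
    -- of L.
    have h1 : StronglyMeasurable fun ω =>
        HSOp.compRight (G := H) R hX.hilbertSchmidt (Φ.val m ω) :=
      (HSOp.compRight (G := H) R hX.hilbertSchmidt).continuous.comp_stronglyMeasurable
        ((Φ.measurable m).mono (𝓕.le _))
    have h2 : ∀ ω, hsNormSq (Φ.val m ω ∘L R)
        = ‖HSOp.compRight (G := H) R hX.hilbertSchmidt (Φ.val m ω)‖ₑ ^ 2 := fun ω => by
      rw [HSOp.enorm_sq_eq, HSOp.toCLM_compRight]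
    simp_rw [h2]
    exact ((h1.enorm.pow_const _).const_mul _).aemeasurable

end WienerLike

/-! ### Density of simple processes -/

namespace HSOp

variable {E : Type*} [NormedAddCommGroup E] [InnerProductSpace ℝ E] [CompleteSpace E]
variable {F : Type*} [NormedAddCommGroup F] [InnerProductSpace ℝ F] [CompleteSpace F]
variable {G : Type*} [NormedAddCommGroup G] [InnerProductSpace ℝ G] [CompleteSpace G]

lemma memℓp_inner (y : lp (fun _ : BasisIndex E => F) 2) (h : F) :
    Memℓp (fun i => ⟪y i, h⟫_ℝ) 2 := by
  have hy := (memℓp_gen_iff (p := 2) (by norm_num)).1 (lp.memℓp y)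
  refine memℓp_gen ((hy.mul_right (‖h‖ ^ (2 : ℝ≥0∞).toReal)).of_nonneg_of_le
    (fun i => by positivity) fun i => ?_)
  rw [← Real.mul_rpow (norm_nonneg _) (norm_nonneg _)]
  exact Real.rpow_le_rpow (norm_nonneg _) (norm_inner_le_norm _ _) (by norm_num)

/-- By Cauchy-Schwarz h ↦ ∑ ⟪y_i, h⟫ e_i is bounded, and its adjoint sends e_i to y_i. This
identifies `HSOp` with an ℓ² space, which makes it complete. -/
lemma toLp_surjective : Function.Surjective (toLp (E := E) (F := F)) := by
  intro y
  let S₀ : F →ₗ[ℝ] lp (fun _ : BasisIndex E => ℝ) 2 :=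
    { toFun := fun h => ⟨fun i => ⟪y i, h⟫_ℝ, memℓp_inner y h⟩
      map_add' := fun h g => by ext i; exact inner_add_right _ _ _
      map_smul' := fun c h => by ext i; exact inner_smul_right _ _ _ }
  have hS₀ : ∀ h, ‖S₀ h‖ ≤ ‖y‖ * ‖h‖ := by
    intro h
    refine lp.norm_le_of_forall_sum_le (by norm_num) (by positivity) fun s => ?_
    rw [Real.mul_rpow (norm_nonneg _) (norm_nonneg _)]
    refine le_trans ?_ (mul_le_mul_of_nonneg_right
      (lp.sum_rpow_le_norm_rpow (by norm_num) y s) (by positivity))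
    rw [Finset.sum_mul]
    refine Finset.sum_le_sum fun i _ => ?_
    rw [← Real.mul_rpow (norm_nonneg _) (norm_nonneg _)]
    exact Real.rpow_le_rpow (norm_nonneg _) (norm_inner_le_norm _ _) (by norm_num)
  let S : F →L[ℝ] E := ((stdBasis E).repr.symm.toContinuousLinearEquiv :
    lp (fun _ : BasisIndex E => ℝ) 2 →L[ℝ] E) ∘L S₀.mkContinuous ‖y‖ hS₀
  have hT : ∀ i, ContinuousLinearMap.adjoint S (stdBasis E i) = y i := by
    intro i
    refine ext_inner_right ℝ fun h => ?_
    rw [ContinuousLinearMap.adjoint_inner_left, ← HilbertBasis.repr_apply_apply]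
    simp [S, S₀]
  have hHS : IsHilbertSchmidt (ContinuousLinearMap.adjoint S) := by
    rw [isHilbertSchmidt_iff_memℓp]
    simp only [hT]
    exact lp.memℓp y
  refine ⟨ofCLM _ hHS, ?_⟩
  ext i
  exact hT i

instance : CompleteSpace (HSOp E F) := by
  let e : HSOp E F ≃ₗᵢ[ℝ] lp (fun _ : BasisIndex E => F) 2 :=
    LinearIsometryEquiv.ofSurjective ⟨toLp, fun _ => rfl⟩ toLp_surjective
  exact (completeSpace_congr (e := e.toEquiv) e.isometry.isUniformEmbedding).2 inferInstance

lemma inner_eq_tsum (S T : HSOp E F) :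
    ⟪S, T⟫_ℝ = ∑' i, ⟪toCLM S (stdBasis E i), toCLM T (stdBasis E i)⟫_ℝ :=
  lp.inner_eq_tsum (toLp S) (toLp T)

/-- A Hilbert-Schmidt operator orthogonal to all `L ∘ R` vanishes, if `R^*` has dense range. -/
lemma eq_zero_of_inner_compRight_eq_zero {R : E →L[ℝ] F} (hR : IsHilbertSchmidt R)
    (hd : DenseRange (ContinuousLinearMap.adjoint R)) {K : HSOp E G}
    (hK : ∀ L : F →L[ℝ] G, ⟪compRight R hR L, K⟫_ℝ = 0) : K = 0 := by
  have h0 : ∀ g, toCLM K (ContinuousLinearMap.adjoint R g) = 0 := by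
    intro g
    refine ext_inner_right ℝ fun h => ?_
    -- Rank one operators suffice: the inner product of (h ⊗ g) R with K is ⟪K R^* g, h⟫.
    have h1 := hK (InnerProductSpace.rankOne ℝ h g)
    rw [inner_eq_tsum] at h1
    have h2 : ∀ i, ⟪toCLM (compRight R hR (InnerProductSpace.rankOne ℝ h g)) (stdBasis E i),
        toCLM K (stdBasis E i)⟫_ℝ = ⟪ContinuousLinearMap.adjoint R g, stdBasis E i⟫_ℝ
          * ⟪stdBasis E i, ContinuousLinearMap.adjoint (toCLM K) h⟫_ℝ := by
      intro i
      rw [toCLM_compRight, ContinuousLinearMap.comp_apply, InnerProductSpace.rankOne_apply,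
        real_inner_smul_left, ContinuousLinearMap.adjoint_inner_left,
        ContinuousLinearMap.adjoint_inner_right, real_inner_comm h]
    simp_rw [h2] at h1
    rw [HilbertBasis.tsum_inner_mul_inner, ContinuousLinearMap.adjoint_inner_right] at h1
    rw [h1, inner_zero_left]
  refine toCLM_injective ?_
  rw [map_zero]
  exact ContinuousLinearMap.ext (congrFun
    (hd.equalizer (toCLM K).continuous continuous_zero (funext h0)))

end HSOp

/-- The sets with vanishing integral form a Dynkin system, `huniv` providing the complements. -/
lemma setIntegral_eq_zero_of_isPiSystem {α : Type*} {K : Type*} [NormedAddCommGroup K]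
    [NormedSpace ℝ K] [CompleteSpace K] {m : MeasurableSpace α} {ν : Measure α}
    {C : Set (Set α)} (hgen : m = MeasurableSpace.generateFrom C) (hpi : IsPiSystem C) {f : α → K}
    (hf : Integrable f ν) (huniv : ∫ x, f x ∂ν = 0) (hC : ∀ s ∈ C, ∫ x in s, f x ∂ν = 0) :
    f =ᵐ[ν] 0 := by
  suffices h : ∀ s, MeasurableSet s → ∫ x in s, f x ∂ν = 0 from
    hf.ae_eq_zero_of_forall_setIntegral_eq_zero fun s hs _ => h s hs
  intro s hs
  induction s, hs using MeasurableSpace.induction_on_inter hgen hpi with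
  | empty => simp
  | basic t ht => exact hC t ht
  | compl t ht ih =>
    have := integral_add_compl ht hf
    rwa [ih, huniv, zero_add] at this
  | iUnion t hd hm ih =>
    rw [integral_iUnion hm hd hf.integrableOn]
    simp [ih]

section Density

variable {Ω : Type*} {mΩ : MeasurableSpace Ω} {P : Measure Ω} [IsProbabilityMeasure P]
variable {T : ℝ} [Fact (0 < T)] {𝓕 : Filtration (Time T) mΩ}
variable {E : Type*} [NormedAddCommGroup E] [InnerProductSpace ℝ E] [CompleteSpace E]
variable {G : Type*} [NormedAddCommGroup G] [InnerProductSpace ℝ G] [CompleteSpace G]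
variable {H : Type*} [NormedAddCommGroup H] [InnerProductSpace ℝ H] [CompleteSpace H]

lemma predictable_le : 𝓕.predictable ≤ (Subtype.instMeasurableSpace.prod mΩ :
    MeasurableSpace (Time T × Ω)) :=
  measurableSpace_le_predictable_of_measurableSet
    (fun _ hA => (measurableSet_singleton _).prod (𝓕.le _ _ hA))
    (fun _ _ hA => measurableSet_Ioi.prod (𝓕.le _ _ hA))

lemma _root_.MeasureTheory.IsStronglyPredictable.stronglyMeasurable_uncurry {K : Type*} [TopologicalSpace K]
    {ψ : Time T → Ω → K} (hψ : IsStronglyPredictable 𝓕 ψ) :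
    StronglyMeasurable (Function.uncurry ψ) := StronglyMeasurable.mono hψ predictable_le

/-- Generators of different kinds never meet, because no (i, T] contains `⊥`. -/
lemma isPiSystem_predictable :
    IsPiSystem ({s | ∃ A, MeasurableSet[𝓕 ⊥] A ∧ s = {(⊥ : Time T)} ×ˢ A} ∪
      {s | ∃ i A, MeasurableSet[𝓕 i] A ∧ s = Set.Ioi i ×ˢ A}) := by
  have hmix : ∀ (i : Time T) (A B : Set Ω), ¬ (({⊥} ×ˢ A) ∩ (Set.Ioi i ×ˢ B)).Nonempty := by
    rintro i A B ⟨⟨t, ω⟩, ⟨h1, -⟩, h2, -⟩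
    rw [Set.mem_singleton_iff.1 h1] at h2
    exact not_lt_bot (Set.mem_Ioi.1 h2)
  rintro _ (⟨A, hA, rfl⟩ | ⟨i, A, hA, rfl⟩) _ (⟨B, hB, rfl⟩ | ⟨j, B, hB, rfl⟩) hne
  · refine Or.inl ⟨A ∩ B, hA.inter hB, ?_⟩
    rw [Set.prod_inter_prod, Set.inter_self]
  · exact absurd hne (hmix _ _ _)
  · rw [Set.inter_comm] at hne
    exact absurd hne (hmix _ _ _)
  · refine Or.inr ⟨max i j, A ∩ B, (𝓕.mono (le_max_left i j) _ hA).inter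
      (𝓕.mono (le_max_right i j) _ hB), ?_⟩
    rw [Set.prod_inter_prod, Set.Ioi_inter_Ioi]

namespace SimpleProc

/-- The process equal to `L` on `(i, T] × A`. -/
lemma exists_elementary (i : Time T) {A : Set Ω} (hA : MeasurableSet[𝓕 i] A) (L : E →L[ℝ] H) :
    ∃ Φ : SimpleProc E H 𝓕, ∀ t, t ≠ ⊥ → ∀ ω,
      Φ.eval t ω = (Set.Ioi i ×ˢ A).indicator (fun _ => L) (t, ω) := by
  classical
  obtain ⟨Φ, h1, -⟩ := exists_of_family (𝓕 := 𝓕) (E := E) (H := H) (I := Unit) (fun _ => i)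
    (fun _ => ⊤) (fun _ => le_top) (fun _ => A.indicator fun _ => L)
    (fun _ => (((Set.finite_singleton L).union (Set.finite_singleton 0))).subset (by
      rintro _ ⟨ω, rfl⟩
      by_cases hω : ω ∈ A
      · rw [Set.indicator_of_mem hω]; exact Or.inl rfl
      · rw [Set.indicator_of_notMem hω]; exact Or.inr rfl))
    (fun _ => stronglyMeasurable_const.indicator hA)
  refine ⟨Φ, fun t ht ω => ?_⟩
  rw [h1 t ht]
  by_cases hi : i < t <;> by_cases hω : ω ∈ A <;> simp [hi, hω, le_top]

lemma stronglyMeasurable_eval (Φ : SimpleProc E H 𝓕) :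
    StronglyMeasurable fun p : Time T × Ω => Φ.eval p.1 p.2 := by
  classical
  have hv : ∀ m, StronglyMeasurable fun p : Time T × Ω => Φ.val m p.2 := fun m =>
    ((Φ.measurable m).mono (𝓕.le _)).comp_measurable measurable_snd
  unfold eval
  refine StronglyMeasurable.add (StronglyMeasurable.ite ?_ (hv 0) stronglyMeasurable_const) ?_
  · exact measurable_fst (measurableSet_singleton ⊥)
  · refine Finset.stronglyMeasurable_fun_sum _ fun m _ => ?_
    refine StronglyMeasurable.ite ?_ (hv m) stronglyMeasurable_const
    exact measurable_fst measurableSet_Ioc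

end SimpleProc

variable (P 𝓕) in
/-- The product measure, on the predictable `σ`-algebra. -/
def predMeasure : @Measure (Time T × Ω) 𝓕.predictable :=
  ((timeMeasure T).prod P).trim predictable_le

instance : IsFiniteMeasure (predMeasure P 𝓕) := isFiniteMeasure_trim _

lemma predMeasure_bot : predMeasure P 𝓕 ({⊥} ×ˢ Set.univ) = 0 := by
  rw [predMeasure, trim_measurableSet_eq _
    (measurableSet_predictable_singleton_bot_prod MeasurableSet.univ), Measure.prod_prod,
    timeMeasure_singleton, zero_mul]

lemma ae_predMeasure_ne_bot : ∀ᵐ p ∂(predMeasure P 𝓕), p.1 ≠ ⊥ := by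
  rw [ae_iff]
  refine measure_mono_null ?_ predMeasure_bot
  rintro ⟨t, ω⟩ h
  exact ⟨by simpa using h, trivial⟩

variable (P 𝓕 H) in
/-- The simple processes, composed with `R`, as a subspace of `L²`. -/
def simpleSubmodule (R : G →L[ℝ] E) (hR : IsHilbertSchmidt R) :
    Submodule ℝ (Lp (HSOp G H) 2 (predMeasure P 𝓕)) where
  carrier := {f | ∃ Φ : SimpleProc E H 𝓕, ∀ᵐ p ∂(predMeasure P 𝓕),
    f p = HSOp.compRight R hR (Φ.eval p.1 p.2)}
  zero_mem' := by
    obtain ⟨Φ, hΦ⟩ := SimpleProc.exists_elementary (𝓕 := 𝓕) (E := E) (H := H) ⊥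
      (@MeasurableSet.empty _ (𝓕 ⊥)) 0
    refine ⟨Φ, ?_⟩
    filter_upwards [Lp.coeFn_zero (HSOp G H) 2 (predMeasure P 𝓕), ae_predMeasure_ne_bot]
      with p h1 h2
    rw [h1, hΦ _ h2]
    simp
  add_mem' := by
    rintro f g ⟨Φ, hΦ⟩ ⟨Ψ, hΨ⟩
    obtain ⟨Z, hZ, -⟩ := SimpleProc.exists_comp_sub_comp Φ Ψ (ContinuousLinearMap.id ℝ E)
      (-ContinuousLinearMap.id ℝ E)
    refine ⟨Z, ?_⟩
    filter_upwards [Lp.coeFn_add f g, ae_predMeasure_ne_bot, hΦ, hΨ] with p h1 h2 h3 h4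
    rw [h1, hZ _ h2, Pi.add_apply, h3, h4, ← map_add]
    congr 1
    ext x
    simp
  smul_mem' := by
    rintro c f ⟨Φ, hΦ⟩
    obtain ⟨Z, hZ, -⟩ := SimpleProc.exists_comp_sub_comp Φ Φ (c • ContinuousLinearMap.id ℝ E) 0
    refine ⟨Z, ?_⟩
    filter_upwards [Lp.coeFn_smul c f, ae_predMeasure_ne_bot, hΦ] with p h1 h2 h3
    rw [h1, hZ _ h2, Pi.smul_apply, h3, ← map_smul]
    congr 1
    ext x
    simp

/-- If f is orthogonal to all simple processes, its integral over each (i, T] × A is orthogonal to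
every L ∘ R and hence zero. These rectangles and the null set {⊥} × Ω account for a generating
π-system, so f = 0. -/
theorem topologicalClosure_simpleSubmodule {R : G →L[ℝ] E} (hR : IsHilbertSchmidt R)
    (hd : DenseRange (ContinuousLinearMap.adjoint R)) :
    (simpleSubmodule P 𝓕 H R hR).topologicalClosure = ⊤ := by
  rw [Submodule.topologicalClosure_eq_top_iff, Submodule.eq_bot_iff]
  intro f hf
  rw [Submodule.mem_orthogonal] at hf
  have hfi : Integrable f (predMeasure P 𝓕) := (Lp.memLp f).integrable one_le_two
  have hbot : ∀ s ⊆ ({⊥} : Set (Time T)) ×ˢ (Set.univ : Set Ω),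
      ∫ p in s, f p ∂(predMeasure P 𝓕) = 0 := fun s hs =>
    setIntegral_measure_zero _ (measure_mono_null hs predMeasure_bot)
  have hIoi : ∀ (i : Time T) (A : Set Ω), MeasurableSet[𝓕 i] A →
      ∫ p in Set.Ioi i ×ˢ A, f p ∂(predMeasure P 𝓕) = 0 := by
    intro i A hA
    have hs := measurableSet_predictable_Ioi_prod hA
    refine HSOp.eq_zero_of_inner_compRight_eq_zero hR hd fun L => ?_
    rw [← L2.inner_indicatorConstLp_eq_inner_setIntegral ℝ hs (measure_ne_top _ _)]
    refine hf _ ?_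
    obtain ⟨Φ, hΦ⟩ := SimpleProc.exists_elementary i hA L
    refine ⟨Φ, ?_⟩
    filter_upwards [indicatorConstLp_coeFn (p := 2) (hs := hs)
      (hμs := measure_ne_top (predMeasure P 𝓕) _) (c := HSOp.compRight R hR L),
      ae_predMeasure_ne_bot] with p h1 h2
    rw [h1, hΦ _ h2]
    by_cases hp : p ∈ Set.Ioi i ×ˢ A
    · rw [Set.indicator_of_mem hp, Set.indicator_of_mem hp]
    · rw [Set.indicator_of_notMem hp, Set.indicator_of_notMem hp, map_zero]
  have h0 : f =ᵐ[predMeasure P 𝓕] 0 := by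
    refine setIntegral_eq_zero_of_isPiSystem (m := 𝓕.predictable) rfl isPiSystem_predictable hfi
      ?_ ?_
    · have h1 := integral_add_compl
        (measurableSet_predictable_singleton_bot_prod (𝓕 := 𝓕) MeasurableSet.univ) hfi
      rw [← h1, hbot _ le_rfl, zero_add]
      have h2 : (({⊥} : Set (Time T)) ×ˢ (Set.univ : Set Ω))ᶜ = Set.Ioi ⊥ ×ˢ Set.univ := by
        ext ⟨t, ω⟩
        simp [bot_lt_iff_ne_bot]
      rw [h2]
      exact hIoi _ _ MeasurableSet.univ
    · rintro _ (⟨A, hA, rfl⟩ | ⟨i, A, hA, rfl⟩)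
      · exact hbot _ (Set.prod_mono le_rfl (Set.subset_univ _))
      · exact hIoi i A hA
  exact (Lp.eq_zero_iff_ae_eq_zero).2 h0

lemma lintegral_time_prod {F : Time T × Ω → ℝ≥0∞} (hF : AEMeasurable F ((timeMeasure T).prod P)) :
    ∫⁻ ω, ∫⁻ t, F (t, ω) ∂(timeMeasure T) ∂P = ∫⁻ p, F p ∂((timeMeasure T).prod P) :=
  (lintegral_prod_symm F hF).symm

/-- Simple processes are dense among the square integrable predictable processes. -/
theorem exists_simpleProc_tendsto {R : G →L[ℝ] E} (hR : IsHilbertSchmidt R)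
    (hd : DenseRange (ContinuousLinearMap.adjoint R)) {ψ : Time T → Ω → HSOp G H}
    (hψ : IsStronglyPredictable 𝓕 ψ)
    (hfin : ∫⁻ ω, ∫⁻ t, ‖ψ t ω‖ₑ ^ 2 ∂(timeMeasure T) ∂P < ∞) :
    ∃ Φ : ℕ → SimpleProc E H 𝓕, Tendsto (fun k => ∫⁻ p,
      ‖HSOp.compRight R hR ((Φ k).eval p.1 p.2) - ψ p.1 p.2‖ₑ ^ 2 ∂((timeMeasure T).prod P))
      atTop (𝓝 0) := by
  -- The measure is trimmed to the predictable σ-algebra, so that the ambient L² consists of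
  -- predictable processes only.
  have hmem : MemLp (Function.uncurry ψ) 2 (predMeasure P 𝓕) := by
    refine memLp_two_of_lintegral (hψ : StronglyMeasurable[𝓕.predictable] _).aestronglyMeasurable ?_
    rw [predMeasure, lintegral_trim _
      ((hψ : StronglyMeasurable[𝓕.predictable] _).enorm.pow_const 2), ← lintegral_time_prod]
    · exact hfin
    · exact (hψ.stronglyMeasurable_uncurry.enorm.pow_const 2).aemeasurable
  have hcl : hmem.toLp ∈ closure (simpleSubmodule P 𝓕 H R hR : Set _) := by
    rw [← Submodule.topologicalClosure_coe, topologicalClosure_simpleSubmodule hR hd]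
    trivial
  obtain ⟨f, hf, hlim⟩ := mem_closure_iff_seq_limit.1 hcl
  choose Φ hΦ using hf
  refine ⟨Φ, ?_⟩
  have h1 := (ENNReal.continuous_pow 2).continuousAt.tendsto.comp
    (tendsto_iff_edist_tendsto_0.1 hlim)
  rw [zero_pow two_ne_zero] at h1
  refine h1.congr fun k => ?_
  rw [Function.comp_apply, Lp.edist_def, eLpNorm_two_sq]
  refine (lintegral_trim predictable_le ?_).trans ?_
  rotate_left
  · refine lintegral_congr_ae ?_
    filter_upwards [ae_of_ae_trim predictable_le (hΦ k),
      ae_of_ae_trim predictable_le hmem.coeFn_toLp] with p h1 h2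
    rw [Pi.sub_apply, h1, h2]
    rfl
  · exact (((Lp.stronglyMeasurable _).sub (Lp.stronglyMeasurable _)).enorm.pow_const 2)

end Density

/-! ### The integral of square integrable processes -/

section SqIntegral

variable {Ω : Type*} {mΩ : MeasurableSpace Ω} {P : Measure Ω} [IsProbabilityMeasure P]
variable {T : ℝ} [Fact (0 < T)] {𝓕 : Filtration (Time T) mΩ}
variable {E : Type*} [NormedAddCommGroup E] [InnerProductSpace ℝ E] [CompleteSpace E]
variable {E₁ : Type*} [NormedAddCommGroup E₁] [InnerProductSpace ℝ E₁] [CompleteSpace E₁]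
variable {E₂ : Type*} [NormedAddCommGroup E₂] [InnerProductSpace ℝ E₂] [CompleteSpace E₂]
variable {G : Type*} [NormedAddCommGroup G] [InnerProductSpace ℝ G] [CompleteSpace G]
variable {H : Type*} [NormedAddCommGroup H] [InnerProductSpace ℝ H] [CompleteSpace H]

/-- `M` is the integral of the square integrable `L₂(G; H)`-valued process `χ` with respect to a
process `X` whose increments have the covariance `R R^*`. For the inclusion `R` of `Q^{1/2}(E)`
this is `IsSqIntegral`. -/
structure IsL2Integral (𝓕 : Filtration (Time T) mΩ) (P : Measure Ω) (R : G →L[ℝ] E)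
    (X : Time T → Ω → E) (χ : Time T → Ω → HSOp G H) (M : Time T → Ω → H) : Prop where
  approx : ∃ Φ : ℕ → SimpleProc E H 𝓕,
    Tendsto (fun k => ∫⁻ ω, ∫⁻ t, hsNormSq ((Φ k).eval t ω ∘L R - HSOp.toCLM (χ t ω))
        ∂(timeMeasure T) ∂P) atTop (𝓝 0) ∧
    Tendsto (fun k => ⨆ t, ∫⁻ ω, ‖(Φ k).integral X t ω - M t ω‖ₑ ^ 2 ∂P) atTop (𝓝 0)

lemma stronglyMeasurable_compRight_eval {R : G →L[ℝ] E} (hR : IsHilbertSchmidt R)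
    (Φ : SimpleProc E H 𝓕) :
    StronglyMeasurable fun p : Time T × Ω => HSOp.compRight R hR (Φ.eval p.1 p.2) :=
  (HSOp.compRight R hR).continuous.comp_stronglyMeasurable Φ.stronglyMeasurable_eval

lemma lintegral_hsNormSq_sub_eq {R : G →L[ℝ] E} (hR : IsHilbertSchmidt R) (Φ : SimpleProc E H 𝓕)
    {χ : Time T → Ω → HSOp G H} (hχ : StronglyMeasurable (Function.uncurry χ)) :
    ∫⁻ ω, ∫⁻ t, hsNormSq (Φ.eval t ω ∘L R - HSOp.toCLM (χ t ω)) ∂(timeMeasure T) ∂P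
      = ∫⁻ p, ‖HSOp.compRight R hR (Φ.eval p.1 p.2) - χ p.1 p.2‖ₑ ^ 2
          ∂((timeMeasure T).prod P) := by
  rw [← lintegral_time_prod]
  · refine lintegral_congr fun ω => lintegral_congr fun t => ?_
    rw [HSOp.enorm_sq_eq, map_sub, HSOp.toCLM_compRight]
  · exact (((stronglyMeasurable_compRight_eval hR Φ).sub hχ).enorm.pow_const 2).aemeasurable

/-- Φ₁ ∘ A₁ - Φ₂ ∘ A₂ is again simple and is integrated against the single process X, so the
isometry compares integrals against A₁ X and A₂ X. This is the core of the independence of the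
embedding. -/
lemma lintegral_integral_sub_sq_le [TopologicalSpace.SeparableSpace E]
    [TopologicalSpace.SeparableSpace H] {R : G →L[ℝ] E} {X : Time T → Ω → E}
    (hX : IsWienerLike 𝓕 P R X) {A₁ : E →L[ℝ] E₁} {A₂ : E →L[ℝ] E₂} {R₁ : G →L[ℝ] E₁}
    {R₂ : G →L[ℝ] E₂} (hR₁ : IsHilbertSchmidt R₁) (hR₂ : IsHilbertSchmidt R₂)
    (h₁ : A₁ ∘L R = R₁) (h₂ : A₂ ∘L R = R₂)
    (Φ₁ : SimpleProc E₁ H 𝓕) (Φ₂ : SimpleProc E₂ H 𝓕) (t : Time T) :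
    ∫⁻ ω, ‖Φ₁.integral (fun s ω => A₁ (X s ω)) t ω
        - Φ₂.integral (fun s ω => A₂ (X s ω)) t ω‖ₑ ^ 2 ∂P
      ≤ ∫⁻ p, ‖HSOp.compRight R₁ hR₁ (Φ₁.eval p.1 p.2)
          - HSOp.compRight R₂ hR₂ (Φ₂.eval p.1 p.2)‖ₑ ^ 2 ∂((timeMeasure T).prod P) := by
  obtain ⟨Z, hZ, hZi⟩ := SimpleProc.exists_comp_sub_comp Φ₁ Φ₂ A₁ A₂
  simp_rw [← hZi X]
  refine (lintegral_enorm_sq_le_of_martingale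
    (Z.isContL2Martingale_integral hX.isContL2Martingale).martingale le_top).trans ?_
  rw [hX.lintegral_integral_sq Z, ← lintegral_time_prod]
  · refine (lintegral_congr fun ω => lintegral_congr_ae ?_).le
    filter_upwards [ae_ne_bot] with t ht
    rw [HSOp.enorm_sq_eq, map_sub, HSOp.toCLM_compRight, HSOp.toCLM_compRight, hZ t ht, ← h₁, ← h₂]
    rfl
  · exact (((stronglyMeasurable_compRight_eval hR₁ Φ₁).sub
      (stronglyMeasurable_compRight_eval hR₂ Φ₂)).enorm.pow_const 2).aemeasurable

variable [TopologicalSpace.SeparableSpace E] [TopologicalSpace.SeparableSpace H]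
variable {R : G →L[ℝ] E} {X : Time T → Ω → E} {χ : Time T → Ω → HSOp G H} {M : Time T → Ω → H}

lemma lintegral_integral_sub_sq_le_add (hX : IsWienerLike 𝓕 P R X)
    {A₁ : E →L[ℝ] E₁} {A₂ : E →L[ℝ] E₂} {R₁ : G →L[ℝ] E₁}
    {R₂ : G →L[ℝ] E₂} (hR₁ : IsHilbertSchmidt R₁) (hR₂ : IsHilbertSchmidt R₂)
    (h₁ : A₁ ∘L R = R₁) (h₂ : A₂ ∘L R = R₂) (hχ : StronglyMeasurable (Function.uncurry χ))
    (Φ₁ : SimpleProc E₁ H 𝓕) (Φ₂ : SimpleProc E₂ H 𝓕) (t : Time T) :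
    ∫⁻ ω, ‖Φ₁.integral (fun s ω => A₁ (X s ω)) t ω
        - Φ₂.integral (fun s ω => A₂ (X s ω)) t ω‖ₑ ^ 2 ∂P
      ≤ 4 * ∫⁻ p, ‖HSOp.compRight R₁ hR₁ (Φ₁.eval p.1 p.2) - χ p.1 p.2‖ₑ ^ 2
          ∂((timeMeasure T).prod P)
        + 4 * ∫⁻ p, ‖HSOp.compRight R₂ hR₂ (Φ₂.eval p.1 p.2) - χ p.1 p.2‖ₑ ^ 2
          ∂((timeMeasure T).prod P) := by
  refine (lintegral_integral_sub_sq_le hX hR₁ hR₂ h₁ h₂ Φ₁ Φ₂ t).trans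
    ((lintegral_enorm_sub_sq_le (g := fun p : Time T × Ω => χ p.1 p.2) ?_).trans_eq ?_)
  · exact ((stronglyMeasurable_compRight_eval hR₁ Φ₁).sub hχ).aestronglyMeasurable
  · congr 3
    ext p
    rw [enorm_sub_rev]

lemma lintegral_integral_sub_self_sq_le (hX : IsWienerLike 𝓕 P R X)
    (hχ : StronglyMeasurable (Function.uncurry χ)) (Φ₁ Φ₂ : SimpleProc E H 𝓕) (t : Time T) :
    ∫⁻ ω, ‖Φ₁.integral X t ω - Φ₂.integral X t ω‖ₑ ^ 2 ∂P
      ≤ 4 * ∫⁻ p, ‖HSOp.compRight R hX.hilbertSchmidt (Φ₁.eval p.1 p.2) - χ p.1 p.2‖ₑ ^ 2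
          ∂((timeMeasure T).prod P)
        + 4 * ∫⁻ p, ‖HSOp.compRight R hX.hilbertSchmidt (Φ₂.eval p.1 p.2) - χ p.1 p.2‖ₑ ^ 2
          ∂((timeMeasure T).prod P) :=
  lintegral_integral_sub_sq_le_add (A₁ := ContinuousLinearMap.id ℝ E)
    (A₂ := ContinuousLinearMap.id ℝ E) hX hX.hilbertSchmidt hX.hilbertSchmidt
    (ContinuousLinearMap.id_comp R) (ContinuousLinearMap.id_comp R) hχ Φ₁ Φ₂ t

lemma eventually_forall_integral_sub_sq_le (hX : IsWienerLike 𝓕 P R X)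
    (hχ : StronglyMeasurable (Function.uncurry χ)) {Φ : ℕ → SimpleProc E H 𝓕}
    (hΦ : Tendsto (fun k => ∫⁻ p, ‖HSOp.compRight R hX.hilbertSchmidt ((Φ k).eval p.1 p.2)
      - χ p.1 p.2‖ₑ ^ 2 ∂((timeMeasure T).prod P)) atTop (𝓝 0)) {ε : ℝ≥0∞} (hε : 0 < ε) :
    ∃ n₀, ∀ m ≥ n₀, ∀ n ≥ n₀, ∀ t,
      ∫⁻ ω, ‖(Φ m).integral X t ω - (Φ n).integral X t ω‖ₑ ^ 2 ∂P ≤ ε := by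
  -- The difference is at most 4 a + 4 b, with a and b the squared distances of the two integrands
  -- to χ.
  have hε8 : 0 < ε / 8 := ENNReal.div_pos hε.ne' (by norm_num)
  obtain ⟨n₀, hn₀⟩ := eventually_atTop.1 (ENNReal.tendsto_nhds_zero.1 hΦ _ hε8)
  refine ⟨n₀, fun m hm n hn t => ?_⟩
  refine (lintegral_integral_sub_self_sq_le hX hχ (Φ m) (Φ n) t).trans ?_
  calc _ ≤ 4 * (ε / 8) + 4 * (ε / 8) := by gcongr; exacts [hn₀ m hm, hn₀ n hn]
    _ = 8 * (ε / 8) := by rw [← add_mul]; norm_num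
    _ = ε := ENNReal.mul_div_cancel (by norm_num) (by norm_num)

/-- A pointwise limit of integrals of simple processes which converge in `L²` is an integral. -/
theorem IsL2Integral.of_tendsto (hX : IsWienerLike 𝓕 P R X)
    (hχ : StronglyMeasurable (Function.uncurry χ)) {Φ : ℕ → SimpleProc E H 𝓕}
    (hΦ : Tendsto (fun k => ∫⁻ p, ‖HSOp.compRight R hX.hilbertSchmidt ((Φ k).eval p.1 p.2)
      - χ p.1 p.2‖ₑ ^ 2 ∂((timeMeasure T).prod P)) atTop (𝓝 0))
    (hM : ∀ t, ∀ᵐ ω ∂P, Tendsto (fun k => (Φ k).integral X t ω) atTop (𝓝 (M t ω))) :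
    IsL2Integral 𝓕 P R X χ M := by
  refine ⟨Φ, ?_, ?_⟩
  · simp_rw [lintegral_hsNormSq_sub_eq hX.hilbertSchmidt _ hχ]
    exact hΦ
  · rw [ENNReal.tendsto_nhds_zero]
    intro ε hε
    obtain ⟨n₀, hn₀⟩ := eventually_forall_integral_sub_sq_le hX hχ hΦ hε
    filter_upwards [eventually_ge_atTop n₀] with k hk
    refine iSup_le fun t => lintegral_enorm_sub_sq_le_of_tendsto (fun n => ?_) (hM t) ?_
    · have hI := fun k => (Φ k).isContL2Martingale_integral hX.isContL2Martingale
      exact ((hI k).aestronglyMeasurable t).sub ((hI n).aestronglyMeasurable t)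
    · filter_upwards [eventually_ge_atTop n₀] with n hn using hn₀ k hk n hn t

lemma IsL2Integral.exists_approx (hX : IsWienerLike 𝓕 P R X)
    (hχ : StronglyMeasurable (Function.uncurry χ)) (hM : IsL2Integral 𝓕 P R X χ M) :
    ∃ Φ : ℕ → SimpleProc E H 𝓕,
      Tendsto (fun k => ∫⁻ p, ‖HSOp.compRight R hX.hilbertSchmidt ((Φ k).eval p.1 p.2)
        - χ p.1 p.2‖ₑ ^ 2 ∂((timeMeasure T).prod P)) atTop (𝓝 0) ∧
      ∀ t, Tendsto (fun k => ∫⁻ ω, ‖(Φ k).integral X t ω - M t ω‖ₑ ^ 2 ∂P) atTop (𝓝 0) := by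
  obtain ⟨Φ, h1, h2⟩ := hM.approx
  simp_rw [lintegral_hsNormSq_sub_eq hX.hilbertSchmidt _ hχ] at h1
  exact ⟨Φ, h1, fun t => tendsto_of_tendsto_of_tendsto_of_le_of_le tendsto_const_nhds h2
    (fun _ => zero_le) fun k => le_iSup (fun t => ∫⁻ ω, ‖(Φ k).integral X t ω - M t ω‖ₑ ^ 2 ∂P) t⟩

theorem IsL2Integral.isContL2Martingale (hX : IsWienerLike 𝓕 P R X)
    (hχ : StronglyMeasurable (Function.uncurry χ)) (hM : IsL2Integral 𝓕 P R X χ M)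
    (hadapted : StronglyAdapted 𝓕 M) (hcont : ∀ᵐ ω ∂P, Continuous (M · ω)) :
    IsContL2Martingale 𝓕 P M := by
  obtain ⟨Φ, -, hΦ⟩ := hM.exists_approx hX hχ
  have hI := fun k => (Φ k).isContL2Martingale_integral hX.isContL2Martingale
  have hMm : ∀ t, AEStronglyMeasurable (M t) P := fun t =>
    (stronglyMeasurable_of_adapted hadapted t).aestronglyMeasurable
  have hsq : ∀ t, ∫⁻ ω, ‖M t ω‖ₑ ^ 2 ∂P < ∞ := by
    intro t
    obtain ⟨k, hk⟩ := (ENNReal.tendsto_nhds_zero.1 (hΦ t) 1 one_pos).exists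
    have h1 := lintegral_enorm_add_sq_le (P := P) (f := fun ω => M t ω - (Φ k).integral X t ω)
      (g := fun ω => (Φ k).integral X t ω) ((hMm t).sub ((hI k).aestronglyMeasurable t))
    simp only [sub_add_cancel] at h1
    refine h1.trans_lt (ENNReal.add_lt_top.2 ⟨ENNReal.mul_lt_top (by norm_num) ?_,
      ENNReal.mul_lt_top (by norm_num) ((hI k).sq_lt_top' t)⟩)
    simp_rw [enorm_sub_rev (M t _)]
    exact hk.trans_lt ENNReal.one_lt_top
  refine ⟨martingale_of_tendsto (fun k => (hI k).martingale) hadapted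
    (fun t => (memLp_two_of_lintegral (hMm t) (hsq t)).integrable one_le_two) hΦ, hcont, hsq ⊤⟩

lemma SimpleProc.integral_bot (Φ : SimpleProc E H 𝓕) (X : Time T → Ω → E) (ω : Ω) :
    Φ.integral X ⊥ ω = 0 := by
  simp [SimpleProc.integral]

lemma IsL2Integral.ae_zero (hX : IsWienerLike 𝓕 P R X)
    (hχ : StronglyMeasurable (Function.uncurry χ)) (hM : IsL2Integral 𝓕 P R X χ M)
    (hMm : AEStronglyMeasurable (M ⊥) P) : ∀ᵐ ω ∂P, M ⊥ ω = 0 := by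
  obtain ⟨Φ, -, hΦ⟩ := hM.exists_approx hX hχ
  have h := hΦ ⊥
  simp only [SimpleProc.integral_bot] at h
  have h0 := tendsto_nhds_unique h tendsto_const_nhds
  have := ae_eq_of_lintegral_enorm_sub_sq_eq_zero (f := fun _ => (0 : H)) (g := M ⊥)
    (aestronglyMeasurable_const.sub hMm) h0.symm
  filter_upwards [this] with ω hω using hω.symm

/-- Existence of the integral. -/
theorem exists_isL2Integral (h𝓕 : IsNormal 𝓕 P) (hX : IsWienerLike 𝓕 P R X)
    (hd : DenseRange (ContinuousLinearMap.adjoint R)) (hχ : IsStronglyPredictable 𝓕 χ)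
    (hfin : ∫⁻ ω, ∫⁻ t, ‖χ t ω‖ₑ ^ 2 ∂(timeMeasure T) ∂P < ∞) :
    ∃ M : Time T → Ω → H, IsL2Integral 𝓕 P R X χ M ∧ StronglyAdapted 𝓕 M ∧
      ∀ ω, Continuous (M · ω) := by
  have hχm := hχ.stronglyMeasurable_uncurry
  obtain ⟨Φ, hΦ⟩ := exists_simpleProc_tendsto hX.hilbertSchmidt hd hχ hfin
  have hI := fun k => (Φ k).isContL2Martingale_integral hX.isContL2Martingale
  obtain ⟨N, hN, hNc, hlim⟩ := exists_limit_of_cauchy h𝓕 hI fun ε hε => by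
    obtain ⟨n₀, hn₀⟩ := eventually_forall_integral_sub_sq_le hX hχm hΦ hε
    exact ⟨n₀, fun m hm n hn => hn₀ m hm n hn ⊤⟩
  refine ⟨N, ⟨Φ, ?_, ?_⟩, hN.martingale.stronglyAdapted, hNc⟩
  · simp_rw [lintegral_hsNormSq_sub_eq hX.hilbertSchmidt _ hχm]
    exact hΦ
  · exact tendsto_of_tendsto_of_tendsto_of_le_of_le tendsto_const_nhds hlim (fun _ => zero_le)
      fun k => iSup_le fun t => (hI k).lintegral_sub_sq_le hN t

/-- Uniqueness of the integral, for two integrators `A₁ X`, `A₂ X`. -/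
theorem IsL2Integral.ae_eq (hX : IsWienerLike 𝓕 P R X)
    {A₁ : E →L[ℝ] E₁} {A₂ : E →L[ℝ] E₂} {R₁ : G →L[ℝ] E₁} {R₂ : G →L[ℝ] E₂}
    {X₁ : Time T → Ω → E₁} {X₂ : Time T → Ω → E₂} {M₁ M₂ : Time T → Ω → H}
    (h₁ : A₁ ∘L R = R₁) (h₂ : A₂ ∘L R = R₂) (hX₁ : ∀ t ω, A₁ (X t ω) = X₁ t ω)
    (hX₂ : ∀ t ω, A₂ (X t ω) = X₂ t ω) (hχ : StronglyMeasurable (Function.uncurry χ))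
    (hM₁ : IsL2Integral 𝓕 P R₁ X₁ χ M₁) (hM₂ : IsL2Integral 𝓕 P R₂ X₂ χ M₂) (t : Time T)
    (hm₁ : AEStronglyMeasurable (M₁ t) P) (hm₂ : AEStronglyMeasurable (M₂ t) P) :
    M₁ t =ᵐ[P] M₂ t := by
  have hR₁ : IsHilbertSchmidt R₁ := h₁ ▸ hX.hilbertSchmidt.comp_left A₁
  have hR₂ : IsHilbertSchmidt R₂ := h₂ ▸ hX.hilbertSchmidt.comp_left A₂
  obtain rfl : (fun t ω => A₁ (X t ω)) = X₁ := by ext t ω; exact hX₁ t ω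
  obtain rfl : (fun t ω => A₂ (X t ω)) = X₂ := by ext t ω; exact hX₂ t ω
  obtain ⟨Φ₁, hΦ₁, hI₁⟩ := hM₁.approx
  obtain ⟨Φ₂, hΦ₂, hI₂⟩ := hM₂.approx
  simp_rw [lintegral_hsNormSq_sub_eq hR₁ _ hχ] at hΦ₁
  simp_rw [lintegral_hsNormSq_sub_eq hR₂ _ hχ] at hΦ₂
  have hc : IsContL2Martingale 𝓕 P X := hX.isContL2Martingale
  -- With 0 as the second operator, the integral against A₁ X becomes one of a simple process
  -- against X, which is known to be measurable.
  have hA₁ : ∀ k, AEStronglyMeasurable ((Φ₁ k).integral (fun t ω => A₁ (X t ω)) t) P := by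
    intro k
    obtain ⟨Z, -, hZ⟩ := SimpleProc.exists_comp_sub_comp (Φ₁ k) (Φ₁ k) A₁ 0
    have h := (Z.isContL2Martingale_integral hc).aestronglyMeasurable t
    refine h.congr (Eventually.of_forall fun ω => ?_)
    rw [hZ]
    simp [SimpleProc.integral]
  have hA₂ : ∀ k, AEStronglyMeasurable ((Φ₂ k).integral (fun t ω => A₂ (X t ω)) t) P := by
    intro k
    obtain ⟨Z, -, hZ⟩ := SimpleProc.exists_comp_sub_comp (Φ₂ k) (Φ₂ k) A₂ 0
    have h := (Z.isContL2Martingale_integral hc).aestronglyMeasurable t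
    refine h.congr (Eventually.of_forall fun ω => ?_)
    rw [hZ]
    simp [SimpleProc.integral]
  refine ae_eq_of_lintegral_enorm_sub_sq_eq_zero (hm₁.sub hm₂) (le_antisymm ?_ zero_le)
  -- The chain runs from M₁ through the two simple integrals to M₂; every term on the right tends to
  -- zero with k.
  have key : ∀ k, ∫⁻ ω, ‖M₁ t ω - M₂ t ω‖ₑ ^ 2 ∂P ≤
      4 * (⨆ t, ∫⁻ ω, ‖(Φ₁ k).integral (fun t ω => A₁ (X t ω)) t ω - M₁ t ω‖ₑ ^ 2 ∂P)
      + 4 * (4 * (4 * ∫⁻ p, ‖HSOp.compRight R₁ hR₁ ((Φ₁ k).eval p.1 p.2) - χ p.1 p.2‖ₑ ^ 2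
          ∂((timeMeasure T).prod P)
        + 4 * ∫⁻ p, ‖HSOp.compRight R₂ hR₂ ((Φ₂ k).eval p.1 p.2) - χ p.1 p.2‖ₑ ^ 2
          ∂((timeMeasure T).prod P))
        + 4 * (⨆ t, ∫⁻ ω, ‖(Φ₂ k).integral (fun t ω => A₂ (X t ω)) t ω - M₂ t ω‖ₑ ^ 2 ∂P)) := by
    intro k
    refine (lintegral_enorm_sub_sq_le (g := (Φ₁ k).integral (fun t ω => A₁ (X t ω)) t)
      (hm₁.sub (hA₁ k))).trans ?_
    gcongr
    · simp_rw [enorm_sub_rev (M₁ t _)]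
      exact le_iSup (fun t => ∫⁻ ω, ‖(Φ₁ k).integral (fun t ω => A₁ (X t ω)) t ω
        - M₁ t ω‖ₑ ^ 2 ∂P) t
    · refine (lintegral_enorm_sub_sq_le (g := (Φ₂ k).integral (fun t ω => A₂ (X t ω)) t)
        ((hA₁ k).sub (hA₂ k))).trans ?_
      gcongr
      · exact lintegral_integral_sub_sq_le_add hX hR₁ hR₂ h₁ h₂ hχ (Φ₁ k) (Φ₂ k) t
      · exact le_iSup (fun t => ∫⁻ ω, ‖(Φ₂ k).integral (fun t ω => A₂ (X t ω)) t ω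
          - M₂ t ω‖ₑ ^ 2 ∂P) t
  have h4 : (4 : ℝ≥0∞) ≠ ∞ := by norm_num
  refine ge_of_tendsto' (x := (atTop : Filter ℕ)) ?_ key
  have h := (ENNReal.Tendsto.const_mul (a := 4) hI₁ (Or.inr h4)).add
    (ENNReal.Tendsto.const_mul (a := 4) ((ENNReal.Tendsto.const_mul (a := 4)
      ((ENNReal.Tendsto.const_mul (a := 4) hΦ₁ (Or.inr h4)).add
        (ENNReal.Tendsto.const_mul (a := 4) hΦ₂ (Or.inr h4))) (Or.inr h4)).add
      (ENNReal.Tendsto.const_mul (a := 4) hI₂ (Or.inr h4))) (Or.inr h4))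
  simpa using h

end SqIntegral

/-! ### Stopping the integral -/

section Stopping

variable {Ω : Type*} {mΩ : MeasurableSpace Ω} {P : Measure Ω} [IsProbabilityMeasure P]
variable {T : ℝ} [Fact (0 < T)] {𝓕 : Filtration (Time T) mΩ}

lemma coe_untopA_min (t : Time T) (r : WithTop (Time T)) :
    (((min (t : WithTop (Time T)) r).untopA : Time T) : WithTop (Time T)) = min ↑t r :=
  by
  have h : min (t : WithTop (Time T)) r ≠ ⊤ :=
    ne_of_lt (lt_of_le_of_lt (min_le_left _ _) (WithTop.coe_lt_top t))
  rw [WithTop.untopA_eq_untop h, WithTop.coe_untop]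

lemma untopA_min_of_le {t : Time T} {r : WithTop (Time T)} (h : (t : WithTop (Time T)) ≤ r) :
    (min (t : WithTop (Time T)) r).untopA = t := by
  rw [← WithTop.coe_inj, coe_untopA_min, min_eq_left h]

lemma untopA_min_top (t : Time T) : (min (t : WithTop (Time T)) ⊤).untopA = t := untopA_min_of_le le_top

lemma lt_coe_iff_exists {t : Time T} {r : WithTop (Time T)} {D : Set (Time T)} (hD : Dense D) :
    r < t ↔ ∃ q ∈ D, q < t ∧ r ≤ q := by
  constructor
  · intro h
    obtain ⟨s, rfl⟩ := WithTop.ne_top_iff_exists.1 (ne_top_of_lt h)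
    obtain ⟨q, hq, h1, h2⟩ := hD.exists_between (WithTop.coe_lt_coe.1 h)
    exact ⟨q, hq, h2, WithTop.coe_le_coe.2 h1.le⟩
  · rintro ⟨q, -, h1, h2⟩
    exact h2.trans_lt (WithTop.coe_lt_coe.2 h1)

/-- The complement {σ < t} is a union of predictable rectangles (q, T] × {σ ≤ q}, with q in a
countable dense set. -/
lemma measurableSet_predictable_le {σ : Ω → WithTop (Time T)} (hσ : IsStoppingTime 𝓕 σ) :
    MeasurableSet[𝓕.predictable] {p : Time T × Ω | (p.1 : WithTop (Time T)) ≤ σ p.2} := by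
  obtain ⟨D, hDc, hD⟩ := TopologicalSpace.exists_countable_dense (Time T)
  have h : {p : Time T × Ω | (p.1 : WithTop (Time T)) ≤ σ p.2}
      = (⋃ q ∈ D, Set.Ioi q ×ˢ {ω | σ ω ≤ q})ᶜ := by
    ext ⟨t, ω⟩
    have := lt_coe_iff_exists (t := t) (r := σ ω) hD
    rw [Set.mem_compl_iff, Set.mem_iUnion₂, Set.mem_ofPred_eq, ← not_lt, this]
    simp only [Set.mem_prod, Set.mem_Ioi, Set.mem_ofPred_eq, exists_prop]
  rw [h]
  exact MeasurableSet.compl (MeasurableSet.biUnion hDc fun q _ =>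
    measurableSet_predictable_Ioi_prod (hσ.measurableSet_le q))

lemma truncate_uncurry_eq {K : Type*} [Zero K] (σ : Ω → WithTop (Time T)) (χ : Time T → Ω → K) :
    Function.uncurry (truncate σ χ) = {p : Time T × Ω | (p.1 : WithTop (Time T)) ≤ σ p.2}.indicator
      (Function.uncurry χ) := by
  classical
  ext ⟨t, ω⟩
  simp only [Function.uncurry, truncate, Set.indicator_apply, Set.mem_ofPred_eq]

lemma _root_.MeasureTheory.IsStronglyPredictable.truncate {K : Type*} [TopologicalSpace K] [Zero K]
    {χ : Time T → Ω → K} (hχ : IsStronglyPredictable 𝓕 χ) {σ : Ω → WithTop (Time T)}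
    (hσ : IsStoppingTime 𝓕 σ) : IsStronglyPredictable 𝓕 (truncate σ χ) := by
  rw [IsStronglyPredictable, truncate_uncurry_eq]
  exact StronglyMeasurable.indicator hχ (measurableSet_predictable_le hσ)

variable (T) in
/-- The equidistant grid with `k + 2` points. -/
def timeGrid (k : ℕ) (j : Fin (k + 1 + 1)) : Time T :=
  ⟨j * T / (k + 1), by
    have hT : 0 ≤ T := Fact.out
    positivity, by
    have hT : 0 ≤ T := Fact.out
    have hj : (j : ℝ) ≤ k + 1 := by exact_mod_cast Nat.lt_succ_iff.1 j.2
    rw [div_le_iff₀ (by positivity), mul_comm T]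
    exact mul_le_mul_of_nonneg_right hj hT⟩

lemma timeGrid_strictMono (k : ℕ) : StrictMono (timeGrid T k) := by
  intro i j hij
  have hT : 0 < T := Fact.out
  rw [← Subtype.coe_lt_coe]
  have hij' : (i : ℝ) < j := by exact_mod_cast hij
  exact div_lt_div_of_pos_right (mul_lt_mul_of_pos_right hij' hT) (by positivity)

lemma timeGrid_zero (k : ℕ) : timeGrid T k 0 = ⊥ := by
  refine Subtype.ext ?_
  simp [timeGrid]

lemma timeGrid_last (k : ℕ) : timeGrid T k (Fin.last (k + 1)) = ⊤ := by
  refine Subtype.ext ?_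
  have : (k : ℝ) + 1 ≠ 0 := by positivity
  simp only [timeGrid, Fin.val_last]
  push_cast
  rw [mul_div_assoc, mul_div_cancel₀ _ this]

/-- As soon as the mesh T / (k + 1) is below t - s, the first grid point from s on, of index ⌈s (k +
1) / T⌉, lies before t. -/
lemma exists_timeGrid_mem {s t : Time T} (hst : s < t) :
    ∀ᶠ k in atTop, ∃ j, s ≤ timeGrid T k j ∧ timeGrid T k j < t := by
  have hT : 0 < T := Fact.out
  have hst' : (0 : ℝ) < t - s := sub_pos.2 hst
  obtain ⟨k₀, hk₀⟩ := exists_nat_gt (T / (t - s))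
  filter_upwards [eventually_ge_atTop k₀] with k hk
  have hk1 : (0 : ℝ) < k + 1 := by positivity
  have hsmall : T / (k + 1) < t - s := by
    rw [div_lt_iff₀ hst'] at hk₀
    rw [div_lt_iff₀ hk1, mul_comm]
    have : (k₀ : ℝ) ≤ k := by exact_mod_cast hk
    nlinarith
  set j := ⌈(s : ℝ) * (k + 1) / T⌉₊ with hj
  have hj1 : (s : ℝ) * (k + 1) / T ≤ j := Nat.le_ceil _
  have hj2 : (j : ℝ) < (s : ℝ) * (k + 1) / T + 1 :=
    Nat.ceil_lt_add_one (by have := s.2.1; positivity)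
  have hj3 : (j : ℝ) * T / (k + 1) < t := by
    rw [div_lt_iff₀ hk1]
    have h1 : (j : ℝ) * T < ((s : ℝ) * (k + 1) / T + 1) * T := mul_lt_mul_of_pos_right hj2 hT
    have h2 : ((s : ℝ) * (k + 1) / T + 1) * T = s * (k + 1) + T := by field_simp
    rw [div_lt_iff₀ hk1] at hsmall
    nlinarith
  have hjk : j < k + 1 + 1 := by
    have h1 : (j : ℝ) * T / (k + 1) < T := hj3.trans_le t.2.2
    rw [div_lt_iff₀ hk1, mul_comm] at h1
    have : (j : ℝ) < k + 1 := lt_of_mul_lt_mul_left h1 hT.le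
    have : j < k + 1 := by exact_mod_cast this
    omega
  refine ⟨⟨j, hjk⟩, ?_, ?_⟩
  · rw [← Subtype.coe_le_coe]
    change (s : ℝ) ≤ j * T / (k + 1)
    rw [div_le_iff₀ hT] at hj1
    rwa [le_div_iff₀ hk1]
  · rw [← Subtype.coe_lt_coe]
    exact hj3

open Classical in
/-- The smallest grid point above `r`. -/
def gridCeil (k : ℕ) (r : WithTop (Time T)) : Time T :=
  Finset.univ.inf' ⟨0, Finset.mem_univ _⟩ fun j : Fin (k + 1 + 1) =>
    if r ≤ timeGrid T k j then timeGrid T k j else ⊤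

lemma gridCeil_mem (k : ℕ) (r : WithTop (Time T)) : ∃ j, gridCeil k r = timeGrid T k j := by
  classical
  obtain ⟨j, -, hj⟩ := Finset.exists_mem_eq_inf' (⟨0, Finset.mem_univ _⟩ : Finset.univ.Nonempty)
    fun j : Fin (k + 1 + 1) => if r ≤ timeGrid T k j then timeGrid T k j else ⊤
  rw [gridCeil, hj]
  split_ifs
  · exact ⟨j, rfl⟩
  · exact ⟨_, (timeGrid_last k).symm⟩

lemma le_gridCeil {t : Time T} {r : WithTop (Time T)} (h : (t : WithTop (Time T)) ≤ r) (k : ℕ) :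
    t ≤ gridCeil k r := by
  refine Finset.le_inf' _ _ fun j _ => ?_
  split_ifs with hj
  · exact WithTop.coe_le_coe.1 (h.trans hj)
  · exact le_top

lemma eventually_gridCeil_lt {t : Time T} {r : WithTop (Time T)} (h : r < t) :
    ∀ᶠ k in atTop, gridCeil k r < t := by
  obtain ⟨s, rfl⟩ := WithTop.ne_top_iff_exists.1 (ne_top_of_lt h)
  filter_upwards [exists_timeGrid_mem (WithTop.coe_lt_coe.1 h)] with k hk
  obtain ⟨j, h1, h2⟩ := hk
  refine lt_of_le_of_lt (Finset.inf'_le _ (Finset.mem_univ j)) ?_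
  rwa [if_pos (WithTop.coe_le_coe.2 h1)]

/-- For s < T the event says that σ exceeds every grid point up to s, which is known at time s. The
case s = T is separate because of the default value `⊤` in `gridCeil`. -/
lemma measurableSet_lt_gridCeil {σ : Ω → WithTop (Time T)} (hσ : IsStoppingTime 𝓕 σ) (k : ℕ)
    (s : Time T) : MeasurableSet[𝓕 s] {ω | s < gridCeil k (σ ω)} := by
  by_cases hs : s = ⊤
  · have : {ω | s < gridCeil k (σ ω)} = ∅ := by
      ext ω
      simp [hs]
    rw [this]
    exact @MeasurableSet.empty _ (𝓕 s)
  · have : {ω | s < gridCeil k (σ ω)}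
        = ⋂ j ∈ {j : Fin (k + 1 + 1) | timeGrid T k j ≤ s}, {ω | σ ω ≤ timeGrid T k j}ᶜ := by
      ext ω
      simp only [gridCeil, Set.mem_ofPred_eq, Set.mem_iInter, Set.mem_compl_iff]
      refine (Finset.lt_inf'_iff _).trans (forall_congr' fun j => ?_)
      simp only [Finset.mem_univ, true_imp_iff]
      split_ifs with hj
      · simp [hj]
      · simp [hj, lt_top_iff_ne_top, hs]
    rw [this]
    refine MeasurableSet.biInter (Set.to_countable _) fun j hj => ?_
    exact (𝓕.mono hj _ (hσ.measurableSet_le _)).compl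

lemma measurable_gridCeil {σ : Ω → WithTop (Time T)} (hσ : IsStoppingTime 𝓕 σ) (k : ℕ) :
    Measurable fun ω => gridCeil k (σ ω) :=
  measurable_of_Ioi fun s => 𝓕.le s _ (measurableSet_lt_gridCeil hσ k s)

lemma tendsto_min_gridCeil (t : Time T) (r : WithTop (Time T)) :
    Tendsto (fun k => min t (gridCeil k r)) atTop (𝓝 (min (t : WithTop (Time T)) r).untopA) := by
  rcases le_or_gt (t : WithTop (Time T)) r with h | h
  · rw [untopA_min_of_le h]
    refine tendsto_const_nhds.congr fun k => ?_
    rw [min_eq_left (le_gridCeil h k)]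
  · obtain ⟨s, rfl⟩ := WithTop.ne_top_iff_exists.1 (ne_top_of_lt h)
    have hst := WithTop.coe_lt_coe.1 h
    have : (min (t : WithTop (Time T)) s).untopA = s := by
      rw [← WithTop.coe_inj, coe_untopA_min, min_eq_right h.le]
    rw [this, tendsto_order]
    refine ⟨fun u hu => Eventually.of_forall fun k => ?_, fun u hu => ?_⟩
    · exact hu.trans_le (le_min hst.le (le_gridCeil le_rfl k))
    · filter_upwards [eventually_gridCeil_lt (WithTop.coe_lt_coe.2 hu)] with k hk
      exact min_lt_of_right_lt hk

variable {E : Type*} [NormedAddCommGroup E] [InnerProductSpace ℝ E] [CompleteSpace E]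
variable {G : Type*} [NormedAddCommGroup G] [InnerProductSpace ℝ G] [CompleteSpace G]
variable {H : Type*} [NormedAddCommGroup H] [InnerProductSpace ℝ H] [CompleteSpace H]
variable [TopologicalSpace.SeparableSpace E] [TopologicalSpace.SeparableSpace H]
variable {R : G →L[ℝ] E} {X : Time T → Ω → E} {χ : Time T → Ω → HSOp G H} {M : Time T → Ω → H}

open Classical in
-- Dominated convergence with bound ‖χ‖²: at each (t, ω) the two truncations agree for large k,
-- since the grid times decide t ≤ σ correctly from some k on.
lemma tendsto_lintegral_gridCeil_sub {σ : Ω → WithTop (Time T)} (hσ : IsStoppingTime 𝓕 σ)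
    (hχ : IsStronglyPredictable 𝓕 χ)
    (hfin : ∫⁻ ω, ∫⁻ t, ‖χ t ω‖ₑ ^ 2 ∂(timeMeasure T) ∂P < ∞) :
    Tendsto (fun k => ∫⁻ p, ‖(if p.1 ≤ gridCeil k (σ p.2) then χ p.1 p.2 else 0)
      - truncate σ χ p.1 p.2‖ₑ ^ 2 ∂((timeMeasure T).prod P)) atTop (𝓝 0) := by
  have hχm := hχ.stronglyMeasurable_uncurry
  have hχσ := (hχ.truncate hσ).stronglyMeasurable_uncurry
  rw [lintegral_time_prod (F := fun p => ‖χ p.1 p.2‖ₑ ^ 2)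
    (hχm.enorm.pow_const 2).aemeasurable] at hfin
  have h := tendsto_lintegral_of_dominated_convergence (μ := (timeMeasure T).prod P)
    (F := fun k p => ‖(if p.1 ≤ gridCeil k (σ p.2) then χ p.1 p.2 else 0)
      - truncate σ χ p.1 p.2‖ₑ ^ 2) (f := fun _ => 0)
    (fun p => ‖χ p.1 p.2‖ₑ ^ 2) ?_ ?_ hfin.ne ?_
  · simpa using h
  · intro k
    refine (StronglyMeasurable.sub ?_ hχσ).enorm.pow_const 2
    refine StronglyMeasurable.ite ?_ hχm stronglyMeasurable_const
    exact measurableSet_le measurable_fst ((measurable_gridCeil hσ k).comp measurable_snd)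
  · refine fun k => Eventually.of_forall fun p => ?_
    simp only [truncate]
    split_ifs <;> simp
  · refine Eventually.of_forall fun p => ?_
    refine tendsto_const_nhds.congr' ?_
    rcases le_or_gt (p.1 : WithTop (Time T)) (σ p.2) with h | h
    · refine Eventually.of_forall fun k => ?_
      simp [truncate, h, le_gridCeil h k]
    · filter_upwards [eventually_gridCeil_lt h] with k hk
      simp [truncate, h.not_ge, hk.not_ge]

/-- The stopped integral is the integral of the truncated integrand. -/
theorem IsL2Integral.stopped (hX : IsWienerLike 𝓕 P R X)
    (hχ : IsStronglyPredictable 𝓕 χ)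
    (hfin : ∫⁻ ω, ∫⁻ t, ‖χ t ω‖ₑ ^ 2 ∂(timeMeasure T) ∂P < ∞)
    (hM : IsL2Integral 𝓕 P R X χ M) (hadapted : StronglyAdapted 𝓕 M)
    (hcont : ∀ᵐ ω ∂P, Continuous (M · ω)) {σ : Ω → WithTop (Time T)} (hσ : IsStoppingTime 𝓕 σ) :
    IsL2Integral 𝓕 P R X (truncate σ χ) (stoppedProcess M σ) := by
  classical
  have hχm := hχ.stronglyMeasurable_uncurry
  have hχσ := (hχ.truncate hσ).stronglyMeasurable_uncurry
  have hMm := hM.isContL2Martingale hX hχm hadapted hcont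
  obtain ⟨Φ₀, hΦ₀, hI₀⟩ := hM.exists_approx hX hχm
  -- Approximation of the integrand and discretisation of σ run with the same index k. Uniform
  -- convergence of the paths permits evaluation at the random time, which itself varies with k.
  obtain ⟨φ, hφ, hφt⟩ := exists_subseq_ae_tendsto
    (fun k => (Φ₀ k).isContL2Martingale_integral hX.isContL2Martingale) hMm (hI₀ ⊤)
  have hΦ := hΦ₀.comp hφ.tendsto_atTop
  choose Ψ hΨe hΨi using fun k => SimpleProc.exists_stopped (Φ₀ (φ k)) (timeGrid_strictMono k)
    (timeGrid_zero k) (timeGrid_last k) (fun ω => gridCeil_mem k (σ ω))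
    (measurableSet_lt_gridCeil hσ k)
  refine IsL2Integral.of_tendsto (Φ := Ψ) hX hχσ ?_ ?_
  · have h4 : (4 : ℝ≥0∞) ≠ ∞ := by norm_num
    have hlim := (ENNReal.Tendsto.const_mul (a := 4) hΦ (Or.inr h4)).add
      (ENNReal.Tendsto.const_mul (a := 4) (tendsto_lintegral_gridCeil_sub (P := P) hσ hχ hfin)
        (Or.inr h4))
    simp only [mul_zero, add_zero] at hlim
    refine tendsto_of_tendsto_of_tendsto_of_le_of_le tendsto_const_nhds hlim
      (fun _ => zero_le) fun k => ?_
    have hχk : StronglyMeasurable fun p : Time T × Ω =>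
        if p.1 ≤ gridCeil k (σ p.2) then χ p.1 p.2 else 0 := by
      refine StronglyMeasurable.ite ?_ hχm stronglyMeasurable_const
      exact measurableSet_le measurable_fst ((measurable_gridCeil hσ k).comp measurable_snd)
    -- The error splits into the truncated error of the simple process, at most the untruncated one,
    -- and the error of discretising σ.
    refine (lintegral_enorm_sub_sq_le (g := fun p : Time T × Ω =>
      if p.1 ≤ gridCeil k (σ p.2) then χ p.1 p.2 else 0) ?_).trans ?_
    · exact ((stronglyMeasurable_compRight_eval hX.hilbertSchmidt (Ψ k)).sub
        hχk).aestronglyMeasurable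
    · refine add_le_add (mul_le_mul_right (?_) 4) le_rfl
      rw [← lintegral_time_prod, Function.comp_apply, ← lintegral_time_prod]
      · refine lintegral_mono fun ω => lintegral_mono_ae ?_
        filter_upwards [ae_ne_bot] with t ht
        simp only [hΨe k t ht]
        split_ifs <;> simp
      · exact (((stronglyMeasurable_compRight_eval hX.hilbertSchmidt _).sub
          hχm).enorm.pow_const 2).aemeasurable
      · exact (((stronglyMeasurable_compRight_eval hX.hilbertSchmidt _).sub
          hχk).enorm.pow_const 2).aemeasurable
  · intro t
    filter_upwards [hφt, hcont] with ω hω hc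
    have h1 : Tendsto (fun k => M (min t (gridCeil k (σ ω))) ω) atTop
        (𝓝 (MeasureTheory.stoppedProcess M σ t ω)) :=
      (hc.tendsto _).comp (tendsto_min_gridCeil t (σ ω))
    rw [tendsto_iff_edist_tendsto_0] at h1 ⊢
    have h2 := tendsto_two_inv_pow.add h1
    rw [zero_add] at h2
    refine tendsto_of_tendsto_of_tendsto_of_le_of_le' tendsto_const_nhds h2
      (Eventually.of_forall fun _ => zero_le) ?_
    filter_upwards [hω] with k hk
    refine (edist_triangle _ (M (min t (gridCeil k (σ ω))) ω) _).trans (add_le_add ?_ le_rfl)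
    rw [hΨi, edist_eq_enorm_sub]
    exact hk _

end Stopping

/-! ### Localization -/

section Localization

variable {Ω : Type*} {mΩ : MeasurableSpace Ω} {P : Measure Ω} [IsProbabilityMeasure P]
variable {T : ℝ} [Fact (0 < T)] {𝓕 : Filtration (Time T) mΩ}

/-- [0, T] has a greatest element, so `⊤` is isolated; a localizing sequence is therefore almost
surely equal to `⊤` from some index on. -/
lemma tendsto_withTop_time_iff {f : ℕ → WithTop (Time T)} :
    Tendsto f atTop (𝓝 ⊤) ↔ ∀ᶠ n in atTop, f n = ⊤ := by
  constructor
  · intro h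
    filter_upwards [h.eventually (lt_mem_nhds (WithTop.coe_lt_top (⊤ : Time T)))] with n hn
    by_contra hne
    obtain ⟨s, hs⟩ := WithTop.ne_top_iff_exists.1 hne
    rw [← hs] at hn
    exact absurd (WithTop.coe_lt_coe.1 hn) not_top_lt
  · intro h
    exact tendsto_const_nhds.congr' (h.mono fun n hn => hn.symm)

/-- `r` is the last time at which m [0, t] does not exceed c. Absence of atoms gives continuity from
the left, so the admissible times form a closed set; this works even if m is infinite. If c is never
exceeded, `r` is `⊤` and not the time T. -/
lemma exists_forall_le_iff (m : Measure (Time T)) (hm : m ≪ timeMeasure T) (c : ℝ≥0∞) :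
    ∃ r : WithTop (Time T), r ≠ (⊤ : Time T) ∧ ∀ t : Time T, t ≤ r ↔ m (Set.Iic t) ≤ c := by
  by_cases htop : m (Set.Iic ⊤) ≤ c
  · refine ⟨⊤, WithTop.top_ne_coe, fun t => ⟨fun _ => ?_, fun _ => le_top⟩⟩
    exact (measure_mono (Set.Iic_subset_Iic.2 le_top)).trans htop
  have hs0 : ∀ t, m {t} = 0 := fun t => hm (timeMeasure_singleton t)
  have hclosed : IsClosed {t : Time T | m (Set.Iic t) ≤ c} := by
    rw [← isOpen_compl_iff, isOpen_iff_mem_nhds]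
    intro t ht
    have ht' : c < m (Set.Iic t) := not_le.1 ht
    have hbot : ⊥ < t := by
      rw [bot_lt_iff_ne_bot]
      rintro rfl
      rw [Set.Iic_bot, hs0] at ht'
      exact not_lt_zero ht'
    obtain ⟨u, hu, hut, hlim⟩ := exists_seq_strictMono_tendsto' hbot
    have h1 : m (Set.Iic t) ≤ ⨆ k, m (Set.Iic (u k)) := by
      rw [← Monotone.measure_iUnion fun i j hij => Set.Iic_subset_Iic.2 (hu.monotone hij)]
      calc m (Set.Iic t) ≤ m (Set.Iio t ∪ {t}) := measure_mono fun x hx => by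
            rcases (Set.mem_Iic.1 hx).lt_or_eq with h | h
            exacts [Or.inl h, Or.inr h]
        _ ≤ m (Set.Iio t) + m {t} := measure_union_le _ _
        _ = m (Set.Iio t) := by rw [hs0, add_zero]
        _ ≤ _ := measure_mono fun x hx => by
            obtain ⟨k, hk⟩ := (hlim.eventually (lt_mem_nhds hx)).exists
            exact Set.mem_iUnion.2 ⟨k, hk.le⟩
    obtain ⟨k, hk⟩ := lt_iSup_iff.1 (ht'.trans_le h1)
    filter_upwards [Ioi_mem_nhds (hut k).2] with x hx
    exact not_le.2 (hk.trans_le (measure_mono (Set.Iic_subset_Iic.2 (le_of_lt hx))))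
  obtain ⟨r, hr, hmax⟩ := hclosed.isCompact.exists_isGreatest
    ⟨⊥, by rw [Set.mem_ofPred_eq, Set.Iic_bot, hs0]; exact zero_le⟩
  refine ⟨r, fun h => htop ?_, fun t => ?_⟩
  · rw [← WithTop.coe_inj.1 h]
    exact hr
  · rw [WithTop.coe_le_coe]
    exact ⟨fun h => (measure_mono (Set.Iic_subset_Iic.2 h)).trans hr, fun h => hmax h⟩

variable {K : Type*} [NormedAddCommGroup K] {χ : Time T → Ω → K}

/-- Predictable processes are progressively measurable, so the integral over [0, q] is measurable by
the product structure of [0, q] × Ω with 𝓕 q. -/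
lemma measurable_setLIntegral_Iic (hχ : IsStronglyPredictable 𝓕 χ) (q : Time T) :
    Measurable[𝓕 q] fun ω => ∫⁻ t in Set.Iic q, ‖χ t ω‖ₑ ^ 2 ∂(timeMeasure T) := by
  have h1 : StronglyMeasurable[Subtype.instMeasurableSpace.prod (𝓕 q)]
      fun p : Set.Iic q × Ω => χ p.1 p.2 := hχ.isStronglyProgressive q
  have h2 := @Measurable.lintegral_prod_left' (Set.Iic q) Ω _ (𝓕 q)
    ((timeMeasure T).comap Subtype.val) _ _ (h1.enorm.pow_const 2)
  have h3 : (fun ω => ∫⁻ t in Set.Iic q, ‖χ t ω‖ₑ ^ 2 ∂(timeMeasure T)) = fun ω =>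
      ∫⁻ t : Set.Iic q, ‖χ t ω‖ₑ ^ 2 ∂((timeMeasure T).comap Subtype.val) := by
    ext ω
    exact (lintegral_subtype_comap measurableSet_Iic fun t => ‖χ t ω‖ₑ ^ 2).symm
  rw [h3]
  exact h2

/-- Every integrand is locally square integrable. -/
theorem exists_isLocalizingSequence (h𝓕 : IsNormal 𝓕 P) (hχ : IsIntegrand 𝓕 P χ) :
    ∃ τ : ℕ → Ω → WithTop (Time T), IsLocalizingSequence 𝓕 τ P ∧
      (∀ ω, Monotone fun n => τ n ω) ∧
      ∀ n, ∫⁻ ω, ∫⁻ t, ‖truncate (τ n) χ t ω‖ₑ ^ 2 ∂(timeMeasure T) ∂P < ∞ := by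
  have := h𝓕.right_continuous
  let m : Ω → Measure (Time T) := fun ω => (timeMeasure T).withDensity fun t => ‖χ t ω‖ₑ ^ 2
  -- τ n is the last time at which ∫₀^t ‖χ‖² ds is at most n.
  choose τ hτ hle using fun (n : ℕ) ω =>
    exists_forall_le_iff (m ω) (withDensity_absolutelyContinuous _ _) n
  have hmono : ∀ ω, Monotone fun n => τ n ω := by
    intro ω i j hij
    have key : ∀ t : Time T, t ≤ τ i ω → t ≤ τ j ω := fun t ht =>
      (hle j ω t).2 (((hle i ω t).1 ht).trans (by exact_mod_cast hij))
    change τ i ω ≤ τ j ω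
    rcases eq_or_ne (τ i ω) ⊤ with h | h
    · have h1 := key ⊤ (by rw [h]; exact le_top)
      rcases eq_or_ne (τ j ω) ⊤ with h2 | h2
      · rw [h2]; exact le_top
      · obtain ⟨s, hs⟩ := WithTop.ne_top_iff_exists.1 h2
        rw [← hs, WithTop.coe_le_coe, top_le_iff] at h1
        exact absurd (h1 ▸ hs).symm (hτ j ω)
    · obtain ⟨s, hs⟩ := WithTop.ne_top_iff_exists.1 h
      rw [← hs]
      exact key s hs.le
  refine ⟨τ, ⟨⟨fun n => ?_, ?_⟩, Eventually.of_forall hmono⟩, hmono, fun n => ?_⟩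
  -- {τ n < t} is the event that the integral up to t exceeds n, and right-continuity passes from
  -- `<` to `≤`. The extra condition concerns times isolated from the right, that is t = T, a value
  -- which τ n never takes.
  · refine isStoppingTime_of_measurableSet_lt_of_isRightContinuous' (fun t => ?_) fun t ht => ?_
    · have : {ω | τ n ω < t}
          = {ω | (n : ℝ≥0∞) < ∫⁻ s in Set.Iic t, ‖χ s ω‖ₑ ^ 2 ∂(timeMeasure T)} := by
        ext ω
        rw [Set.mem_ofPred_eq, Set.mem_ofPred_eq, ← not_le, hle, not_le,
          withDensity_apply _ measurableSet_Iic]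
      rw [this]
      exact measurable_setLIntegral_Iic hχ.predictable t measurableSet_Ioi
    · have ht : t = ⊤ := by
        by_contra hne
        exact (nhdsGT_neBot_of_exists_gt ⟨⊤, lt_top_iff_ne_top.2 hne⟩).ne ht
      have : {ω | τ n ω = t} = ∅ := by
        ext ω
        simpa [ht] using hτ n ω
      rw [this]
      exact @MeasurableSet.empty _ (𝓕 t)
  · filter_upwards [hχ.sq_integrable] with ω hω
    rw [tendsto_withTop_time_iff]
    obtain ⟨N, hN⟩ := ENNReal.exists_nat_gt hω.ne
    filter_upwards [eventually_ge_atTop N] with n hn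
    have h1 : (⊤ : Time T) ≤ τ n ω := by
      rw [hle]
      refine (measure_mono (Set.subset_univ _)).trans ?_
      rw [withDensity_apply _ MeasurableSet.univ, Measure.restrict_univ]
      exact hN.le.trans (by exact_mod_cast hn)
    by_contra h2
    obtain ⟨s, hs⟩ := WithTop.ne_top_iff_exists.1 h2
    rw [← hs, WithTop.coe_le_coe, top_le_iff] at h1
    exact absurd (h1 ▸ hs).symm (hτ n ω)
  · have key : ∀ ω, ∫⁻ t, ‖truncate (τ n) χ t ω‖ₑ ^ 2 ∂(timeMeasure T) ≤ n := by
      intro ω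
      obtain ⟨u, hu⟩ : ∃ u : Time T, u ≤ τ n ω ∧ ∀ t : Time T, t ≤ τ n ω → t ≤ u := by
        rcases eq_or_ne (τ n ω) ⊤ with h | h
        · exact ⟨⊤, by rw [h]; exact le_top, fun _ _ => le_top⟩
        · obtain ⟨s, hs⟩ := WithTop.ne_top_iff_exists.1 h
          exact ⟨s, hs.le, fun t ht => WithTop.coe_le_coe.1 (hs ▸ ht)⟩
      refine le_trans ?_ ((hle n ω u).1 hu.1)
      rw [withDensity_apply _ measurableSet_Iic, ← lintegral_indicator measurableSet_Iic]
      refine lintegral_mono fun t => ?_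
      simp only [truncate]
      split_ifs with h
      · rw [Set.indicator_of_mem (show t ∈ Set.Iic u from hu.2 t h)]
      · simp
    refine (lintegral_mono key).trans_lt ?_
    rw [lintegral_const, measure_univ, mul_one]
    exact ENNReal.natCast_lt_top n

lemma truncate_truncate (σ τ : Ω → WithTop (Time T)) :
    truncate σ (truncate τ χ) = truncate (σ ⊓ τ) χ := by
  ext t ω
  simp only [truncate, Pi.inf_apply, le_inf_iff]
  split_ifs <;> simp_all

lemma continuous_untopA_min (r : WithTop (Time T)) :
    Continuous fun t : Time T => (min (t : WithTop (Time T)) r).untopA := by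
  rcases eq_or_ne r ⊤ with rfl | h
  · simp_rw [untopA_min_top]
    exact continuous_id
  · obtain ⟨s, rfl⟩ := WithTop.ne_top_iff_exists.1 h
    have : ∀ t : Time T, (min (t : WithTop (Time T)) s).untopA = min t s := by
      intro t
      rw [← WithTop.coe_inj, coe_untopA_min, WithTop.coe_min]
    simp_rw [this]
    exact continuous_id.min continuous_const

lemma continuous_stoppedProcess {V : Type*} [TopologicalSpace V] {M : Time T → Ω → V} {ω : Ω}
    (hM : Continuous (M · ω)) (τ : Ω → WithTop (Time T)) :
    Continuous (stoppedProcess M τ · ω) :=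
  hM.comp (continuous_untopA_min (τ ω))

lemma stoppedProcess_eq_of_eq_top {V : Type*} {M : Time T → Ω → V} {ω : Ω}
    {τ : Ω → WithTop (Time T)} (h : τ ω = ⊤) (t : Time T) : stoppedProcess M τ t ω = M t ω := by
  rw [stoppedProcess, h, untopA_min_top]

variable {E : Type*} [NormedAddCommGroup E] [InnerProductSpace ℝ E] [CompleteSpace E]
variable {E₁ : Type*} [NormedAddCommGroup E₁] [InnerProductSpace ℝ E₁] [CompleteSpace E₁]
variable {E₂ : Type*} [NormedAddCommGroup E₂] [InnerProductSpace ℝ E₂] [CompleteSpace E₂]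
variable {G : Type*} [NormedAddCommGroup G] [InnerProductSpace ℝ G] [CompleteSpace G]
variable {H : Type*} [NormedAddCommGroup H] [InnerProductSpace ℝ H] [CompleteSpace H]

/-- The integral of an integrand which is almost surely square integrable in time. For the
inclusion `R` of `Q^{1/2}(E)` this is `IsStochIntegral`. -/
structure IsLocalIntegral (𝓕 : Filtration (Time T) mΩ) (P : Measure Ω) (R : G →L[ℝ] E)
    (X : Time T → Ω → E) (χ : Time T → Ω → HSOp G H) (M : Time T → Ω → H) : Prop where
  adapted : StronglyAdapted 𝓕 M
  continuous : ∀ᵐ ω ∂P, Continuous (M · ω)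
  localized : ∃ τ : ℕ → Ω → WithTop (Time T), IsLocalizingSequence 𝓕 τ P ∧
    ∀ n, (∫⁻ ω, ∫⁻ t, ‖truncate (τ n) χ t ω‖ₑ ^ 2 ∂(timeMeasure T) ∂P) < ∞ ∧
      IsL2Integral 𝓕 P R X (truncate (τ n) χ) (stoppedProcess M (τ n))

lemma IsL2Integral.congr {R : G →L[ℝ] E} {X : Time T → Ω → E} {χ : Time T → Ω → HSOp G H}
    {M N : Time T → Ω → H} (hM : IsL2Integral 𝓕 P R X χ M)
    (h : ∀ᵐ ω ∂P, ∀ t, M t ω = N t ω) : IsL2Integral 𝓕 P R X χ N := by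
  obtain ⟨Φ, h1, h2⟩ := hM.approx
  refine ⟨Φ, h1, h2.congr fun k => iSup_congr fun t => lintegral_congr_ae ?_⟩
  filter_upwards [h] with ω hω
  rw [hω]

/-- Local integrals have everywhere continuous versions. -/
lemma IsLocalIntegral.exists_continuous (h𝓕 : IsNormal 𝓕 P) {R : G →L[ℝ] E} {X : Time T → Ω → E}
    {χ : Time T → Ω → HSOp G H} {M : Time T → Ω → H} (hM : IsLocalIntegral 𝓕 P R X χ M) :
    ∃ N : Time T → Ω → H, IsLocalIntegral 𝓕 P R X χ N ∧ (∀ ω, Continuous (N · ω)) ∧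
      ∀ᵐ ω ∂P, ∀ t, M t ω = N t ω := by
  obtain ⟨A, hA, hA0, hAc⟩ := exists_measurable_null hM.continuous
  have hae : ∀ᵐ ω ∂P, ∀ t, M t ω = Aᶜ.indicator (M t) ω := by
    filter_upwards [ae_notMem_of_null hA0] with ω hω t
    rw [Set.indicator_of_mem hω]
  have hcont : ∀ ω, Continuous fun t => Aᶜ.indicator (M t) ω := by
    intro ω
    by_cases hω : ω ∈ A
    · have : ∀ t, Aᶜ.indicator (M t) ω = 0 := fun t =>
        Set.indicator_of_notMem (Set.notMem_compl_iff.2 hω) _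
      simp_rw [this]
      exact continuous_const
    · have : ∀ t, Aᶜ.indicator (M t) ω = M t ω := fun t => Set.indicator_of_mem hω _
      simp_rw [this]
      exact hAc ω hω
  refine ⟨fun t => Aᶜ.indicator (M t), ⟨fun t =>
    stronglyMeasurable_compl_indicator h𝓕 hA hA0 (hM.adapted t), Eventually.of_forall hcont, ?_⟩,
    hcont, hae⟩
  obtain ⟨τ, hτ, h⟩ := hM.localized
  refine ⟨τ, hτ, fun n => ⟨(h n).1, (h n).2.congr ?_⟩⟩
  filter_upwards [hae] with ω hω t using hω _

variable [TopologicalSpace.SeparableSpace E] [TopologicalSpace.SeparableSpace H]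

/-- Uniqueness of the integral, for two integrators `A₁ X`, `A₂ X`. -/
theorem IsLocalIntegral.indistinguishable [TopologicalSpace.SeparableSpace E₁]
    [TopologicalSpace.SeparableSpace E₂] (h𝓕 : IsNormal 𝓕 P) {R : G →L[ℝ] E} {X : Time T → Ω → E}
    (hX : IsWienerLike 𝓕 P R X)
    {A₁ : E →L[ℝ] E₁} {A₂ : E →L[ℝ] E₂} {R₁ : G →L[ℝ] E₁} {R₂ : G →L[ℝ] E₂}
    {X₁ : Time T → Ω → E₁} {X₂ : Time T → Ω → E₂} (hX₁ : IsWienerLike 𝓕 P R₁ X₁)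
    (hX₂ : IsWienerLike 𝓕 P R₂ X₂) (h₁ : A₁ ∘L R = R₁) (h₂ : A₂ ∘L R = R₂)
    (hAX₁ : ∀ t ω, A₁ (X t ω) = X₁ t ω) (hAX₂ : ∀ t ω, A₂ (X t ω) = X₂ t ω)
    {χ : Time T → Ω → HSOp G H} (hχ : IsStronglyPredictable 𝓕 χ) {M₁ M₂ : Time T → Ω → H}
    (hM₁ : IsLocalIntegral 𝓕 P R₁ X₁ χ M₁) (hM₂ : IsLocalIntegral 𝓕 P R₂ X₂ χ M₂) :
    ∀ᵐ ω ∂P, ∀ t, M₁ t ω = M₂ t ω := by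
  -- Everywhere continuous paths ensure that the stopped processes are adapted.
  obtain ⟨N₁, hN₁, hc₁, he₁⟩ := hM₁.exists_continuous h𝓕
  obtain ⟨N₂, hN₂, hc₂, he₂⟩ := hM₂.exists_continuous h𝓕
  obtain ⟨τ, hτ, hτN⟩ := hN₁.localized
  obtain ⟨σ, hσ, hσN⟩ := hN₂.localized
  have hτσ := hτ.min hσ
  -- Each process is stopped at the other localizing time as well; both then integrate the same
  -- truncation of χ, and square integrable uniqueness applies.
  have key : ∀ n, ∀ᵐ ω ∂P, ∀ t,
      stoppedProcess N₁ ((τ ⊓ σ) n) t ω = stoppedProcess N₂ ((τ ⊓ σ) n) t ω := by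
    intro n
    have hτn := hτ.isStoppingTime n
    have hσn := hσ.isStoppingTime n
    have i₁ := (hτN n).2.stopped hX₁ (hχ.truncate hτn) (hτN n).1
      (hN₁.adapted.stoppedProcess hc₁ hτn)
      (Eventually.of_forall fun ω => continuous_stoppedProcess (hc₁ ω) _) hσn
    have i₂ := (hσN n).2.stopped hX₂ (hχ.truncate hσn) (hσN n).1
      (hN₂.adapted.stoppedProcess hc₂ hσn)
      (Eventually.of_forall fun ω => continuous_stoppedProcess (hc₂ ω) _) hτn
    rw [truncate_truncate, stoppedProcess_stoppedProcess] at i₁ i₂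
    have e₁ : σ n ⊓ τ n = (τ ⊓ σ) n := inf_comm _ _
    have e₂ : τ n ⊓ σ n = (τ ⊓ σ) n := rfl
    rw [e₁] at i₁
    rw [e₂] at i₂
    have hst := hτσ.isStoppingTime n
    have hm : ∀ {N : Time T → Ω → H}, StronglyAdapted 𝓕 N → (∀ ω, Continuous (N · ω)) → ∀ t,
        AEStronglyMeasurable (stoppedProcess N ((τ ⊓ σ) n) t) P := fun h1 h2 t =>
      (stronglyMeasurable_of_adapted (StronglyAdapted.stoppedProcess h1 h2 hst) t).aestronglyMeasurable
    refine indistinguishable_of_forall_ae_eq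
      (Eventually.of_forall fun ω => continuous_stoppedProcess (hc₁ ω) _)
      (Eventually.of_forall fun ω => continuous_stoppedProcess (hc₂ ω) _) fun t => ?_
    exact IsL2Integral.ae_eq hX h₁ h₂ hAX₁ hAX₂ (hχ.truncate hst).stronglyMeasurable_uncurry i₁ i₂ t
      (hm hN₁.adapted hc₁ t) (hm hN₂.adapted hc₂ t)
  filter_upwards [ae_all_iff.2 key, hτσ.tendsto_top, he₁, he₂] with ω hω hlim h1 h2 t
  obtain ⟨n, hn⟩ := (tendsto_withTop_time_iff.1 hlim).exists
  have := hω n t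
  rw [stoppedProcess_eq_of_eq_top hn, stoppedProcess_eq_of_eq_top hn] at this
  rw [h1, h2, this]

/-- Existence of the integral. -/
theorem exists_isLocalIntegral (h𝓕 : IsNormal 𝓕 P) {R : G →L[ℝ] E} {X : Time T → Ω → E}
    (hX : IsWienerLike 𝓕 P R X) (hd : DenseRange (ContinuousLinearMap.adjoint R))
    {χ : Time T → Ω → HSOp G H} (hχ : IsIntegrand 𝓕 P χ) :
    ∃ M : Time T → Ω → H, IsLocalIntegral 𝓕 P R X χ M ∧ IsContLocalMartingale 𝓕 P M := by
  classical
  obtain ⟨τ, hτ, hmono, hfin⟩ := exists_isLocalizingSequence h𝓕 hχ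
  have hpred := fun n => hχ.predictable.truncate (hτ.isStoppingTime n)
  choose N hN hNa hNc using fun n => exists_isL2Integral h𝓕 hX hd (hpred n) (hfin n)
  -- N m stopped at τ n integrates χ truncated at τ n ⊓ τ m = τ n, and so agrees with N n by
  -- uniqueness.
  have hcons : ∀ n m, n ≤ m → ∀ᵐ ω ∂P, ∀ t, stoppedProcess (N m) (τ n) t ω = N n t ω := by
    intro n m hnm
    have i := (hN m).stopped hX (hpred m) (hfin m) (hNa m)
      (Eventually.of_forall (hNc m)) (hτ.isStoppingTime n)
    have e : τ n ⊓ τ m = τ n := inf_eq_left.2 fun ω => hmono ω hnm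
    rw [truncate_truncate, e] at i
    refine indistinguishable_of_forall_ae_eq
      (Eventually.of_forall fun ω => continuous_stoppedProcess (hNc m ω) _)
      (Eventually.of_forall (hNc n)) fun t => ?_
    exact IsL2Integral.ae_eq (A₁ := ContinuousLinearMap.id ℝ E) (A₂ := ContinuousLinearMap.id ℝ E)
      hX (ContinuousLinearMap.id_comp R) (ContinuousLinearMap.id_comp R) (fun _ _ => rfl)
      (fun _ _ => rfl) (hpred n).stronglyMeasurable_uncurry i (hN n) t
      (stronglyMeasurable_of_adapted (StronglyAdapted.stoppedProcess (hNa m) (hNc m)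
        (hτ.isStoppingTime n)) t).aestronglyMeasurable
      (stronglyMeasurable_of_adapted (hNa n) t).aestronglyMeasurable
  have hgood : ∀ᵐ ω ∂P, (∀ n m, n ≤ m → ∀ t, stoppedProcess (N m) (τ n) t ω = N n t ω) ∧
      ∃ n, τ n ω = ⊤ := by
    have h1 : ∀ᵐ ω ∂P, ∀ n m, n ≤ m → ∀ t, stoppedProcess (N m) (τ n) t ω = N n t ω := by
      rw [ae_all_iff]; intro n
      rw [ae_all_iff]; intro m
      by_cases hnm : n ≤ m
      · filter_upwards [hcons n m hnm] with ω hω _ using hω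
      · exact Eventually.of_forall fun ω h => absurd h hnm
    filter_upwards [h1, hτ.tendsto_top] with ω hω hlim
    exact ⟨hω, (tendsto_withTop_time_iff.1 hlim).exists⟩
  obtain ⟨A, hA, hA0, hAg⟩ := exists_measurable_null hgood
  -- Any index with τ n ω = `⊤` serves, by consistency off the null set `A`. The choice need not be
  -- measurable in ω.
  let idx : Ω → ℕ := fun ω => if h : ∃ n, τ n ω = ⊤ then h.choose else 0
  let M : Time T → Ω → H := fun t => Aᶜ.indicator fun ω => N (idx ω) t ω
  have hidx : ∀ ω ∉ A, τ (idx ω) ω = ⊤ := by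
    intro ω hω
    have h := (hAg ω hω).2
    simp only [idx, dif_pos h]
    exact h.choose_spec
  have hMeq : ∀ ω ∉ A, ∀ m ≥ idx ω, ∀ t, M t ω = N m t ω := by
    intro ω hω m hm t
    have h1 := (hAg ω hω).1 (idx ω) m hm t
    rw [stoppedProcess_eq_of_eq_top (hidx ω hω)] at h1
    rw [h1]
    exact Set.indicator_of_mem hω _
  have hMA : ∀ ω ∈ A, ∀ t, M t ω = 0 := fun ω hω t => Set.indicator_of_notMem (Set.notMem_compl_iff.2 hω) _
  have hMc : ∀ ω, Continuous (M · ω) := by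
    intro ω
    by_cases hω : ω ∈ A
    · simp_rw [hMA ω hω]
      exact continuous_const
    · simp_rw [hMeq ω hω _ le_rfl]
      exact hNc _ ω
  -- Adaptedness comes from the pointwise limit of the N m off `A`, which avoids measurability of
  -- `idx`.
  have hMa : StronglyAdapted 𝓕 M := by
    intro t
    refine stronglyMeasurable_of_tendsto atTop (f := fun m => Aᶜ.indicator (N m t))
      (fun m => stronglyMeasurable_compl_indicator h𝓕 hA hA0 (hNa m t)) ?_
    rw [tendsto_pi_nhds]
    intro ω
    refine tendsto_const_nhds.congr' ?_
    by_cases hω : ω ∈ A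
    · refine Eventually.of_forall fun m => ?_
      change M t ω = Aᶜ.indicator (N m t) ω
      rw [hMA ω hω, Set.indicator_of_notMem (Set.notMem_compl_iff.2 hω)]
    · filter_upwards [eventually_ge_atTop (idx ω)] with m hm
      rw [hMeq ω hω m hm, Set.indicator_of_mem hω]
  have hNM : ∀ n, ∀ᵐ ω ∂P, ∀ t, N n t ω = stoppedProcess M (τ n) t ω := by
    intro n
    filter_upwards [ae_notMem_of_null hA0] with ω hω t
    rw [← (hAg ω hω).1 n (max n (idx ω)) (le_max_left _ _) t]
    exact (hMeq ω hω _ (le_max_right _ _) _).symm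
  have hint : ∀ n, IsL2Integral 𝓕 P R X (truncate (τ n) χ) (stoppedProcess M (τ n)) := fun n =>
    (hN n).congr (hNM n)
  have hmart : ∀ n, IsContL2Martingale 𝓕 P (stoppedProcess M (τ n)) := fun n =>
    (hint n).isContL2Martingale hX (hpred n).stronglyMeasurable_uncurry
      (hMa.stoppedProcess hMc (hτ.isStoppingTime n))
      (Eventually.of_forall fun ω => continuous_stoppedProcess (hMc ω) _)
  refine ⟨M, ⟨hMa, Eventually.of_forall hMc, τ, hτ, fun n => ⟨hfin n, hint n⟩⟩,
    hMa, Eventually.of_forall hMc, ?_, τ, hτ, fun n => ⟨(hmart n).martingale, ?_⟩⟩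
  · have h0 : ∀ᵐ ω ∂P, ∀ n, N n ⊥ ω = 0 := ae_all_iff.2 fun n =>
      (hN n).ae_zero hX (hpred n).stronglyMeasurable_uncurry
        (stronglyMeasurable_of_adapted (hNa n) ⊥).aestronglyMeasurable
    filter_upwards [h0, ae_notMem_of_null hA0] with ω hω hωA
    rw [hMeq ω hωA _ le_rfl, hω]
  · exact (iSup_le fun t => lintegral_enorm_sq_le_of_martingale (hmart n).martingale
      le_top).trans_lt (hmart n).sq_lt_top

end Localization

/-! ### Generalised Wiener processes -/

section GenWienerProcess

variable {Ω : Type*} {mΩ : MeasurableSpace Ω} {P : Measure Ω} [IsProbabilityMeasure P]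
variable {T : ℝ} [Fact (0 < T)] {𝓕 : Filtration (Time T) mΩ}
variable {U : Type*} [NormedAddCommGroup U] [InnerProductSpace ℝ U] [CompleteSpace U]
variable {Q : U →L[ℝ] U} {W : Time T → U → Ω → ℝ}

namespace IsGenWiener

lemma stronglyMeasurable (hW : IsGenWiener 𝓕 P Q W) (t : Time T) (h : U) :
    StronglyMeasurable (W t h) := by
  obtain ⟨q, hq⟩ := hW.wiener h
  exact stronglyMeasurable_of_adapted hq.adapted t

lemma zero (hW : IsGenWiener 𝓕 P Q W) (h : U) : ∀ᵐ ω ∂P, W ⊥ h ω = 0 := by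
  obtain ⟨q, hq⟩ := hW.wiener h
  exact hq.zero

/-- The variance parameter q is identified by computing E W_{h;T}² twice, from the Gaussian law and
from the covariance; T > 0 permits cancellation. -/
lemma isQWiener (hW : IsGenWiener 𝓕 P Q W) (h : U) :
    IsQWiener 𝓕 P (‖covMap Q h‖ ^ 2 • ContinuousLinearMap.id ℝ ℝ) (fun t => W t h) := by
  obtain ⟨q, hq⟩ := hW.wiener h
  have hg : ∀ s t : Time T, s ≤ t → P.map (fun ω => W t h ω - W s h ω)
      = gaussianReal 0 (Real.toNNReal (((t : ℝ) - s) * q)) := fun s t hst => by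
    simpa using hq.gaussian s t hst 1
  have hq0 : 0 ≤ q := by simpa using hq.isPositive.inner_nonneg_left (1 : ℝ)
  have hT : 0 < T := Fact.out
  have h1 : ∫⁻ ω, ‖W ⊤ h ω‖ₑ ^ 2 ∂P = ENNReal.ofReal (T * q) := by
    have h2 := lintegral_sq_of_map_eq_gaussianReal
      ((hW.stronglyMeasurable ⊤ h).sub (hW.stronglyMeasurable ⊥ h)).measurable.aemeasurable
      (hg ⊥ ⊤ bot_le)
    have h3 : ((⊤ : Time T) : ℝ) - (⊥ : Time T) = T := sub_zero T
    rw [h3] at h2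
    refine Eq.trans (lintegral_congr_ae ?_) h2
    filter_upwards [hW.zero h] with ω hω
    simp [hω]
  have h2 : ∫⁻ ω, ‖W ⊤ h ω‖ₑ ^ 2 ∂P = ENNReal.ofReal (T * ⟪Q h, h⟫_ℝ) := by
    have h3 := hW.covariance ⊤ ⊤ h h
    rw [min_self] at h3
    have h4 : MemLp (W ⊤ h) 2 P := memLp_two_of_lintegral
      (hW.stronglyMeasurable ⊤ h).aestronglyMeasurable (h1 ▸ ENNReal.ofReal_lt_top)
    have h5 : ∫ ω, W ⊤ h ω * W ⊤ h ω ∂P = T * ⟪Q h, h⟫_ℝ := h3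
    rw [← h5, ofReal_integral_eq_lintegral_ofReal]
    · refine lintegral_congr fun ω => ?_
      rw [enorm_sq_eq_ofReal, Real.norm_eq_abs, sq_abs, sq]
    · simpa [sq] using h4.integrable_sq
    · exact Eventually.of_forall fun ω => mul_self_nonneg _
  have h3 : q = ‖covMap Q h‖ ^ 2 := by
    rw [← real_inner_self_eq_norm_sq, inner_covMap_covMap hW.isPositive]
    rw [h1, ENNReal.ofReal_eq_ofReal_iff (by positivity)
      (mul_nonneg hT.le (hW.isPositive.inner_nonneg_left h))] at h2
    exact mul_left_cancel₀ hT.ne' h2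
  rw [← h3]
  exact hq

lemma map_sub (hW : IsGenWiener 𝓕 P Q W) {s t : Time T} (hst : s ≤ t) (h : U) :
    P.map (fun ω => W t h ω - W s h ω)
      = gaussianReal 0 (Real.toNNReal (((t : ℝ) - s) * ‖covMap Q h‖ ^ 2)) := by
  simpa using (hW.isQWiener h).gaussian s t hst 1

lemma indep (hW : IsGenWiener 𝓕 P Q W) {s t : Time T} (hst : s ≤ t) (h : U) :
    Indep (MeasurableSpace.comap (fun ω => W t h ω - W s h ω) (borel ℝ)) (𝓕 s) P := by
  obtain ⟨q, hq⟩ := hW.wiener h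
  exact hq.indep s t hst

lemma map_eq (hW : IsGenWiener 𝓕 P Q W) (t : Time T) (h : U) :
    P.map (W t h) = gaussianReal 0 (Real.toNNReal ((t : ℝ) * ‖covMap Q h‖ ^ 2)) := by
  have h1 := hW.map_sub (bot_le : ⊥ ≤ t) h
  have h2 : ((t : Time T) : ℝ) - (⊥ : Time T) = t := sub_zero _
  rw [h2] at h1
  rw [← h1]
  refine Measure.map_congr ?_
  filter_upwards [hW.zero h] with ω hω
  simp [hω]

lemma lintegral_sq (hW : IsGenWiener 𝓕 P Q W) (t : Time T) (h : U) :
    ∫⁻ ω, ‖W t h ω‖ₑ ^ 2 ∂P = ENNReal.ofReal t * ‖covMap Q h‖ₑ ^ 2 := by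
  rw [lintegral_sq_of_map_eq_gaussianReal (hW.stronglyMeasurable t h).measurable.aemeasurable
    (hW.map_eq t h), enorm_sq_eq_ofReal, ← ENNReal.ofReal_mul t.2.1]
  rfl

lemma memLp (hW : IsGenWiener 𝓕 P Q W) (t : Time T) (h : U) : MemLp (W t h) 2 P := by
  refine memLp_two_of_lintegral (hW.stronglyMeasurable t h).aestronglyMeasurable ?_
  rw [hW.lintegral_sq]
  exact ENNReal.mul_lt_top ENNReal.ofReal_lt_top (ENNReal.pow_lt_top enorm_lt_top)

lemma integral_eq_zero (hW : IsGenWiener 𝓕 P Q W) (t : Time T) (h : U) :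
    ∫ ω, W t h ω ∂P = 0 :=
  integral_of_map_eq_gaussianReal (hW.stronglyMeasurable t h).measurable.aemeasurable
    (hW.map_eq t h)

lemma ae_add (hW : IsGenWiener 𝓕 P Q W) (t : Time T) (h g : U) :
    W t (h + g) =ᵐ[P] fun ω => W t h ω + W t g ω := by
  simpa using hW.linear t 1 1 h g

lemma ae_sub (hW : IsGenWiener 𝓕 P Q W) (t : Time T) (h g : U) :
    W t (h - g) =ᵐ[P] fun ω => W t h ω - W t g ω := by
  simpa [sub_eq_add_neg] using hW.linear t 1 (-1) h g

lemma ae_sum (hW : IsGenWiener 𝓕 P Q W) (t : Time T) {κ : Type*} (S : Finset κ) (c : κ → ℝ)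
    (h : κ → U) :
    W t (∑ k ∈ S, c k • h k) =ᵐ[P] fun ω => ∑ k ∈ S, c k * W t (h k) ω := by
  classical
  induction S using Finset.induction_on with
  | empty => simpa using hW.linear t 0 0 0 0
  | insert k S hk ih =>
    simp_rw [Finset.sum_insert hk]
    filter_upwards [hW.linear t (c k) 1 (h k) (∑ j ∈ S, c j • h j), ih] with ω h1 h2
    rw [one_smul] at h1
    rw [h1, h2, one_mul]

lemma lintegral_sub_sq (hW : IsGenWiener 𝓕 P Q W) (t : Time T) (h g : U) :
    ∫⁻ ω, ‖W t h ω - W t g ω‖ₑ ^ 2 ∂P = ENNReal.ofReal t * ‖covMap Q h - covMap Q g‖ₑ ^ 2 := by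
  rw [← _root_.map_sub, ← hW.lintegral_sq]
  refine lintegral_congr_ae ?_
  filter_upwards [hW.ae_sub t h g] with ω hω
  rw [hω]

/-- Independence of 𝓕 s makes the conditional characteristic function constant. Integrated over past
events this survives limits, and it encodes both Gaussianity (A = Ω) and independence (all A). -/
lemma setIntegral_cexp (hW : IsGenWiener 𝓕 P Q W) {s t : Time T} (hst : s ≤ t) (h : U)
    {A : Set Ω} (hA : MeasurableSet[𝓕 s] A) :
    ∫ ω in A, Complex.exp (((W t h ω - W s h ω : ℝ) : ℂ) * Complex.I) ∂P
      = P.real A * Complex.exp (-(((t : ℝ) - s) * ‖covMap Q h‖ ^ 2 / 2 : ℝ)) := by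
  have hm : Measurable fun ω => W t h ω - W s h ω :=
    ((hW.stronglyMeasurable t h).sub (hW.stronglyMeasurable s h)).measurable
  have hc : Continuous fun x : ℝ => Complex.exp ((x : ℂ) * Complex.I) := by fun_prop
  have hi : Integrable (fun ω => Complex.exp (((W t h ω - W s h ω : ℝ) : ℂ) * Complex.I)) P := by
    refine Integrable.of_bound (hc.measurable.comp hm).aestronglyMeasurable 1 ?_
    exact Eventually.of_forall fun ω => (Complex.norm_exp_ofReal_mul_I _).le
  have h1 : ∫ ω, Complex.exp (((W t h ω - W s h ω : ℝ) : ℂ) * Complex.I) ∂P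
      = Complex.exp (-(((t : ℝ) - s) * ‖covMap Q h‖ ^ 2 / 2 : ℝ)) := by
    have h2 := charFun_gaussianReal (μ := 0)
      (v := Real.toNNReal (((t : ℝ) - s) * ‖covMap Q h‖ ^ 2)) 1
    rw [← hW.map_sub hst h, charFun_apply_real,
      integral_map hm.aemeasurable (by fun_prop)] at h2
    simp only [Complex.ofReal_one, one_mul] at h2
    rw [h2, Real.coe_toNNReal _ (mul_nonneg (sub_nonneg.2 hst) (sq_nonneg _))]
    push_cast
    congr 1
    ring
  have h2 : P[fun ω => Complex.exp (((W t h ω - W s h ω : ℝ) : ℂ) * Complex.I) | 𝓕 s]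
      =ᵐ[P] fun _ => ∫ ω, Complex.exp (((W t h ω - W s h ω : ℝ) : ℂ) * Complex.I) ∂P := by
    refine condExp_indep_eq hm.comap_le (𝓕.le s) ?_ (hW.indep hst h)
    exact (hc.measurable.comp
      (comap_measurable (fun ω => W t h ω - W s h ω))).stronglyMeasurable
  rw [← setIntegral_condExp (𝓕.le s) hi hA, setIntegral_congr_ae (𝓕.le s _ hA)
    (h2.mono fun ω hω _ => hω), setIntegral_const, h1, Complex.real_smul]

end IsGenWiener

end GenWienerProcess

/-! ### Representations of generalised Wiener processes -/

section Representation

variable {Ω : Type*} {mΩ : MeasurableSpace Ω} {P : Measure Ω} [IsProbabilityMeasure P]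
variable {T : ℝ} [Fact (0 < T)] {𝓕 : Filtration (Time T) mΩ}
variable {U : Type*} [NormedAddCommGroup U] [InnerProductSpace ℝ U] [CompleteSpace U]
variable {E : Type*} [NormedAddCommGroup E] [InnerProductSpace ℝ E] [CompleteSpace E]
variable {Q : U →L[ℝ] U} {W : Time T → U → Ω → ℝ}

/-- A subsequence of a sequence which converges in mean square converges almost surely. -/
lemma exists_subseq_ae_tendsto_of_lintegral {H : Type*} [NormedAddCommGroup H] {f : ℕ → Ω → H} {g : Ω → H}
    (hf : ∀ n, AEStronglyMeasurable (f n) P) (hg : AEStronglyMeasurable g P)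
    (h : Tendsto (fun n => ∫⁻ ω, ‖f n ω - g ω‖ₑ ^ 2 ∂P) atTop (𝓝 0)) :
    ∃ ns : ℕ → ℕ, StrictMono ns ∧
      ∀ᵐ ω ∂P, Tendsto (fun n => f (ns n) ω) atTop (𝓝 (g ω)) := by
  refine TendstoInMeasure.exists_seq_tendsto_ae
    (tendstoInMeasure_of_tendsto_eLpNorm two_ne_zero hf hg ?_)
  have h1 : ∀ n, eLpNorm (f n - g) 2 P = (∫⁻ ω, ‖f n ω - g ω‖ₑ ^ 2 ∂P) ^ (1 / 2 : ℝ) := fun n => by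
    rw [eLpNorm_eq_lintegral_rpow_enorm_toReal two_ne_zero ENNReal.ofNat_ne_top]
    simp
  simp_rw [h1]
  have h2 := h.ennrpow_const (1 / 2 : ℝ)
  simpa using h2

/-- The adapted continuous process `X` is the generalised Wiener process `W` seen as an `E`-valued
process: if `ι^* g` is the limit of `covMap Q (h n)` then `⟪X t, g⟫` is the mean square
limit of `W t (h n)`. -/
structure IsRepr (𝓕 : Filtration (Time T) mΩ) (P : Measure Ω) (W : Time T → U → Ω → ℝ)
    (ι : RKSpace Q →L[ℝ] E) (X : Time T → Ω → E) : Prop where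
  adapted : StronglyAdapted 𝓕 X
  continuous : ∀ᵐ ω ∂P, Continuous (X · ω)
  approx : ∀ g : E, ∃ h : ℕ → U,
    Tendsto (fun n => covMap Q (h n)) atTop (𝓝 (ContinuousLinearMap.adjoint ι g)) ∧
    ∀ t, Tendsto (fun n => ∫⁻ ω, ‖W t (h n) ω - ⟪X t ω, g⟫_ℝ‖ₑ ^ 2 ∂P) atTop (𝓝 0)

namespace IsRepr

variable {ι : RKSpace Q →L[ℝ] E} {X : Time T → Ω → E}

/-- Dominated convergence along a subsequence on which W at both s and t converges almost surely;
the variances converge because `covMap Q (h n)` tends to ι^* g. -/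
lemma setIntegral_cexp (hX : IsRepr 𝓕 P W ι X) (hW : IsGenWiener 𝓕 P Q W) {s t : Time T}
    (hst : s ≤ t) (g : E) {A : Set Ω} (hA : MeasurableSet[𝓕 s] A) :
    ∫ ω in A, Complex.exp (((⟪X t ω - X s ω, g⟫_ℝ : ℝ) : ℂ) * Complex.I) ∂P
      = P.real A * Complex.exp
        (-(((t : ℝ) - s) * ‖ContinuousLinearMap.adjoint ι g‖ ^ 2 / 2 : ℝ)) := by
  obtain ⟨h, hh, hlim⟩ := hX.approx g
  have hmX : ∀ t, AEStronglyMeasurable (fun ω => ⟪X t ω, g⟫_ℝ) P := fun t =>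
    ((stronglyMeasurable_of_adapted hX.adapted t).inner
      stronglyMeasurable_const).aestronglyMeasurable
  have hmW : ∀ t n, AEStronglyMeasurable (W t (h n)) P := fun t n =>
    (hW.stronglyMeasurable t (h n)).aestronglyMeasurable
  obtain ⟨ns, hns, hs⟩ := exists_subseq_ae_tendsto_of_lintegral (hmW s) (hmX s) (hlim s)
  obtain ⟨ms, hms, ht⟩ := exists_subseq_ae_tendsto_of_lintegral (fun n => hmW t (ns n)) (hmX t)
    ((hlim t).comp hns.tendsto_atTop)
  have hc : Continuous fun x : ℝ => Complex.exp ((x : ℂ) * Complex.I) := by fun_prop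
  have h1 : Tendsto (fun n => ∫ ω in A, Complex.exp
      (((W t (h (ns (ms n))) ω - W s (h (ns (ms n))) ω : ℝ) : ℂ) * Complex.I) ∂P) atTop
      (𝓝 (∫ ω in A, Complex.exp (((⟪X t ω - X s ω, g⟫_ℝ : ℝ) : ℂ) * Complex.I) ∂P)) := by
    refine tendsto_integral_of_dominated_convergence (fun _ => 1) (fun n => ?_)
      (integrable_const _) (fun n => ?_) ?_
    · exact hc.comp_aestronglyMeasurable ((hmW t _).sub (hmW s _)).restrict
    · exact Eventually.of_forall fun ω => (Complex.norm_exp_ofReal_mul_I _).le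
    · refine ae_restrict_of_ae ?_
      filter_upwards [hs, ht] with ω hs ht
      have h2 := ht.sub (hs.comp hms.tendsto_atTop)
      rw [← inner_sub_left] at h2
      exact (hc.tendsto _).comp h2
  simp_rw [hW.setIntegral_cexp hst _ hA] at h1
  refine tendsto_nhds_unique h1 ?_
  have h2 := hh.comp (hns.comp hms).tendsto_atTop
  have hc' : Continuous fun x : RKSpace Q => (P.real A : ℂ) *
      Complex.exp (-(((t : ℝ) - s) * ‖x‖ ^ 2 / 2 : ℝ)) := by fun_prop
  exact (hc'.tendsto _).comp h2

lemma stronglyMeasurable_sub (hX : IsRepr 𝓕 P W ι X) (s t : Time T) :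
    StronglyMeasurable fun ω => X t ω - X s ω :=
  (stronglyMeasurable_of_adapted hX.adapted t).sub (stronglyMeasurable_of_adapted hX.adapted s)

lemma gaussian (hX : IsRepr 𝓕 P W ι X) (hW : IsGenWiener 𝓕 P Q W) {s t : Time T} (hst : s ≤ t)
    (g : E) : P.map (fun ω => ⟪X t ω - X s ω, g⟫_ℝ) = gaussianReal 0
      (Real.toNNReal (((t : ℝ) - s) * ‖ContinuousLinearMap.adjoint ι g‖ ^ 2)) := by
  have hm : AEMeasurable (fun ω => ⟪X t ω - X s ω, g⟫_ℝ) P :=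
    ((hX.stronglyMeasurable_sub s t).inner stronglyMeasurable_const).measurable.aemeasurable
  have := Measure.isProbabilityMeasure_map hm
  refine Measure.ext_of_charFun (funext fun r => ?_)
  have h1 := hX.setIntegral_cexp hW hst (r • g) (A := Set.univ) MeasurableSet.univ
  rw [charFun_gaussianReal, charFun_apply_real, integral_map hm (by fun_prop)]
  rw [setIntegral_univ] at h1
  refine Eq.trans (integral_congr_ae (Eventually.of_forall fun ω => ?_)) (h1.trans ?_)
  · simp only [real_inner_smul_right]
    push_cast
    rfl
  · rw [Real.coe_toNNReal _ (mul_nonneg (sub_nonneg.2 hst) (sq_nonneg _)), _root_.map_smul, norm_smul,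
      mul_pow, Real.norm_eq_abs, sq_abs]
    simp only [probReal_univ, Complex.ofReal_one, one_mul]
    push_cast
    congr 1
    ring

variable [TopologicalSpace.SeparableSpace E]

/-- The laws B ↦ P(A ∩ {X_t - X_s ∈ B}) and B ↦ P(A) P(X_t - X_s ∈ B) are finite measures with the
same characteristic function, hence equal. -/
lemma indep (hX : IsRepr 𝓕 P W ι X) (hW : IsGenWiener 𝓕 P Q W) {s t : Time T} (hst : s ≤ t) :
    Indep (MeasurableSpace.comap (fun ω => X t ω - X s ω) (borel E)) (𝓕 s) P := by
  borelize E
  have : SecondCountableTopology E := UniformSpace.secondCountable_of_separable E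
  have hm : Measurable fun ω => X t ω - X s ω := (hX.stronglyMeasurable_sub s t).measurable
  rw [Indep_iff]
  rintro _ A ⟨B, hB, rfl⟩ hA
  have hA' := 𝓕.le s _ hA
  have key : (P.restrict A).map (fun ω => X t ω - X s ω)
      = P A • P.map (fun ω => X t ω - X s ω) := by
    have : IsFiniteMeasure (P A • P.map (fun ω => X t ω - X s ω)) :=
      Measure.smul_finite _ (measure_ne_top P A)
    refine Measure.ext_of_charFun (funext fun g => ?_)
    have hcg : Continuous fun x : E => Complex.exp (((⟪x, g⟫_ℝ : ℝ) : ℂ) * Complex.I) := by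
      fun_prop
    rw [charFun_apply, charFun_apply, integral_smul_measure,
      integral_map hm.aemeasurable hcg.aestronglyMeasurable,
      integral_map hm.aemeasurable hcg.aestronglyMeasurable, hX.setIntegral_cexp hW hst g hA,
      ← setIntegral_univ, hX.setIntegral_cexp hW hst g MeasurableSet.univ]
    simp [Measure.real]
  have h1 := congrArg (fun μ : Measure E => μ B) key
  rw [Measure.map_apply hm hB, Measure.restrict_apply (hm hB), Measure.smul_apply,
    Measure.map_apply hm hB, smul_eq_mul] at h1
  rw [h1, mul_comm]

lemma zero (hX : IsRepr 𝓕 P W ι X) (hW : IsGenWiener 𝓕 P Q W) : ∀ᵐ ω ∂P, X ⊥ ω = 0 := by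
  have h1 : ∀ g : E, ∀ᵐ ω ∂P, ⟪X ⊥ ω, g⟫_ℝ = 0 := fun g => by
    obtain ⟨h, -, hlim⟩ := hX.approx g
    have h2 : ∀ n, ∫⁻ ω, ‖W ⊥ (h n) ω - ⟪X ⊥ ω, g⟫_ℝ‖ₑ ^ 2 ∂P
        = ∫⁻ ω, ‖⟪X ⊥ ω, g⟫_ℝ - 0‖ₑ ^ 2 ∂P := fun n => by
      refine lintegral_congr_ae ?_
      filter_upwards [hW.zero (h n)] with ω hω
      rw [hω, zero_sub, sub_zero, enorm_neg]
    have h3 := tendsto_nhds_unique ((hlim ⊥).congr h2) tendsto_const_nhds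
    have hm : AEStronglyMeasurable (fun ω => ⟪X ⊥ ω, g⟫_ℝ) P :=
      ((stronglyMeasurable_of_adapted hX.adapted ⊥).inner
        stronglyMeasurable_const).aestronglyMeasurable
    exact ae_eq_of_lintegral_enorm_sub_sq_eq_zero (g := fun _ => (0 : ℝ))
      (by simpa using hm) h3.symm
  have h2 : ∀ᵐ ω ∂P, ∀ i, ⟪X ⊥ ω, stdBasis E i⟫_ℝ = 0 := ae_all_iff.2 fun i => h1 _
  filter_upwards [h2] with ω hω
  refine (stdBasis E).repr.injective ?_
  ext i
  simp [HilbertBasis.repr_apply_apply, real_inner_comm, hω i]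

lemma isWienerLike (hX : IsRepr 𝓕 P W ι X) (hW : IsGenWiener 𝓕 P Q W)
    (hι : IsHilbertSchmidt ι) : IsWienerLike 𝓕 P ι X where
  hilbertSchmidt := hι
  adapted := hX.adapted
  zero := hX.zero hW
  continuous := hX.continuous
  mean s t hst g := integral_of_map_eq_gaussianReal
    ((hX.stronglyMeasurable_sub s t).inner stronglyMeasurable_const).measurable.aemeasurable
    (hX.gaussian hW hst g)
  variance s t hst g := by
    rw [lintegral_sq_of_map_eq_gaussianReal
      ((hX.stronglyMeasurable_sub s t).inner stronglyMeasurable_const).measurable.aemeasurable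
      (hX.gaussian hW hst g), enorm_sq_eq_ofReal, ← ENNReal.ofReal_mul (sub_nonneg.2 hst)]
    rfl
  indep s t hst := hX.indep hW hst

lemma isQWiener (hX : IsRepr 𝓕 P W ι X) (hW : IsGenWiener 𝓕 P Q W)
    (hι : IsHilbertSchmidt ι) : IsQWiener 𝓕 P (extCov ι) X where
  isPositive := ContinuousLinearMap.isPositive_self_comp_adjoint ι
  traceClass := by
    rw [extCov, posTrace_comp_adjoint]
    exact hι
  adapted := hX.adapted
  zero := hX.zero hW
  continuous := hX.continuous
  gaussian s t hst g := by
    rw [hX.gaussian hW hst g, extCov, ContinuousLinearMap.comp_apply,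
      ← ContinuousLinearMap.adjoint_inner_right, real_inner_self_eq_norm_sq]
  indep s t hst := hX.indep hW hst

end IsRepr

end Representation

/-! ### Series of orthogonal random variables -/

section Series

variable {Ω : Type*} {mΩ : MeasurableSpace Ω} {P : Measure Ω} [IsProbabilityMeasure P]
variable {T : ℝ} [Fact (0 < T)] {𝓕 : Filtration (Time T) mΩ}
variable {U : Type*} [NormedAddCommGroup U] [InnerProductSpace ℝ U] [CompleteSpace U]
variable {E : Type*} [NormedAddCommGroup E] [InnerProductSpace ℝ E] [CompleteSpace E]
variable {E₁ : Type*} [NormedAddCommGroup E₁] [InnerProductSpace ℝ E₁] [CompleteSpace E₁]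
variable {E₂ : Type*} [NormedAddCommGroup E₂] [InnerProductSpace ℝ E₂] [CompleteSpace E₂]
variable {Q : U →L[ℝ] U} {W : Time T → U → Ω → ℝ}

lemma _root_.MeasureTheory.MemLp.smul_vector {b : Ω → ℝ} (hb : MemLp b 2 P) (x : E) :
    MemLp (fun ω => b ω • x) 2 P :=
  (ContinuousLinearMap.toSpanSingleton ℝ x).comp_memLp' hb

/-- The mean square of a finite sum with orthogonal coefficients of the same size. -/
lemma lintegral_sum_smul_sq {κ : Type*} {b : κ → Ω → ℝ} {c : ℝ≥0∞} (hb : ∀ k, MemLp (b k) 2 P)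
    (hc : ∀ k, ∫⁻ ω, ‖b k ω‖ₑ ^ 2 ∂P = c) (ho : ∀ j k, j ≠ k → ∫ ω, b j ω * b k ω ∂P = 0)
    (S : Finset κ) (x : κ → E) :
    ∫⁻ ω, ‖∑ k ∈ S, b k ω • x k‖ₑ ^ 2 ∂P = c * ∑ k ∈ S, ‖x k‖ₑ ^ 2 := by
  classical
  induction S using Finset.induction_on with
  | empty => simp
  | insert k S hk ih =>
    simp_rw [Finset.sum_insert hk]
    rw [lintegral_enorm_sq_add_of_orthogonal ((hb k).smul_vector (x k))
      (memLp_finsetSum S fun j _ => (hb j).smul_vector (x j)), ih, mul_add]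
    · congr 1
      simp_rw [enorm_smul, mul_pow]
      rw [lintegral_mul_const' _ _ (ENNReal.pow_ne_top enorm_ne_top), hc]
    · simp_rw [inner_sum, real_inner_smul_left, real_inner_smul_right]
      rw [integral_finsetSum]
      · refine Finset.sum_eq_zero fun j hj => ?_
        have h1 : ∀ ω, b k ω * (b j ω * ⟪x k, x j⟫_ℝ) = (b k ω * b j ω) * ⟪x k, x j⟫_ℝ :=
          fun ω => (mul_assoc _ _ _).symm
        simp_rw [h1]
        rw [integral_mul_const, ho k j (fun h => hk (h ▸ hj)), zero_mul]
      · intro j _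
        have h2 := ((hb k).smul_vector (x k)).integrable_inner_real ((hb j).smul_vector (x j))
        simp_rw [real_inner_smul_left, real_inner_smul_right] at h2
        exact h2

lemma sum_enorm_inner_sq_le {κ : Type*} (f : HilbertBasis κ ℝ E) (S : Finset κ) (x : E) :
    ∑ k ∈ S, ‖⟪f k, x⟫_ℝ‖ₑ ^ 2 ≤ ‖x‖ₑ ^ 2 := by
  rw [enorm_sq_eq_tsum_inner f]
  exact ENNReal.sum_le_tsum S

lemma IsQWiener.lintegral_sq_of_standard {β : Time T → Ω → ℝ}
    (hβ : IsQWiener 𝓕 P (ContinuousLinearMap.id ℝ ℝ) β) (t : Time T) :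
    ∫⁻ ω, ‖β t ω‖ₑ ^ 2 ∂P = ENNReal.ofReal t ∧ ∫ ω, β t ω ∂P = 0 := by
  have hm : ∀ t, Measurable (β t) := fun t =>
    (stronglyMeasurable_of_adapted hβ.adapted t).measurable
  have h1 : P.map (β t) = gaussianReal 0 (Real.toNNReal t) := by
    have h2 := hβ.gaussian ⊥ t bot_le 1
    have h3 : (t : ℝ) - (⊥ : Time T) = t := sub_zero _
    rw [h3] at h2
    simp only [ContinuousLinearMap.id_apply, inner_self_eq_norm_sq_to_K, norm_one, RCLike.ofReal_one,
      one_pow, mul_one] at h2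
    rw [← h2]
    refine Measure.map_congr ?_
    filter_upwards [hβ.zero] with ω hω
    simp [hω]
  exact ⟨lintegral_sq_of_map_eq_gaussianReal (hm t).aemeasurable h1,
    integral_of_map_eq_gaussianReal (hm t).aemeasurable h1⟩

lemma integral_mul_eq_zero_of_iIndepFun {κ : Type*} {β : κ → Time T → Ω → ℝ}
    (hβ : ∀ k, IsQWiener 𝓕 P (ContinuousLinearMap.id ℝ ℝ) (β k))
    (hi : iIndepFun (fun k ω t => β k t ω) P) (t : Time T) {j k : κ} (hjk : j ≠ k) :
    ∫ ω, β j t ω * β k t ω ∂P = 0 := by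
  have h1 : IndepFun (β j t) (β k t) P :=
    (hi.indepFun hjk).comp (φ := fun x : Time T → ℝ => x t) (ψ := fun x : Time T → ℝ => x t)
      (measurable_pi_apply t) (measurable_pi_apply t)
  have hm : ∀ k, AEStronglyMeasurable (β k t) P := fun k =>
    (stronglyMeasurable_of_adapted (hβ k).adapted t).aestronglyMeasurable
  rw [h1.integral_fun_mul_eq_mul_integral (hm j) (hm k), ((hβ j).lintegral_sq_of_standard t).2,
    zero_mul]

/-- The partial sums of the two series differ by a sum with coefficients ⟪f_k, covMap Q h - ι^* g⟫,
so orthogonality and Bessel's inequality bound the mean square. The 16 stems from two triangle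
inequalities with constant 4. -/
lemma IsExtension.lintegral_sub_sq_le {ι : RKSpace Q →L[ℝ] E} {X : Time T → Ω → E}
    (hX : IsExtension 𝓕 P W ι X) (hW : IsGenWiener 𝓕 P Q W) (t : Time T) (h : U) (g : E) :
    ∫⁻ ω, ‖W t h ω - ⟪X t ω, g⟫_ℝ‖ₑ ^ 2 ∂P
      ≤ 16 * (ENNReal.ofReal t * ‖covMap Q h - ContinuousLinearMap.adjoint ι g‖ₑ ^ 2) := by
  obtain ⟨κ, f, β, hβ, hi, hWs, hXs⟩ := hX.series
  have hmβ : ∀ k, StronglyMeasurable (β k t) := fun k =>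
    stronglyMeasurable_of_adapted (hβ k).adapted t
  have hLp : ∀ k, MemLp (β k t) 2 P := fun k => memLp_two_of_lintegral
    (hmβ k).aestronglyMeasurable
    (((hβ k).lintegral_sq_of_standard t).1 ▸ ENNReal.ofReal_lt_top)
  have hsum : ∀ c : κ → ℝ, ∀ S : Finset κ,
      StronglyMeasurable fun ω => ∑ k ∈ S, β k t ω * c k := fun c S =>
    Finset.stronglyMeasurable_fun_sum S fun k _ => (hmβ k).mul_const (c k)
  have hmX : StronglyMeasurable (X t) := stronglyMeasurable_of_adapted hX.adapted t
  set d := covMap Q h - ContinuousLinearMap.adjoint ι g with hd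
  have h2 : ∀ S : Finset κ, ∫⁻ ω, ‖(∑ k ∈ S, β k t ω *
      ⟪ImageSpace.incl (opSqrt Q) (f k), h⟫_ℝ) - ⟪∑ k ∈ S, β k t ω • ι (f k), g⟫_ℝ‖ₑ ^ 2 ∂P
        ≤ ENNReal.ofReal t * ‖d‖ₑ ^ 2 := fun S => by
    have h3 : ∀ ω, (∑ k ∈ S, β k t ω * ⟪ImageSpace.incl (opSqrt Q) (f k), h⟫_ℝ)
        - ⟪∑ k ∈ S, β k t ω • ι (f k), g⟫_ℝ = ∑ k ∈ S, β k t ω • ⟪f k, d⟫_ℝ := fun ω => by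
      rw [sum_inner, ← Finset.sum_sub_distrib]
      refine Finset.sum_congr rfl fun k _ => ?_
      rw [real_inner_smul_left, ← ContinuousLinearMap.adjoint_inner_right ι, ← inner_covMap Q (f k) h,
        ← mul_sub, ← inner_sub_right, smul_eq_mul]
    simp_rw [h3]
    rw [lintegral_sum_smul_sq hLp (fun k => ((hβ k).lintegral_sq_of_standard t).1)
      (fun j k hjk => integral_mul_eq_zero_of_iIndepFun hβ hi t hjk)]
    gcongr
    exact sum_enorm_inner_sq_le f S d
  have h4 : ∀ S : Finset κ, ∫⁻ ω, ‖W t h ω - ⟪X t ω, g⟫_ℝ‖ₑ ^ 2 ∂P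
      ≤ 4 * ∫⁻ ω, ‖W t h ω - ∑ k ∈ S, β k t ω *
          ⟪ImageSpace.incl (opSqrt Q) (f k), h⟫_ℝ‖ₑ ^ 2 ∂P +
        4 * (4 * (ENNReal.ofReal t * ‖d‖ₑ ^ 2) +
          4 * (‖g‖ₑ ^ 2 * ∫⁻ ω, ‖X t ω - ∑ k ∈ S, β k t ω • ι (f k)‖ₑ ^ 2 ∂P)) := fun S => by
    have hmS : StronglyMeasurable fun ω => ⟪∑ k ∈ S, β k t ω • ι (f k), g⟫_ℝ :=
      (Finset.stronglyMeasurable_fun_sum S fun k _ => (hmβ k).smul_const (ι (f k))).inner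
        stronglyMeasurable_const
    refine (lintegral_enorm_sub_sq_le (g := fun ω => ∑ k ∈ S, β k t ω *
      ⟪ImageSpace.incl (opSqrt Q) (f k), h⟫_ℝ)
      ((hW.stronglyMeasurable t h).sub (hsum _ S)).aestronglyMeasurable).trans ?_
    gcongr
    refine (lintegral_enorm_sub_sq_le (g := fun ω => ⟪∑ k ∈ S, β k t ω • ι (f k), g⟫_ℝ)
      ((hsum _ S).sub hmS).aestronglyMeasurable).trans ?_
    gcongr
    · exact h2 S
    · rw [← lintegral_const_mul' _ _ (ENNReal.pow_ne_top enorm_ne_top)]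
      refine lintegral_mono fun ω => ?_
      rw [← inner_sub_left, ← mul_pow, mul_comm, ← enorm_neg (X t ω - _), neg_sub]
      gcongr
      rw [← ofReal_norm, ← ofReal_norm, ← ofReal_norm, ← ENNReal.ofReal_mul (norm_nonneg _)]
      exact ENNReal.ofReal_le_ofReal (abs_real_inner_le_norm _ _)
  have h5 := (ENNReal.Tendsto.const_mul (hWs t h) (Or.inr (by simp : (4 : ℝ≥0∞) ≠ ∞))).add
    (ENNReal.Tendsto.const_mul (tendsto_const_nhds (x := 4 * (ENNReal.ofReal t * ‖d‖ₑ ^ 2)).add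
      (ENNReal.Tendsto.const_mul (ENNReal.Tendsto.const_mul (hXs t)
        (Or.inr (ENNReal.pow_ne_top (n := 2) (enorm_ne_top (x := g)))))
        (Or.inr (by simp : (4 : ℝ≥0∞) ≠ ∞)))) (Or.inr (by simp : (4 : ℝ≥0∞) ≠ ∞)))
  refine (ge_of_tendsto' h5 h4).trans (le_of_eq ?_)
  simp only [mul_zero, add_zero, zero_add]
  rw [← mul_assoc]
  norm_num

/-- The range of `covMap` is dense in U₀, which provides approximants of ι^* g; the preceding
estimate shows that they work at every time. Basis and Brownian motions are forgotten here. -/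
lemma IsExtension.isRepr {ι : RKSpace Q →L[ℝ] E} {X : Time T → Ω → E}
    (hX : IsExtension 𝓕 P W ι X) (hW : IsGenWiener 𝓕 P Q W) : IsRepr 𝓕 P W ι X where
  adapted := hX.adapted
  continuous := hX.continuous
  approx g := by
    obtain ⟨u, hu, hlim⟩ := mem_closure_iff_seq_limit.1
      (denseRange_covMap Q (ContinuousLinearMap.adjoint ι g))
    choose h hh using hu
    refine ⟨h, by simpa only [hh] using hlim, fun t => ?_⟩
    refine tendsto_of_tendsto_of_tendsto_of_le_of_le tendsto_const_nhds ?_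
      (fun n => zero_le) (fun n => hX.lintegral_sub_sq_le hW t (h n) g)
    have h1 : Tendsto (fun n => ‖covMap Q (h n) - ContinuousLinearMap.adjoint ι g‖ₑ ^ 2) atTop
        (𝓝 0) := by
      simp_rw [hh]
      have h2 := (hlim.sub_const (ContinuousLinearMap.adjoint ι g)).enorm
      rw [sub_self, enorm_zero] at h2
      simpa using ENNReal.Tendsto.pow (n := 2) h2
    have h3 := ENNReal.Tendsto.const_mul (ENNReal.Tendsto.const_mul h1
      (Or.inr (ENNReal.ofReal_ne_top (r := (t : ℝ))))) (Or.inr (by simp : (16 : ℝ≥0∞) ≠ ∞))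
    simpa using h3

/-- The pair `(ι₁, ι₂)` of operators, with values in the Hilbert space `E₁ × E₂`. -/
def prodL2 {G : Type*} [NormedAddCommGroup G] [InnerProductSpace ℝ G] (ι₁ : G →L[ℝ] E₁)
    (ι₂ : G →L[ℝ] E₂) : G →L[ℝ] WithLp 2 (E₁ × E₂) :=
  (WithLp.prodContinuousLinearEquiv 2 ℝ E₁ E₂).symm ∘L ι₁.prod ι₂

lemma enorm_prodL2_sq {G : Type*} [NormedAddCommGroup G] [InnerProductSpace ℝ G]
    (ι₁ : G →L[ℝ] E₁) (ι₂ : G →L[ℝ] E₂) (x : G) :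
    ‖prodL2 ι₁ ι₂ x‖ₑ ^ 2 = ‖ι₁ x‖ₑ ^ 2 + ‖ι₂ x‖ₑ ^ 2 := by
  rw [enorm_sq_eq_ofReal, WithLp.prod_norm_sq_eq_of_L2,
    ENNReal.ofReal_add (sq_nonneg _) (sq_nonneg _), enorm_sq_eq_ofReal, enorm_sq_eq_ofReal]
  rfl

lemma isHilbertSchmidt_prodL2 {G : Type*} [NormedAddCommGroup G] [InnerProductSpace ℝ G]
    [CompleteSpace G] {ι₁ : G →L[ℝ] E₁} {ι₂ : G →L[ℝ] E₂} (h₁ : IsHilbertSchmidt ι₁)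
    (h₂ : IsHilbertSchmidt ι₂) : IsHilbertSchmidt (prodL2 ι₁ ι₂) := by
  unfold IsHilbertSchmidt hsNormSq at *
  simp_rw [enorm_prodL2_sq]
  rw [ENNReal.tsum_add]
  exact ENNReal.add_lt_top.2 ⟨h₁, h₂⟩

lemma adjoint_prodL2 {G : Type*} [NormedAddCommGroup G] [InnerProductSpace ℝ G] [CompleteSpace G]
    (ι₁ : G →L[ℝ] E₁) (ι₂ : G →L[ℝ] E₂) (g : WithLp 2 (E₁ × E₂)) :
    ContinuousLinearMap.adjoint (prodL2 ι₁ ι₂) g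
      = ContinuousLinearMap.adjoint ι₁ g.fst + ContinuousLinearMap.adjoint ι₂ g.snd := by
  refine ext_inner_left ℝ fun x => ?_
  rw [ContinuousLinearMap.adjoint_inner_right, inner_add_right,
    ContinuousLinearMap.adjoint_inner_right, ContinuousLinearMap.adjoint_inner_right,
    WithLp.prod_inner_apply]
  rfl

/-- Two representations of the same process, taken together, represent it. -/
lemma IsRepr.prod {ι₁ : RKSpace Q →L[ℝ] E₁} {ι₂ : RKSpace Q →L[ℝ] E₂} {X₁ : Time T → Ω → E₁}
    {X₂ : Time T → Ω → E₂} (h₁ : IsRepr 𝓕 P W ι₁ X₁) (h₂ : IsRepr 𝓕 P W ι₂ X₂)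
    (hW : IsGenWiener 𝓕 P Q W) :
    IsRepr 𝓕 P W (prodL2 ι₁ ι₂) (fun t ω => WithLp.toLp 2 (X₁ t ω, X₂ t ω)) where
  adapted t := (WithLp.prod_continuous_toLp 2 E₁ E₂).comp_stronglyMeasurable
    ((h₁.adapted t).prodMk (h₂.adapted t))
  continuous := by
    filter_upwards [h₁.continuous, h₂.continuous] with ω hω₁ hω₂
    exact (WithLp.prod_continuous_toLp 2 E₁ E₂).comp (hω₁.prodMk hω₂)
  approx g := by
    obtain ⟨u₁, hu₁, hl₁⟩ := h₁.approx g.fst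
    obtain ⟨u₂, hu₂, hl₂⟩ := h₂.approx g.snd
    -- (ι₁, ι₂)^* g = ι₁^* g₁ + ι₂^* g₂, and W is additive, so approximants for the two components
    -- are added.
    refine ⟨fun n => u₁ n + u₂ n, ?_, fun t => ?_⟩
    · rw [adjoint_prodL2]
      simpa only [map_add] using hu₁.add hu₂
    · have h3 := (ENNReal.Tendsto.const_mul (hl₁ t) (Or.inr (by simp : (4 : ℝ≥0∞) ≠ ∞))).add
        (ENNReal.Tendsto.const_mul (hl₂ t) (Or.inr (by simp : (4 : ℝ≥0∞) ≠ ∞)))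
      rw [mul_zero, add_zero] at h3
      refine tendsto_of_tendsto_of_tendsto_of_le_of_le tendsto_const_nhds h3
        (fun n => zero_le) (fun n => ?_)
      have hm : StronglyMeasurable fun ω => W t (u₁ n) ω - ⟪X₁ t ω, g.fst⟫_ℝ :=
        (hW.stronglyMeasurable t (u₁ n)).sub
          ((stronglyMeasurable_of_adapted h₁.adapted t).inner stronglyMeasurable_const)
      refine le_trans (le_of_eq (lintegral_congr_ae ?_))
        (lintegral_enorm_add_sq_le hm.aestronglyMeasurable)
      filter_upwards [hW.ae_add t (u₁ n) (u₂ n)] with ω hω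
      rw [hω, WithLp.prod_inner_apply]
      congr 2
      change _ - (⟪X₁ t ω, g.fst⟫_ℝ + ⟪X₂ t ω, g.snd⟫_ℝ) = _
      ring

end Series

/-! ### Joint Gaussianity -/

section JointGaussian

variable {Ω : Type*} {mΩ : MeasurableSpace Ω} {P : Measure Ω} [IsProbabilityMeasure P]
variable {T : ℝ} [Fact (0 < T)] {𝓕 : Filtration (Time T) mΩ}
variable {U : Type*} [NormedAddCommGroup U] [InnerProductSpace ℝ U] [CompleteSpace U]
variable {Q : U →L[ℝ] U} {W : Time T → U → Ω → ℝ}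

namespace IsGenWiener

/-- Induction on the largest time s: W_{g;t} is W_{g;s} plus a Gaussian increment independent of 𝓕
s, and W_{g;s} is absorbed into the term at s by linearity. The free term `W t g` is what closes the
induction. -/
lemma map_sum_add (hW : IsGenWiener 𝓕 P Q W) (S : Finset (Time T)) :
    ∀ (h : Time T → U) (t : Time T), (∀ r ∈ S, r ≤ t) → ∀ g : U,
      ∃ v : NNReal, P.map (fun ω => ∑ r ∈ S, W r (h r) ω + W t g ω) = gaussianReal 0 v := by
  classical
  induction S using Finset.induction_on_max with
  | empty =>
    intro h t _ g
    exact ⟨_, by simpa using hW.map_eq t g⟩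
  | insert s S hlt ih =>
    intro h t ht g
    have hst : s ≤ t := ht s (Finset.mem_insert_self _ _)
    have hs : s ∉ S := fun hs => (hlt s hs).false
    obtain ⟨v, hv⟩ := ih h s (fun r hr => (hlt r hr).le) (h s + g)
    have hm : StronglyMeasurable[𝓕 s] fun ω => ∑ r ∈ S, W r (h r) ω + W s (h s + g) ω := by
      refine StronglyMeasurable.add ?_ ((hW.isQWiener _).adapted s)
      exact Finset.stronglyMeasurable_fun_sum S fun r hr =>
        ((hW.isQWiener _).adapted r).mono (𝓕.mono (hlt r hr).le)
    have hi : IndepFun (fun ω => ∑ r ∈ S, W r (h r) ω + W s (h s + g) ω)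
        (fun ω => W t g ω - W s g ω) P := by
      rw [IndepFun_iff_Indep]
      exact (indep_of_indep_of_le_right (hW.indep hst g) hm.measurable.comap_le).symm
    have hv' := gaussianReal_add_gaussianReal_of_indepFun hi hv (hW.map_sub hst g)
    rw [add_zero] at hv'
    refine ⟨_, (Measure.map_congr ?_).trans hv'⟩
    filter_upwards [hW.ae_add s (h s) g] with ω hω
    rw [Finset.sum_insert hs, Pi.add_apply, hω]
    ring

/-- Linearity collects the terms with equal times into one. -/
lemma map_sum (hW : IsGenWiener 𝓕 P Q W) {κ : Type*} (S : Finset κ) (τ : κ → Time T) (h : κ → U)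
    (c : κ → ℝ) :
    ∃ v : NNReal, P.map (fun ω => ∑ k ∈ S, c k * W (τ k) (h k) ω) = gaussianReal 0 v := by
  classical
  obtain ⟨v, hv⟩ := hW.map_sum_add (S.image τ)
    (fun t => ∑ k ∈ S with τ k = t, c k • h k) ⊤ (fun _ _ => le_top) 0
  refine ⟨v, hv ▸ Measure.map_congr ?_⟩
  have h1 : ∀ᵐ ω ∂P, ∀ t ∈ S.image τ, W t (∑ k ∈ S with τ k = t, c k • h k) ω
      = ∑ k ∈ S with τ k = t, c k * W t (h k) ω :=
    (Finset.eventually_all _).2 fun t _ => hW.ae_sum t _ c h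
  have h2 : W ⊤ 0 =ᵐ[P] fun _ => 0 := by simpa using hW.linear ⊤ 0 0 0 0
  filter_upwards [h1, h2] with ω h1 h2
  rw [h2, add_zero, Finset.sum_congr rfl h1,
    ← Finset.sum_fiberwise_of_maps_to (s := S) (t := S.image τ) (g := τ)
      fun k hk => Finset.mem_image_of_mem τ hk]
  refine Finset.sum_congr rfl fun t _ => Finset.sum_congr rfl fun k hk => ?_
  rw [(Finset.mem_filter.1 hk).2]

lemma isGaussianProcess (hW : IsGenWiener 𝓕 P Q W) {κ : Type*} (h : κ → U) :
    IsGaussianProcess (fun (p : (_ : κ) × Time T) ω => W p.2 (h p.1) ω) P where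
  hasGaussianLaw I := by
    classical
    have hm : Measurable fun ω => I.restrict fun p : (_ : κ) × Time T => W p.2 (h p.1) ω :=
      measurable_pi_lambda _ fun p => (hW.stronglyMeasurable _ _).measurable
    refine ⟨isGaussian_of_map_eq_gaussianReal fun L => ?_⟩
    obtain ⟨v, hv⟩ := hW.map_sum (Finset.univ : Finset I) (fun p => p.1.2) (fun p => h p.1.1)
      (fun p => L (Pi.single p 1))
    refine ⟨0, v, ?_⟩
    rw [Measure.map_map L.continuous.measurable hm, ← hv]
    congr 1
    ext ω
    rw [Function.comp_apply, ← Finset.univ_sum_single (I.restrict _), _root_.map_sum]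
    refine Finset.sum_congr rfl fun p _ => ?_
    rw [mul_comm, ← smul_eq_mul, ← _root_.map_smul, ← Pi.single_smul, smul_eq_mul, mul_one]
    rfl

/-- For jointly Gaussian processes independence is vanishing of the cross covariances, which here
are multiples of inner products in U₀. -/
lemma iIndepFun_of_orthonormal (hW : IsGenWiener 𝓕 P Q W) {κ : Type*} {h : κ → U}
    (ho : Orthonormal ℝ fun k => covMap Q (h k)) : iIndepFun (fun k ω t => W t (h k) ω) P := by
  refine IsGaussianProcess.iIndepFun_of_covariance_eq_zero (X := fun k t => W t (h k))
    (hW.isGaussianProcess h) (fun k t => (hW.stronglyMeasurable t _).measurable.aemeasurable)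
    fun j k hjk s t => ?_
  rw [covariance_eq_sub (hW.memLp s _) (hW.memLp t _), hW.integral_eq_zero, zero_mul, sub_zero]
  have h1 := hW.covariance s t (h j) (h k)
  rw [← inner_covMap_covMap hW.isPositive, ho.2 hjk, mul_zero] at h1
  exact h1

end IsGenWiener

end JointGaussian

/-! ### Existence of Hilbert-Schmidt extensions -/

section ExtensionExists

variable {Ω : Type*} {mΩ : MeasurableSpace Ω} {P : Measure Ω} [IsProbabilityMeasure P]
variable {T : ℝ} [Fact (0 < T)] {𝓕 : Filtration (Time T) mΩ}
variable {U : Type*} [NormedAddCommGroup U] [InnerProductSpace ℝ U] [CompleteSpace U]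
variable {E : Type*} [NormedAddCommGroup E] [InnerProductSpace ℝ E] [CompleteSpace E]
variable {H : Type*} [NormedAddCommGroup H] [InnerProductSpace ℝ H] [CompleteSpace H]
variable {Q : U →L[ℝ] U} {W : Time T → U → Ω → ℝ}

lemma IsContL2Martingale.clm_apply {M : Time T → Ω → E} (hM : IsContL2Martingale 𝓕 P M)
    (L : E →L[ℝ] H) : IsContL2Martingale 𝓕 P (fun t ω => L (M t ω)) where
  martingale := by
    refine ⟨fun t => L.continuous.comp_stronglyMeasurable (hM.martingale.1 t), fun s t hst => ?_⟩
    refine (L.comp_condExp_comm ((hM.memLp t).integrable one_le_two)).symm.trans ?_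
    filter_upwards [hM.martingale.2 s t hst] with ω hω
    rw [Function.comp_apply, hω]
  continuous := by
    filter_upwards [hM.continuous] with ω hω
    exact L.continuous.comp hω
  sq_lt_top := (L.comp_memLp' (hM.memLp ⊤)).lintegral_sq_lt_top

lemma _root_.Finset.sum_sdiff_le_tsum_compl {κ : Type*} [DecidableEq κ] (f : κ → ℝ≥0∞) (S S' : Finset κ) :
    ∑ k ∈ S' \ S, f k ≤ ∑' k : {k // k ∉ S}, f k := by
  have h1 : ∑' k : {k // k ∉ S}, f k = ∑' k, Set.indicator {k | k ∉ S} f k :=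
    tsum_subtype {k | k ∉ S} f
  rw [h1]
  refine le_trans (le_of_eq (Finset.sum_congr rfl fun k hk => ?_)) (ENNReal.sum_le_tsum (S' \ S))
  rw [Set.indicator_of_mem]
  exact (Finset.mem_sdiff.1 hk).2

/-- A series of orthogonal continuous martingales with square summable terms converges. -/
lemma exists_tendsto_sum_martingale (h𝓕 : IsNormal 𝓕 P) {κ : Type*} [Countable κ]
    {b : κ → Time T → Ω → ℝ} (hb : ∀ k, IsContL2Martingale 𝓕 P (b k))
    (hc : ∀ k t, ∫⁻ ω, ‖b k t ω‖ₑ ^ 2 ∂P = ENNReal.ofReal t)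
    (ho : ∀ t j k, j ≠ k → ∫ ω, b j t ω * b k t ω ∂P = 0) {x : κ → E}
    (hx : ∑' k, ‖x k‖ₑ ^ 2 < ∞) :
    ∃ N : Time T → Ω → E, IsContL2Martingale 𝓕 P N ∧
      ∀ t, Tendsto (fun S : Finset κ => ∫⁻ ω, ‖N t ω - ∑ k ∈ S, b k t ω • x k‖ₑ ^ 2 ∂P)
        atTop (𝓝 0) := by
  classical
  set Y : Finset κ → Time T → Ω → E := fun S t ω => ∑ k ∈ S, b k t ω • x k with hY
  -- The tail of the series beyond `S`; times t, it bounds the mean square of every difference of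
  -- partial sums starting from `S`.
  set r : Finset κ → ℝ≥0∞ := fun S => ∑' k : {k // k ∉ S}, ‖x k‖ₑ ^ 2 with hr
  have hr0 : Tendsto r atTop (𝓝 0) := ENNReal.tendsto_tsum_compl_atTop_zero hx.ne
  have hYM : ∀ S, IsContL2Martingale 𝓕 P (Y S) := fun S => IsContL2Martingale.sum S fun k _ =>
    (hb k).clm_apply (ContinuousLinearMap.toSpanSingleton ℝ (x k))
  have hYS : ∀ S S' t, S ⊆ S' →
      ∫⁻ ω, ‖Y S' t ω - Y S t ω‖ₑ ^ 2 ∂P ≤ ENNReal.ofReal t * r S := fun S S' t hSS' => by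
    have h1 : ∀ ω, Y S' t ω - Y S t ω = ∑ k ∈ S' \ S, b k t ω • x k := fun ω =>
      (Finset.sum_sdiff_eq_sub hSS').symm
    simp_rw [h1]
    rw [lintegral_sum_smul_sq (fun k => (hb k).memLp t) (fun k => hc k t) (ho t)]
    gcongr
    exact Finset.sum_sdiff_le_tsum_compl (fun k => ‖x k‖ₑ ^ 2) S S'
  have hm : ∀ S t, AEStronglyMeasurable (Y S t) P := fun S t => (hYM S).aestronglyMeasurable t
  have hr8 : ∀ t : Time T, Tendsto (fun S => 8 * (ENNReal.ofReal t * r S)) atTop (𝓝 0) := fun t => by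
    simpa using ENNReal.Tendsto.const_mul (ENNReal.Tendsto.const_mul hr0
      (Or.inr (ENNReal.ofReal_ne_top (r := (t : ℝ))))) (Or.inr (by simp : (8 : ℝ≥0∞) ≠ ∞))
  -- Completeness is available for sequences, so the limit is taken along a sequence cofinal in the
  -- finite sets; the tail bound then gives convergence of the whole net.
  obtain ⟨S, hS⟩ := exists_seq_tendsto (atTop : Filter (Finset κ))
  obtain ⟨N, hN, -, hlim⟩ := exists_limit_of_cauchy h𝓕 (M := fun n => Y (S n))
    (fun n => hYM (S n)) fun ε hε => by
      obtain ⟨S₀, hS₀⟩ := ((hr8 ⊤).eventually (eventually_le_nhds hε)).exists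
      obtain ⟨n₀, hn₀⟩ := eventually_atTop.1 (hS.eventually (eventually_ge_atTop S₀))
      refine ⟨n₀, fun m hm' n hn => ?_⟩
      refine (lintegral_enorm_sub_sq_le (g := Y S₀ ⊤) ((hm _ _).sub (hm _ _))).trans ?_
      have h2 : ∫⁻ ω, ‖Y S₀ ⊤ ω - Y (S n) ⊤ ω‖ₑ ^ 2 ∂P
          ≤ ENNReal.ofReal (⊤ : Time T) * r S₀ := by
        refine le_trans (le_of_eq (lintegral_congr fun ω => ?_)) (hYS S₀ (S n) ⊤ (hn₀ n hn))
        rw [← enorm_neg, neg_sub]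
      refine (add_le_add (mul_le_mul_right (hYS S₀ (S m) ⊤ (hn₀ m hm')) 4)
        (mul_le_mul_right h2 4)).trans (le_trans (le_of_eq ?_) hS₀)
      rw [← add_mul]
      norm_num
  refine ⟨N, hN, fun t => ?_⟩
  have hlim' : Tendsto (fun n => ∫⁻ ω, ‖N t ω - Y (S n) t ω‖ₑ ^ 2 ∂P) atTop (𝓝 0) := by
    refine tendsto_of_tendsto_of_tendsto_of_le_of_le tendsto_const_nhds hlim
      (fun n => zero_le) (fun n => ?_)
    refine le_trans (le_of_eq (lintegral_congr fun ω => ?_)) ((hYM (S n)).lintegral_sub_sq_le hN t)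
    rw [← enorm_neg, neg_sub]
  refine tendsto_of_tendsto_of_tendsto_of_le_of_le tendsto_const_nhds (hr8 t)
    (fun S => zero_le) (fun S' => ?_)
  have h3 : ∀ᶠ n in atTop, ∫⁻ ω, ‖N t ω - Y S' t ω‖ₑ ^ 2 ∂P
      ≤ 4 * ∫⁻ ω, ‖N t ω - Y (S n) t ω‖ₑ ^ 2 ∂P + 4 * (ENNReal.ofReal t * r S') := by
    filter_upwards [hS.eventually (eventually_ge_atTop S')] with n hn
    refine (lintegral_enorm_sub_sq_le (g := Y (S n) t)
      ((hN.aestronglyMeasurable t).sub (hm _ _))).trans ?_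
    gcongr
    exact hYS S' (S n) t hn
  have h4 := (ENNReal.Tendsto.const_mul hlim' (Or.inr (by simp : (4 : ℝ≥0∞) ≠ ∞))).add_const
    (4 * (ENNReal.ofReal t * r S'))
  rw [mul_zero, zero_add] at h4
  refine (ge_of_tendsto h4 h3).trans ?_
  gcongr
  norm_num

/-- Every generalised Wiener process has a representation in a Hilbert-Schmidt extension. -/
theorem exists_isExtension [TopologicalSpace.SeparableSpace U] (h𝓕 : IsNormal 𝓕 P)
    (hW : IsGenWiener 𝓕 P Q W) {ι : RKSpace Q →L[ℝ] E} (hι : IsHilbertSchmidt ι) :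
    ∃ X, IsExtension 𝓕 P W ι X := by
  -- Basis vectors of the form `covMap Q (h k)` allow the choice β^k = W_{h k}, with no need to
  -- extend W to U₀.
  obtain ⟨κ, f, h, hf⟩ := exists_hilbertBasis_covMap Q
  have : Countable κ := Orthonormal.countable_of_separable f.orthonormal
  have hfn : ∀ k, ‖f k‖ = 1 := f.orthonormal.1
  have hβ : ∀ k, IsQWiener 𝓕 P (ContinuousLinearMap.id ℝ ℝ) (fun t => W t (h k)) := fun k => by
    simpa [← hf, hfn] using hW.isQWiener (h k)
  obtain ⟨X, hX, hlim⟩ := exists_tendsto_sum_martingale h𝓕 (b := fun k t => W t (h k))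
    (fun k => (hβ k).isWienerLike.isContL2Martingale)
    (fun k t => ((hβ k).lintegral_sq_of_standard t).1)
    (fun t j k hjk => by
      have h1 := hW.covariance t t (h j) (h k)
      rw [← inner_covMap_covMap hW.isPositive, ← hf, ← hf, f.orthonormal.2 hjk, mul_zero] at h1
      exact h1) (x := fun k => ι (f k)) (by rwa [← hsNormSq_eq_tsum f ι])
  refine ⟨X, hX.martingale.1, hX.continuous, κ, f, fun k t => W t (h k), hβ,
    hW.iIndepFun_of_orthonormal (by simpa only [← hf] using f.orthonormal), fun t g => ?_, hlim⟩
  -- The partial sum is W at a vector whose image in U₀ is the projection of `covMap Q g` onto the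
  -- span of the f_k with k in S.
  have h1 : ∀ S : Finset κ, ∫⁻ ω, ‖W t g ω - ∑ k ∈ S, W t (h k) ω *
      ⟪ImageSpace.incl (opSqrt Q) (f k), g⟫_ℝ‖ₑ ^ 2 ∂P
        = ENNReal.ofReal t * ‖covMap Q g - ∑ k ∈ S, f.repr (covMap Q g) k • f k‖ₑ ^ 2 := fun S => by
    have h2 : covMap Q (∑ k ∈ S, f.repr (covMap Q g) k • h k)
        = ∑ k ∈ S, f.repr (covMap Q g) k • f k := by
      simp only [map_sum, _root_.map_smul, hf]
    rw [← h2, ← hW.lintegral_sub_sq]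
    refine lintegral_congr_ae ?_
    filter_upwards [hW.ae_sum t S (f.repr (covMap Q g)) h] with ω hω
    rw [hω]
    congr 4
    ext k
    rw [mul_comm, ← inner_covMap, HilbertBasis.repr_apply_apply]
  simp_rw [h1]
  have h3 : Tendsto (fun S : Finset κ => covMap Q g - ∑ k ∈ S, f.repr (covMap Q g) k • f k)
      atTop (𝓝 0) := by
    simpa using (f.hasSum_repr (covMap Q g)).const_sub (covMap Q g)
  have h4 := ENNReal.Tendsto.const_mul (ENNReal.Tendsto.pow (n := 2) h3.enorm)
    (Or.inr (ENNReal.ofReal_ne_top (r := (t : ℝ))))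
  simpa using h4

end ExtensionExists

/-! ### Integrands on the covariance space of an extension -/

section Transfer

variable {Ω : Type*} {mΩ : MeasurableSpace Ω} {P : Measure Ω} [IsProbabilityMeasure P]
variable {T : ℝ} [Fact (0 < T)] {𝓕 : Filtration (Time T) mΩ}
variable {U : Type*} [NormedAddCommGroup U] [InnerProductSpace ℝ U] [CompleteSpace U]
variable {E : Type*} [NormedAddCommGroup E] [InnerProductSpace ℝ E] [CompleteSpace E]
variable {H : Type*} [NormedAddCommGroup H] [InnerProductSpace ℝ H] [CompleteSpace H]
variable {Q : U →L[ℝ] U} {ι : RKSpace Q →L[ℝ] E} {J : RKSpace Q ≃ₗᵢ[ℝ] RKSpace (extCov ι)}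
variable {φ : Time T → Ω → HSOp (RKSpace Q) H} {ψ : Time T → Ω → HSOp (RKSpace (extCov ι)) H}

lemma isCompInv_compIsometry (hJ : ∀ x, ImageSpace.incl (opSqrt (extCov ι)) (J x) = ι x) :
    IsCompInv ι φ fun t ω => HSOp.compIsometry J.symm (φ t ω) := fun t ω y =>
  ⟨J.symm y, by rw [← hJ, J.apply_symm_apply], rfl⟩

/-- Injectivity of ι makes the preimage in `IsCompInv` unique, so ψ is determined by φ. -/
lemma IsCompInv.compIsometry_eq (h : IsCompInv ι φ ψ) (hι : Function.Injective ι)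
    (hJ : ∀ x, ImageSpace.incl (opSqrt (extCov ι)) (J x) = ι x) (t : Time T) (ω : Ω) :
    HSOp.compIsometry J (ψ t ω) = φ t ω := by
  refine HSOp.toCLM_injective (ContinuousLinearMap.ext fun x => ?_)
  obtain ⟨x', hx', h'⟩ := h t ω (J x)
  rw [hJ] at hx'
  rw [HSOp.toCLM_compIsometry_apply, h', hι hx']

lemma HSOp.compIsometry_symm_compIsometry (S : HSOp (RKSpace (extCov ι)) H) :
    HSOp.compIsometry J.symm (HSOp.compIsometry J S) = S := by
  refine HSOp.toCLM_injective (ContinuousLinearMap.ext fun x => ?_)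
  rw [HSOp.toCLM_compIsometry_apply, HSOp.toCLM_compIsometry_apply, J.apply_symm_apply]

lemma IsIntegrand.of_compIsometry (hφ : IsIntegrand 𝓕 P φ)
    (h : ∀ t ω, HSOp.compIsometry J (ψ t ω) = φ t ω) : IsIntegrand 𝓕 P ψ where
  predictable := by
    have h1 : Function.uncurry ψ = fun p => HSOp.compIsometry J.symm (Function.uncurry φ p) := by
      ext1 p
      simp only [Function.uncurry, ← h, HSOp.compIsometry_symm_compIsometry]
    have h2 : IsStronglyPredictable 𝓕 φ := hφ.predictable
    unfold IsStronglyPredictable at h2 ⊢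
    rw [h1]
    exact (HSOp.compIsometry J.symm).continuous.comp_stronglyMeasurable h2
  sq_integrable := by
    filter_upwards [hφ.sq_integrable] with ω hω
    simpa only [← h, LinearIsometry.enorm_map] using hω

/-- Composition with `J` preserves Hilbert-Schmidt norms and turns the inclusion of Q₁^{1/2}(U₁)
into ι. The same simple processes approximate on both sides, and their integrals do not involve the
integrand space. -/
lemma isSqIntegral_iff_isL2Integral {X : Time T → Ω → E} {M : Time T → Ω → H}
    (hJ : ∀ x, ImageSpace.incl (opSqrt (extCov ι)) (J x) = ι x)
    (h : ∀ t ω, HSOp.compIsometry J (ψ t ω) = φ t ω) :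
    IsSqIntegral 𝓕 P (extCov ι) X ψ M ↔ IsL2Integral 𝓕 P ι X φ M := by
  have h1 : ∀ (A : E →L[ℝ] H) t ω,
      hsNormSq (A ∘L ImageSpace.incl (opSqrt (extCov ι)) - HSOp.toCLM (ψ t ω))
        = hsNormSq (A ∘L ι - HSOp.toCLM (φ t ω)) := fun A t ω => by
    rw [← hsNormSq_comp_linearIsometryEquiv _ J, ← h]
    congr 1
    ext x
    simp [hJ]
  constructor
  · rintro ⟨Φ, hΦ⟩
    exact ⟨Φ, by simpa only [h1] using hΦ⟩
  · rintro ⟨Φ, hΦ⟩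
    exact ⟨Φ, by simpa only [h1] using hΦ⟩

lemma compIsometry_truncate (h : ∀ t ω, HSOp.compIsometry J (ψ t ω) = φ t ω)
    (τ : Ω → WithTop (Time T)) (t : Time T) (ω : Ω) :
    HSOp.compIsometry J (truncate τ ψ t ω) = truncate τ φ t ω := by
  unfold truncate
  split_ifs
  · exact h t ω
  · exact map_zero _

lemma isStochIntegral_iff_isLocalIntegral {X : Time T → Ω → E} {M : Time T → Ω → H}
    (hJ : ∀ x, ImageSpace.incl (opSqrt (extCov ι)) (J x) = ι x)
    (h : ∀ t ω, HSOp.compIsometry J (ψ t ω) = φ t ω) :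
    IsStochIntegral 𝓕 P (extCov ι) X ψ M ↔ IsLocalIntegral 𝓕 P ι X φ M := by
  have h1 : ∀ (τ : Ω → WithTop (Time T)) N, IsSqIntegral 𝓕 P (extCov ι) X (truncate τ ψ) N
      ↔ IsL2Integral 𝓕 P ι X (truncate τ φ) N := fun τ N =>
    isSqIntegral_iff_isL2Integral hJ (compIsometry_truncate h τ)
  have h2 : ∀ (τ : Ω → WithTop (Time T)) t ω, ‖truncate τ ψ t ω‖ₑ = ‖truncate τ φ t ω‖ₑ :=
    fun τ t ω => by rw [← compIsometry_truncate h, LinearIsometry.enorm_map]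
  constructor
  · rintro ⟨ha, hc, τ, hτ, hl⟩
    exact ⟨ha, hc, τ, hτ, by simpa only [h1, h2] using hl⟩
  · rintro ⟨ha, hc, τ, hτ, hl⟩
    exact ⟨ha, hc, τ, hτ, by simpa only [h1, h2] using hl⟩

end Transfer

end GenWiener

end

/-! ### The main theorem -/

theorem mainTheorem7
    {Ω : Type*} [mΩ : MeasurableSpace Ω] (P : Measure Ω) [IsProbabilityMeasure P]
    (T : ℝ) [Fact (0 < T)]
    (𝓕 : Filtration (GenWiener.Time T) mΩ) (h𝓕 : GenWiener.IsNormal 𝓕 P)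
    {U : Type*} [NormedAddCommGroup U] [InnerProductSpace ℝ U] [CompleteSpace U]
    [TopologicalSpace.SeparableSpace U]
    {H : Type*} [NormedAddCommGroup H] [InnerProductSpace ℝ H] [CompleteSpace H]
    [TopologicalSpace.SeparableSpace H]
    (Q : U →L[ℝ] U) (W : GenWiener.Time T → U → Ω → ℝ)
    (hW : GenWiener.IsGenWiener 𝓕 P Q W)
    (φ : GenWiener.Time T → Ω → GenWiener.HSOp (GenWiener.RKSpace Q) H)
    (hφ : GenWiener.IsIntegrand 𝓕 P φ)
    {U₁ : Type*} [NormedAddCommGroup U₁] [InnerProductSpace ℝ U₁] [CompleteSpace U₁]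
    [TopologicalSpace.SeparableSpace U₁]
    (ι₁ : GenWiener.RKSpace Q →L[ℝ] U₁) (hι₁ : GenWiener.IsHSEmbedding ι₁)
    {U₂ : Type*} [NormedAddCommGroup U₂] [InnerProductSpace ℝ U₂] [CompleteSpace U₂]
    [TopologicalSpace.SeparableSpace U₂]
    (ι₂ : GenWiener.RKSpace Q →L[ℝ] U₂) (hι₂ : GenWiener.IsHSEmbedding ι₂) :
    (∃ W₁, GenWiener.IsExtension 𝓕 P W ι₁ W₁) ∧
    (∃ ψ₁, GenWiener.IsCompInv ι₁ φ ψ₁) ∧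
    (∀ W₁ ψ₁, GenWiener.IsExtension 𝓕 P W ι₁ W₁ → GenWiener.IsCompInv ι₁ φ ψ₁ →
      GenWiener.IsQWiener 𝓕 P (GenWiener.extCov ι₁) W₁ ∧
      GenWiener.IsIntegrand 𝓕 P ψ₁ ∧
      ∃ M : GenWiener.Time T → Ω → H,
        GenWiener.IsStochIntegral 𝓕 P (GenWiener.extCov ι₁) W₁ ψ₁ M ∧
        GenWiener.IsContLocalMartingale 𝓕 P M) ∧
    (∀ W₁ ψ₁ M₁ W₂ ψ₂ M₂,
      GenWiener.IsExtension 𝓕 P W ι₁ W₁ → GenWiener.IsCompInv ι₁ φ ψ₁ →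
      GenWiener.IsStochIntegral 𝓕 P (GenWiener.extCov ι₁) W₁ ψ₁ M₁ →
      GenWiener.IsExtension 𝓕 P W ι₂ W₂ → GenWiener.IsCompInv ι₂ φ ψ₂ →
      GenWiener.IsStochIntegral 𝓕 P (GenWiener.extCov ι₂) W₂ ψ₂ M₂ →
      ∀ᵐ ω ∂P, ∀ t, M₁ t ω = M₂ t ω) := by
  obtain ⟨J₁, hJ₁⟩ := GenWiener.exists_polar hι₁.injective
  obtain ⟨J₂, hJ₂⟩ := GenWiener.exists_polar hι₂.injective
  refine ⟨GenWiener.exists_isExtension h𝓕 hW hι₁.hilbertSchmidt, ⟨_, GenWiener.isCompInv_compIsometry hJ₁⟩,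
    fun W₁ ψ₁ hW₁ hψ₁ => ?_, fun W₁ ψ₁ M₁ W₂ ψ₂ M₂ hW₁ hψ₁ hM₁ hW₂ hψ₂ hM₂ => ?_⟩
  · have hX := hW₁.isRepr hW
    have h := hψ₁.compIsometry_eq hι₁.injective hJ₁
    obtain ⟨M, hM, hM'⟩ := GenWiener.exists_isLocalIntegral h𝓕 (hX.isWienerLike hW hι₁.hilbertSchmidt)
      (GenWiener.denseRange_adjoint hι₁.injective) hφ
    exact ⟨hX.isQWiener hW hι₁.hilbertSchmidt, hφ.of_compIsometry h, M,
      (GenWiener.isStochIntegral_iff_isLocalIntegral hJ₁ h).2 hM, hM'⟩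
  · have hX₁ := hW₁.isRepr hW
    have hX₂ := hW₂.isRepr hW
    -- The pair (W₁, W₂) in the Hilbert sum of U₁ and U₂ is the common integrator; its coordinate
    -- projections serve as `A₁` and `A₂`.
    have hX := (hX₁.prod hX₂ hW).isWienerLike hW
      (GenWiener.isHilbertSchmidt_prodL2 hι₁.hilbertSchmidt hι₂.hilbertSchmidt)
    exact GenWiener.IsLocalIntegral.indistinguishable h𝓕 hX (A₁ := WithLp.fstL 2 ℝ U₁ U₂)
      (A₂ := WithLp.sndL 2 ℝ U₁ U₂) (hX₁.isWienerLike hW hι₁.hilbertSchmidt)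
      (hX₂.isWienerLike hW hι₂.hilbertSchmidt) rfl rfl (fun _ _ => rfl) (fun _ _ => rfl)
      hφ.predictable
      ((GenWiener.isStochIntegral_iff_isLocalIntegral hJ₁
        (hψ₁.compIsometry_eq hι₁.injective hJ₁)).1 hM₁)
      ((GenWiener.isStochIntegral_iff_isLocalIntegral hJ₂
        (hψ₂.compIsometry_eq hι₂.injective hJ₂)).1 hM₂)
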